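/- **Theorem (Replicability and regret bound for RepLinUCB).** *Setting.* Let $d,T\ge 1$, $\lambda,L>0$, $\sigma,S\ge 0$. The action sets $A_1,\dots,A_T\subset\mathbb R^d$ are nonempty and compact, fixed in advance (oblivious adversary), with $\|a\|_2\le L$ for all $a\in A_t$. Let $\theta^\star\in\mathbb R^d$ with $\|\theta^\star\|_2\le S$. In round $t$ the learner plays $a_t\in A_t$ and observes $r_t=\langle a_t,\theta^\star\rangle+\varepsilon_t$, where for all $t\le T$ and $\gamma\in\mathbb R$ $$\mathbb E\big[\exp(\gamma\varepsilon_t)\,\big|\,a_1,r_1,\dots,a_{t-1},r_{t-1},a_t\big]\le\exp(\sigma^2\gamma^2/2).$$ The noise $\varepsilon_t$ is a function of the reward randomness of the execution and of the actions $a_1,\dots,a_t$; the reward randomness is independent of the internal randomness of the algorithm. The regret is $\mathrm{Reg}(T)=\sum_{t=1}^T\big(\max_{a\in A_t}\langle a,\theta^\star\rangle-\langle a_t,\theta^\star\rangle\big)$. For positive semidefinite $M$ write $\|x\|_M=\sqrt{x^\top Mx}$. *RepRidge$(\lambda,\delta,\rho;(x_i,y_i)_{i=1}^n)$.* Put $V=\lambda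 I+\sum_{i=1}^n x_ix_i^\top$, $\widehat\theta=V^{-1}\sum_{i=1}^n y_ix_i$, $\beta=\sigma\sqrt{2\log\frac{\det(V)^{1/2}}{\det(\lambda I)^{1/2}\delta}}+\sqrt\lambda\,S$ and $\alpha=\frac{2\beta\sqrt d}{\rho-2\delta}$. Draw $w$ uniformly from $[0,1)^d$, let $u=\alpha w$ (uniform on $[0,\alpha)^d$), and return $V^{-1/2}Q_{\alpha,u}(V^{1/2}\widehat\theta)$, where $Q_{\alpha,u}(z)_j=\alpha\lfloor (z_j-u_j)/\alpha\rfloor+u_j+\alpha/2$ (and $Q_{0,0}=0$). *RepLinUCB* with batch budget $B$, growth factor $q$ and budgets $(\delta_b,\rho_b)_{0\le b<B}$. Put $V_t=\lambda I+\sum_{s<t}a_sa_s^\top$. Batch $b=0$ starts at time $t_0=1$. When batch $b$ starts, at time $t_b$, compute $\widetilde\theta_b=\mathrm{RepRidge}(\lambda,\delta_b,\rho_b;(a_s,r_s)_{s<t_b})$ with fresh internal randomness $w_b$, and $\widetilde\beta_b=\beta_b\big(1+\frac{d}{\rho_b-2\delta_b}\big)$, where $\beta_b$ is the value of $\beta$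 in this call. In each round $t$ of batch $b$ play $a_t\in\arg\max_{a\in A_t}\{\langle a,\widetilde\theta_b\rangle+\widetilde\beta_b\|a\|_{V_{t_b}^{-1}}\}$, ties being broken by a fixed (deterministic, measurable) rule. After round $t$, if $b\le B-2$ and $\det V_{t+1}>q\det V_{t_b}$, start batch $b+1$ at time $t_{b+1}=t+1$. *Parameters.* Let $0<\delta<1$, $3\delta<\rho<1$, $\Lambda=d\log\big(1+\frac{TL^2}{\lambda d}\big)$ and $$B=\lceil\Lambda\rceil,\qquad q=\Big(1+\frac{TL^2}{\lambda d}\Big)^{d/B},\qquad \delta_b=\frac{\delta}{B},\qquad \rho_b=\frac{\rho}{B}\qquad(0\le b<B).$$ *Conclusion.* There are a universal constant $C>0$ and a function $K(\sigma,S,\lambda,L)$ such that in every such situation the following holds, with $R=\Big(\sigma\sqrt{\Lambda+\log(B/\delta)}+\sqrt\lambda\,S\Big)\Big(1+\frac{dB}{\rho}\Big)$. 1. (Replicability) Two executions of RepLinUCB on $(A_t)_{t=1}^T$ with the same internal randomness $(w_b)_b$ and independent, identically distributed reward randomness satisfy $\mathbb P\big(\forall t\in[T]:a^{(1)}_t=a^{(2)}_t\big)\ge1-\rho$.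 2. (Regret) With probability at least $1-\delta$, $$\mathrm{Reg}(T)\le C\max\Big\{1,\frac{L}{\sqrt\lambda}\Big\}\Big(\sigma\sqrt{\Lambda+\log(B/\delta)}+\sqrt\lambda\,S\Big)\Big(1+\frac{dB}{\rho}\Big)\sqrt{T\,d\log\Big(1+\frac{TL^2}{\lambda d}\Big)}.$$ In particular the constant is the universal $C$ when $L^2\le\lambda$. 3. (Regret, bounded losses) If $\max_{a'\in A_t}\langle a',\theta^\star\rangle-\langle a,\theta^\star\rangle\le G$ for all $t\le T$ and $a\in A_t$ (for example $G=1$ when mean rewards lie in $[0,1]$), then with probability at least $1-\delta$, $\mathrm{Reg}(T)\le C\max\{G,R\}\sqrt{T\Lambda}$. 4. (Rate) With probability at least $1-\delta$, $\mathrm{Reg}(T)\le K(\sigma,S,\lambda,L)\,\big(d+\frac{d^3}{\rho}\big)\sqrt T\,\log^2\big(e+\frac{dT}{\delta}\big)$; that is, $\mathrm{Reg}(T)=\widetilde O\big((d+\frac{d^3}{\rho})\sqrt T\big)$ for fixed $\sigma,S,\lambda,L$. -/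

import Mathlib

open MeasureTheory

noncomputable section

/-! ### Ridge regression

Vectors of `ℝ^d` are functions `Fin d → ℝ`; Euclidean inner products are written `⬝ᵥ`.
A data set of size `n` is given by the first `n` entries of two sequences `x` (covariates) and
`y` (responses). -/

namespace RepLin

/-- The Euclidean norm on `ℝ^d`. -/
def euclNorm {d : ℕ} (x : Fin d → ℝ) : ℝ := ‖WithLp.toLp 2 x‖

/-- The norm `‖x‖_M = √(xᵀ M x)`. -/
def matNorm {d : ℕ} (M : Matrix (Fin d) (Fin d) ℝ) (x : Fin d → ℝ) : ℝ :=
  √(x ⬝ᵥ (M.mulVec x))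

/-- The regularized Gram matrix `λ I + ∑_{i < n} x_i x_iᵀ`. -/
def gram {d : ℕ} (lam : ℝ) (n : ℕ) (x : ℕ → Fin d → ℝ) : Matrix (Fin d) (Fin d) ℝ :=
  lam • (1 : Matrix (Fin d) (Fin d) ℝ) + ∑ i ∈ Finset.range n, Matrix.vecMulVec (x i) (x i)

/-- The ridge estimator `V_n⁻¹ ∑_{i < n} y_i x_i`. -/
def ridge {d : ℕ} (lam : ℝ) (n : ℕ) (x : ℕ → Fin d → ℝ) (y : ℕ → ℝ) : Fin d → ℝ :=
  (gram lam n x)⁻¹.mulVec (∑ i ∈ Finset.range n, y i • x i)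

/-- The ridge confidence radius
`σ √(2 log (det(V_n)^{1/2} / (det(λ I)^{1/2} δ))) + √λ S`. -/
def confRadius {d : ℕ} (sigma S lam delta : ℝ) (n : ℕ) (x : ℕ → Fin d → ℝ) : ℝ :=
  sigma * √(2 * Real.log (√((gram lam n x).det) /
      (√((lam • (1 : Matrix (Fin d) (Fin d) ℝ)).det) * delta))) + √lam * S

/-- The width of the rounding grid. -/
def gridWidth {d : ℕ} (sigma S lam delta rho : ℝ) (n : ℕ) (x : ℕ → Fin d → ℝ) : ℝ :=
  2 * confRadius sigma S lam delta n x * √(d : ℝ) / (rho - 2 * delta)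

/-- Rounding of each coordinate to the midpoint of its cell in the grid of width `α` shifted
by `u`. -/
def gridRound {d : ℕ} (α : ℝ) (u z : Fin d → ℝ) : Fin d → ℝ :=
  fun j => α * (⌊(z j - u j) / α⌋ : ℝ) + u j + α / 2

/-- The symmetric square root of a positive definite matrix, through the functional calculus. -/
def matSqrt {d : ℕ} (V : Matrix (Fin d) (Fin d) ℝ) : Matrix (Fin d) (Fin d) ℝ :=
  cfc Real.sqrt V

/-- Replicable ridge regression. The internal randomness is `w`, uniform on `[0,1)^d`; the shift
of the grid is `u = α w`, which is uniform on `[0,α)^d`. -/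
def repRidge {d : ℕ} (sigma S lam delta rho : ℝ) (n : ℕ) (x : ℕ → Fin d → ℝ) (y : ℕ → ℝ)
    (w : Fin d → ℝ) : Fin d → ℝ :=
  let V := gram lam n x
  let z := (matSqrt V).mulVec (ridge lam n x y)
  let α := gridWidth sigma S lam delta rho n x
  (matSqrt V)⁻¹.mulVec (gridRound α (α • w) z)

/-! ### The batched optimistic algorithm -/

/-- The inputs of the algorithm other than the action sets: noise level `sigma`, norm bound `S`,
regularization `lam`, batch budget `B`, determinant growth factor `q`, and the confidence and
replicability budgets of the batches `b < B`. -/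
structure Params where
  sigma : ℝ
  S : ℝ
  lam : ℝ
  B : ℕ
  q : ℝ
  deltaB : ℕ → ℝ
  rhoB : ℕ → ℝ

/-- The state of the algorithm between two rounds. Rounds are numbered from `0`, so that before
round `t` the actions and rewards with index `< t` have been recorded. `batch` is the index of the
current batch and `start` the round at which it started, which is also the number of data points
available at its start. -/
structure State (d : ℕ) where
  actions : ℕ → Fin d → ℝ
  rewards : ℕ → ℝ
  batch : ℕ
  start : ℕ

/-- The initial state: no data, batch `0` starting at round `0`. -/
def State.init (d : ℕ) : State d := ⟨fun _ => 0, fun _ => 0, 0, 0⟩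

/-- The upper confidence score `⟨a, θ⟩ + β ‖a‖_{W⁻¹}`. -/
def ucbScore {d : ℕ} (θ : Fin d → ℝ) (β : ℝ) (W : Matrix (Fin d) (Fin d) ℝ)
    (a : Fin d → ℝ) : ℝ :=
  a ⬝ᵥ θ + β * matNorm W⁻¹ a

/-- The arguments `(θ, β, W)` of the score. -/
abbrev ScoreArg (d : ℕ) : Type := (Fin d → ℝ) × ℝ × (Fin d → Fin d → ℝ)

/-- A maximization rule with fixed tie breaking: for every round `t < T` and every score, `rule`
returns one maximizer of the score over the action set of that round, in a deterministic and
measurable way. -/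
structure IsArgmaxRule {d : ℕ} (T : ℕ) (A : ℕ → Set (Fin d → ℝ))
    (rule : ℕ → ScoreArg d → Fin d → ℝ) : Prop where
  measurable : ∀ t, Measurable (rule t)
  mem : ∀ t < T, ∀ (θ : Fin d → ℝ) (β : ℝ) (W : Fin d → Fin d → ℝ),
    (Matrix.of W).PosDef → rule t (θ, β, W) ∈ A t
  isMax : ∀ t < T, ∀ (θ : Fin d → ℝ) (β : ℝ) (W : Fin d → Fin d → ℝ),
    (Matrix.of W).PosDef → ∀ a ∈ A t,
      ucbScore θ β (Matrix.of W) a ≤ ucbScore θ β (Matrix.of W) (rule t (θ, β, W))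

/-- The internal randomness: one point of `[0,1)^d` for each batch index. -/
abbrev Seed (d : ℕ) : Type := ℕ → Fin d → ℝ

/-- The estimate used in the current batch: replicable ridge regression on the data recorded
before the start of the batch. -/
def batchEstimate {d : ℕ} (P : Params) (w : Seed d) (st : State d) : Fin d → ℝ :=
  repRidge P.sigma P.S P.lam (P.deltaB st.batch) (P.rhoB st.batch) st.start
    st.actions st.rewards (w st.batch)

/-- The inflated confidence radius used in the current batch. -/
def batchRadius {d : ℕ} (P : Params) (st : State d) : ℝ :=
  confRadius P.sigma P.S P.lam (P.deltaB st.batch) st.start st.actions *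
    (1 + (d : ℝ) / (P.rhoB st.batch - 2 * P.deltaB st.batch))

/-- The action chosen at round `t`. -/
def chooseAction {d : ℕ} (P : Params) (rule : ℕ → ScoreArg d → Fin d → ℝ) (w : Seed d)
    (t : ℕ) (st : State d) : Fin d → ℝ :=
  rule t (batchEstimate P w st, batchRadius P st, fun i j => gram P.lam st.start st.actions i j)

open Classical in
/-- The update after action `a` and reward `r` at round `t`: record the data, and start a new
batch if the batch budget allows it and the determinant has grown by more than the factor `q`. -/
def State.update {d : ℕ} (P : Params) (t : ℕ) (st : State d) (a : Fin d → ℝ) (r : ℝ) : State d :=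
  let x := Function.update st.actions t a
  let y := Function.update st.rewards t r
  if st.batch + 2 ≤ P.B ∧ P.q * (gram P.lam st.start x).det < (gram P.lam (t + 1) x).det then
    ⟨x, y, st.batch + 1, t + 1⟩
  else
    ⟨x, y, st.batch, st.start⟩

/-! ### Interaction with the environment

The reward randomness of one execution is a point `ω` of a probability space. The noise of round
`t` is `noise t ω (a_0, …, a_t)`: it may depend on the actions played so far, and the noises of
different rounds may depend on each other through `ω`. -/

/-- A noise model. -/
abbrev Noise (d : ℕ) (E : Type*) : Type _ := (t : ℕ) → E → (Fin (t + 1) → Fin d → ℝ) → ℝ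

/-- The state before round `t` when the internal randomness is `w` and the reward
randomness is `ω`. -/
def run {d : ℕ} {E : Type*} (P : Params) (rule : ℕ → ScoreArg d → Fin d → ℝ)
    (θ : Fin d → ℝ) (noise : Noise d E) (w : Seed d) (ω : E) : ℕ → State d
  | 0 => State.init d
  | t + 1 =>
    let st := run P rule θ noise w ω t
    let a := chooseAction P rule w t st
    st.update P t a
      (a ⬝ᵥ θ + noise t ω (fun s => Function.update st.actions t a (s : ℕ)))

/-- The action `a_t` of the execution with internal randomness `p.1` and reward
randomness `p.2`. -/
def action {d : ℕ} {E : Type*} (P : Params) (rule : ℕ → ScoreArg d → Fin d → ℝ)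
    (θ : Fin d → ℝ) (noise : Noise d E) (t : ℕ) (p : Seed d × E) : Fin d → ℝ :=
  chooseAction P rule p.1 t (run P rule θ noise p.1 p.2 t)

/-- The noise `ε_t` of the execution. -/
def noiseAt {d : ℕ} {E : Type*} (P : Params) (rule : ℕ → ScoreArg d → Fin d → ℝ)
    (θ : Fin d → ℝ) (noise : Noise d E) (t : ℕ) (p : Seed d × E) : ℝ :=
  noise t p.2 (fun s => action P rule θ noise (s : ℕ) p)

/-- The reward `r_t = ⟨a_t, θ⟩ + ε_t` of the execution. -/
def reward {d : ℕ} {E : Type*} (P : Params) (rule : ℕ → ScoreArg d → Fin d → ℝ)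
    (θ : Fin d → ℝ) (noise : Noise d E) (t : ℕ) (p : Seed d × E) : ℝ :=
  action P rule θ noise t p ⬝ᵥ θ + noiseAt P rule θ noise t p

/-- The σ-algebra generated by `a_0, r_0, …, a_{t-1}, r_{t-1}, a_t` (the action sets are
deterministic). -/
abbrev pastSigma {d : ℕ} {E : Type*} (P : Params) (rule : ℕ → ScoreArg d → Fin d → ℝ)
    (θ : Fin d → ℝ) (noise : Noise d E) (t : ℕ) : MeasurableSpace (Seed d × E) :=
  MeasurableSpace.comap
    (fun p => ((fun s : Fin t =>
        (action P rule θ noise (s : ℕ) p, reward P rule θ noise (s : ℕ) p)),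
      action P rule θ noise t p))
    inferInstance

/-- The uniform distribution on `[0,1)^d`. -/
def unitCube (d : ℕ) : Measure (Fin d → ℝ) :=
  Measure.pi fun _ : Fin d => (volume : Measure ℝ).restrict (Set.Ico 0 1)

/-- The law of the internal randomness: independent uniform points of `[0,1)^d`. -/
def seedLaw (d : ℕ) : Measure (Seed d) := Measure.infinitePi fun _ : ℕ => unitCube d

instance (d : ℕ) : IsProbabilityMeasure (unitCube d) := by
  have : IsProbabilityMeasure ((volume : Measure ℝ).restrict (Set.Ico 0 1)) := ⟨by simp⟩
  unfold unitCube
  infer_instance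

instance (d : ℕ) : IsProbabilityMeasure (seedLaw d) := by
  unfold seedLaw
  infer_instance

/-- The noise of an execution is conditionally `σ`-sub-Gaussian during the first `T` rounds:
`E[exp(γ ε_t) | a_0, r_0, …, a_{t-1}, r_{t-1}, a_t] ≤ exp(σ² γ² / 2)` for all `γ`. -/
def CondSubGaussian {d : ℕ} {E : Type*} [MeasurableSpace E] (T : ℕ) (P : Params)
    (rule : ℕ → ScoreArg d → Fin d → ℝ) (θ : Fin d → ℝ) (noise : Noise d E)
    (envLaw : Measure E) : Prop :=
  ∀ t < T, ∀ γ : ℝ,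
    Integrable (fun p => Real.exp (γ * noiseAt P rule θ noise t p)) ((seedLaw d).prod envLaw) ∧
    ((seedLaw d).prod envLaw)[fun p => Real.exp (γ * noiseAt P rule θ noise t p) |
        pastSigma P rule θ noise t]
      ≤ᵐ[(seedLaw d).prod envLaw] fun _ => Real.exp (P.sigma ^ 2 * γ ^ 2 / 2)

/-- Replicability over `T` rounds: two executions with the same internal randomness and
independent, identically distributed reward randomness play the same actions with probability at
least `1 - ρ`. -/
def Replicable {d : ℕ} {E : Type*} [MeasurableSpace E] (T : ℕ) (P : Params)
    (rule : ℕ → ScoreArg d → Fin d → ℝ) (θ : Fin d → ℝ) (noise : Noise d E)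
    (envLaw : Measure E) (rho : ℝ) : Prop :=
  ENNReal.ofReal (1 - rho) ≤ ((seedLaw d).prod (envLaw.prod envLaw))
    {p : Seed d × E × E | ∀ t < T,
      action P rule θ noise t (p.1, p.2.1) = action P rule θ noise t (p.1, p.2.2)}

/-- The regret `∑_{t < T} (⟨a*_t, θ⟩ - ⟨a_t, θ⟩)` against the actions `aStar`. -/
def regret {d : ℕ} {E : Type*} (T : ℕ) (P : Params)
    (rule : ℕ → ScoreArg d → Fin d → ℝ) (θ : Fin d → ℝ) (noise : Noise d E)
    (aStar : ℕ → Fin d → ℝ) (p : Seed d × E) : ℝ :=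
  ∑ t ∈ Finset.range T, (aStar t ⬝ᵥ θ - action P rule θ noise t p ⬝ᵥ θ)

/-- With probability at least `1 - δ`, the regret over `T` rounds is at most `R`. -/
def RegretAtMost {d : ℕ} {E : Type*} [MeasurableSpace E] (T : ℕ) (P : Params)
    (rule : ℕ → ScoreArg d → Fin d → ℝ) (θ : Fin d → ℝ) (noise : Noise d E)
    (envLaw : Measure E) (aStar : ℕ → Fin d → ℝ) (delta R : ℝ) : Prop :=
  ENNReal.ofReal (1 - delta) ≤ ((seedLaw d).prod envLaw)
    {p | regret T P rule θ noise aStar p ≤ R}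

/-! ### The choice of the parameters -/

/-- `d log (1 + T L² / (λ d))`. -/
def logDet (d T : ℕ) (lam L : ℝ) : ℝ := d * Real.log (1 + T * L ^ 2 / (lam * d))

/-- The number of batches `B = ⌈d log (1 + T L² / (λ d))⌉`. -/
def numBatches (d T : ℕ) (lam L : ℝ) : ℕ := ⌈logDet d T lam L⌉₊

/-- The parameters: `B` as above, `q = (1 + T L² / (λ d))^{d/B}`, `δ_b = δ / B`, `ρ_b = ρ / B`. -/
def mainParams (d T : ℕ) (sigma S lam L delta rho : ℝ) : Params where
  sigma := sigma
  S := S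
  lam := lam
  B := numBatches d T lam L
  q := (1 + T * L ^ 2 / (lam * d)) ^ ((d : ℝ) / (numBatches d T lam L : ℝ))
  deltaB := fun _ => delta / (numBatches d T lam L : ℝ)
  rhoB := fun _ => rho / (numBatches d T lam L : ℝ)

/-- `(σ √(d log (1 + T L² / (λ d)) + log (B / δ)) + √λ S) (1 + d B / ρ)`. -/
def radiusBound (d T : ℕ) (sigma S lam L delta rho : ℝ) : ℝ :=
  (sigma * √(logDet d T lam L + Real.log ((numBatches d T lam L : ℝ) / delta)) + √lam * S) *
    (1 + d * (numBatches d T lam L : ℝ) / rho)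

end RepLin

end

open RepLin

/-!
The algorithm plays optimistically with respect to a ridge estimate that is rounded to a randomly
shifted grid; the theorem rests on a single confidence event and on two deterministic arguments
made on it.

*Confidence event.* With `V_t` the Gram matrix and `S_t` the noise-weighted sum of the first `t`
actions, `exp(⟨v, S_t⟩ - σ² vᵀ(V_t - λ I)v / 2)` is a supermartingale for each direction `v`.
Its mixture over a Gaussian weight is, up to a constant,
`exp(‖S_t‖² / (2σ²)) det(V_t)^{-1/2}`, where the norm is that of `V_t⁻¹` (`mixture_eq`), and Ville's
inequality (`mul_measure_exists_le`) bounds `‖S_t‖` for all `t ≤ T` at once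
(`measure_selfNormalized_le`). The confidence budgets `δ / B` of the batches are all equal, so one
event of probability at least `1 - δ / B` serves every batch (`measure_compl_confident_le`); no
stopping times are needed. For `σ = 0` the noise vanishes almost surely.

*Regret.* Rounding inflates the confidence radius by `1 + d / (ρ_b - 2 δ_b)`
(`matNorm_repRidge_sub_le`), so a round costs at most twice the bonus of the played action in the
Gram matrix of the start of the batch (`dotProduct_sub_le_of_ucb`). That matrix may be replaced by
the current one at the price of the ratio of determinants (`matNorm_inv_gram_sq_le`). The ratio is
at most `q ≤ e`: in the last batch because every earlier batch has multiplied the determinant by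
more than `q`, while `q ^ B λ ^ d` bounds all determinants (`det_gram_le_mul_start`). The elliptical
potential lemma (`sum_min_one_matNorm_sq_le`) and Cauchy–Schwarz sum up the rounds.

*Replicability.* As long as the actions of two executions agree, they share the Gram matrices, the
batch schedule and the grid. On the two confidence events the vectors to be rounded are within
twice the confidence radius of each other, so a uniformly shifted grid separates them with
probability at most `ρ_b - 2 δ_b` (`unitCube_gridRound_ne_le_gap`). The seed of batch `b` is
independent of these vectors, as they are functions of the run stopped at the start of the batch
(`stoppedRun_spec`, `measure_separated_le`). A union bound over the batches and the two confidence
events gives `ρ`.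

Every object is measurable because, for `λ > 0`, the functional calculus and the matrix inverse
are continuous along Gram matrices.
-/

namespace RepLin

/-! ### Euclidean norm and symmetric square root -/

theorem euclNorm_nonneg {d : ℕ} (x : Fin d → ℝ) : 0 ≤ euclNorm x := norm_nonneg _

theorem euclNorm_sq {d : ℕ} (x : Fin d → ℝ) : euclNorm x ^ 2 = x ⬝ᵥ x := by
  rw [euclNorm, EuclideanSpace.norm_sq_eq]
  simp [dotProduct, sq]

theorem euclNorm_eq_sqrt {d : ℕ} (x : Fin d → ℝ) : euclNorm x = √(x ⬝ᵥ x) := by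
  rw [← euclNorm_sq, Real.sqrt_sq (euclNorm_nonneg x)]

theorem euclNorm_add_le {d : ℕ} (x y : Fin d → ℝ) :
    euclNorm (x + y) ≤ euclNorm x + euclNorm y := by
  simpa [euclNorm] using norm_add_le (WithLp.toLp 2 x) (WithLp.toLp 2 y)

theorem euclNorm_smul {d : ℕ} (c : ℝ) (x : Fin d → ℝ) :
    euclNorm (c • x) = |c| * euclNorm x := by
  simp [euclNorm, norm_smul]

theorem abs_dotProduct_le {d : ℕ} (x y : Fin d → ℝ) :
    |x ⬝ᵥ y| ≤ euclNorm x * euclNorm y := by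
  have h := abs_real_inner_le_norm (WithLp.toLp 2 x) (WithLp.toLp 2 y)
  rw [EuclideanSpace.inner_eq_star_dotProduct] at h
  simpa [euclNorm, dotProduct_comm] using h

theorem sum_abs_le_sqrt_mul_euclNorm {d : ℕ} (x : Fin d → ℝ) :
    ∑ j, |x j| ≤ √(d : ℝ) * euclNorm x := by
  rw [euclNorm_eq_sqrt, ← Real.sqrt_mul (Nat.cast_nonneg d)]
  apply Real.le_sqrt_of_sq_le
  have h := sq_sum_le_card_mul_sum_sq (s := Finset.univ) (f := fun j => |x j|)
  simpa [dotProduct, sq_abs, ← sq] using h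

theorem euclNorm_le_of_abs_le {d : ℕ} {c : ℝ} {x : Fin d → ℝ} (hc : 0 ≤ c)
    (h : ∀ j, |x j| ≤ c) : euclNorm x ≤ √(d : ℝ) * c := by
  rw [euclNorm_eq_sqrt, ← Real.sqrt_sq hc, ← Real.sqrt_mul (Nat.cast_nonneg d)]
  apply Real.sqrt_le_sqrt
  calc x ⬝ᵥ x = ∑ j, |x j| ^ 2 := by simp [dotProduct, sq_abs, ← sq]
    _ ≤ ∑ _j : Fin d, c ^ 2 := by
      gcongr with j
      exact h j
    _ = d * c ^ 2 := by simp

theorem dotProduct_mulVec_symm {d : ℕ} {M : Matrix (Fin d) (Fin d) ℝ} (hM : M.IsHermitian)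
    (x y : Fin d → ℝ) : x ⬝ᵥ M.mulVec y = M.mulVec x ⬝ᵥ y := by
  have h : M.transpose = M := by simpa [Matrix.IsHermitian] using hM
  rw [Matrix.dotProduct_mulVec, ← Matrix.mulVec_transpose, h]

theorem posDef_dotProduct_nonneg {d : ℕ} {M : Matrix (Fin d) (Fin d) ℝ} (hM : M.PosDef)
    (x : Fin d → ℝ) : 0 ≤ x ⬝ᵥ M.mulVec x := by
  simpa using hM.posSemidef.dotProduct_mulVec_nonneg x

theorem matNorm_sq {d : ℕ} {M : Matrix (Fin d) (Fin d) ℝ} (hM : M.PosDef) (x : Fin d → ℝ) :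
    matNorm M x ^ 2 = x ⬝ᵥ M.mulVec x := Real.sq_sqrt (posDef_dotProduct_nonneg hM x)

theorem matNorm_nonneg {d : ℕ} (M : Matrix (Fin d) (Fin d) ℝ) (x : Fin d → ℝ) :
    0 ≤ matNorm M x := Real.sqrt_nonneg _

theorem matSqrt_isHermitian {d : ℕ} (V : Matrix (Fin d) (Fin d) ℝ) :
    (matSqrt V).IsHermitian := by
  have : IsSelfAdjoint (matSqrt V) := cfc_predicate _ _
  exact this

theorem matSqrt_mul_self {d : ℕ} {V : Matrix (Fin d) (Fin d) ℝ} (hV : V.PosDef) :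
    matSqrt V * matSqrt V = V := by
  have hsa : IsSelfAdjoint V := hV.isHermitian
  have hfin : (spectrum ℝ V).Finite := V.finite_real_spectrum
  unfold matSqrt
  rw [← cfc_mul Real.sqrt Real.sqrt V]
  conv_rhs => rw [← cfc_id ℝ V]
  apply cfc_congr
  intro r hr
  have : 0 ≤ r := by
    rw [hV.isHermitian.spectrum_real_eq_range_eigenvalues] at hr
    obtain ⟨i, rfl⟩ := hr
    exact hV.posSemidef.eigenvalues_nonneg i
  simp [Real.mul_self_sqrt this]

theorem det_matSqrt_sq {d : ℕ} {V : Matrix (Fin d) (Fin d) ℝ} (hV : V.PosDef) :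
    (matSqrt V).det ^ 2 = V.det := by
  rw [sq, ← Matrix.det_mul, matSqrt_mul_self hV]

theorem det_matSqrt_ne_zero {d : ℕ} {V : Matrix (Fin d) (Fin d) ℝ} (hV : V.PosDef) :
    (matSqrt V).det ≠ 0 := by
  intro h
  have := det_matSqrt_sq hV
  rw [h] at this
  have := hV.det_pos
  simp_all

theorem isUnit_det_matSqrt {d : ℕ} {V : Matrix (Fin d) (Fin d) ℝ} (hV : V.PosDef) :
    IsUnit (matSqrt V).det := isUnit_iff_ne_zero.2 (det_matSqrt_ne_zero hV)

theorem isUnit_det_of_posDef {d : ℕ} {V : Matrix (Fin d) (Fin d) ℝ} (hV : V.PosDef) :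
    IsUnit V.det := isUnit_iff_ne_zero.2 hV.det_pos.ne'

theorem matNorm_eq_euclNorm {d : ℕ} {V : Matrix (Fin d) (Fin d) ℝ} (hV : V.PosDef)
    (x : Fin d → ℝ) : matNorm V x = euclNorm ((matSqrt V).mulVec x) := by
  rw [euclNorm_eq_sqrt, matNorm, ← dotProduct_mulVec_symm (matSqrt_isHermitian V),
    Matrix.mulVec_mulVec, matSqrt_mul_self hV]

theorem matNorm_add_le {d : ℕ} {V : Matrix (Fin d) (Fin d) ℝ} (hV : V.PosDef)
    (x y : Fin d → ℝ) : matNorm V (x + y) ≤ matNorm V x + matNorm V y := by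
  simp only [matNorm_eq_euclNorm hV, Matrix.mulVec_add]
  exact euclNorm_add_le _ _

theorem matNorm_smul {d : ℕ} {V : Matrix (Fin d) (Fin d) ℝ} (hV : V.PosDef) (c : ℝ)
    (x : Fin d → ℝ) : matNorm V (c • x) = |c| * matNorm V x := by
  simp only [matNorm_eq_euclNorm hV, Matrix.mulVec_smul, euclNorm_smul]

theorem mulVec_inv_mulVec {d : ℕ} {V : Matrix (Fin d) (Fin d) ℝ} (hV : IsUnit V.det)
    (x : Fin d → ℝ) : V.mulVec (V⁻¹.mulVec x) = x := by
  rw [Matrix.mulVec_mulVec, Matrix.mul_nonsing_inv _ hV, Matrix.one_mulVec]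

theorem inv_mulVec_mulVec {d : ℕ} {V : Matrix (Fin d) (Fin d) ℝ} (hV : IsUnit V.det)
    (x : Fin d → ℝ) : V⁻¹.mulVec (V.mulVec x) = x := by
  rw [Matrix.mulVec_mulVec, Matrix.nonsing_inv_mul _ hV, Matrix.one_mulVec]

/-- The dual norm of `y` is the primal norm of `V⁻¹ y`. -/
theorem matNorm_inv_mulVec {d : ℕ} {V : Matrix (Fin d) (Fin d) ℝ} (hV : V.PosDef)
    (y : Fin d → ℝ) : matNorm V (V⁻¹.mulVec y) = matNorm V⁻¹ y := by
  rw [matNorm, matNorm, mulVec_inv_mulVec (isUnit_det_of_posDef hV), dotProduct_comm]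

/-- Cauchy–Schwarz for the pair of dual norms `‖·‖_V` and `‖·‖_{V⁻¹}`. -/
theorem abs_dotProduct_le_matNorm {d : ℕ} {V : Matrix (Fin d) (Fin d) ℝ} (hV : V.PosDef)
    (x y : Fin d → ℝ) : |x ⬝ᵥ y| ≤ matNorm V⁻¹ x * matNorm V y := by
  have h := abs_dotProduct_le ((matSqrt V).mulVec (V⁻¹.mulVec x)) ((matSqrt V).mulVec y)
  rwa [← dotProduct_mulVec_symm (matSqrt_isHermitian V), Matrix.mulVec_mulVec,
    matSqrt_mul_self hV, ← dotProduct_mulVec_symm hV.inv.isHermitian,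
    inv_mulVec_mulVec (isUnit_det_of_posDef hV), ← matNorm_eq_euclNorm hV,
    ← matNorm_eq_euclNorm hV, matNorm_inv_mulVec hV] at h

/-! ### Gram matrices -/

theorem gram_succ {d : ℕ} (lam : ℝ) (n : ℕ) (x : ℕ → Fin d → ℝ) :
    gram lam (n + 1) x = gram lam n x + Matrix.vecMulVec (x n) (x n) := by
  simp [gram, Finset.sum_range_succ, add_assoc]

theorem gram_congr {d : ℕ} (lam : ℝ) {n : ℕ} {x x' : ℕ → Fin d → ℝ}
    (h : ∀ i < n, x i = x' i) : gram lam n x = gram lam n x' := by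
  unfold gram
  congr 1
  exact Finset.sum_congr rfl fun i hi => by rw [h i (Finset.mem_range.1 hi)]

theorem gram_mulVec {d : ℕ} (lam : ℝ) (n : ℕ) (x : ℕ → Fin d → ℝ) (v : Fin d → ℝ) :
    (gram lam n x).mulVec v = lam • v + ∑ i ∈ Finset.range n, (x i ⬝ᵥ v) • x i := by
  rw [gram, Matrix.add_mulVec, Matrix.smul_mulVec, Matrix.one_mulVec, Matrix.sum_mulVec]
  congr 1
  refine Finset.sum_congr rfl fun i _ => ?_
  rw [Matrix.vecMulVec_mulVec]
  simp

theorem gram_quadratic {d : ℕ} (lam : ℝ) (n : ℕ) (x : ℕ → Fin d → ℝ) (v : Fin d → ℝ) :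
    v ⬝ᵥ (gram lam n x).mulVec v =
      lam * (v ⬝ᵥ v) + ∑ i ∈ Finset.range n, (v ⬝ᵥ x i) ^ 2 := by
  rw [gram_mulVec, dotProduct_add, dotProduct_smul, dotProduct_sum]
  simp only [dotProduct_smul, smul_eq_mul]
  congr 1
  refine Finset.sum_congr rfl fun i _ => ?_
  rw [dotProduct_comm (x i), sq]

theorem gram_isHermitian {d : ℕ} (lam : ℝ) (n : ℕ) (x : ℕ → Fin d → ℝ) :
    (gram lam n x).IsHermitian := by
  induction n with
  | zero => simp [gram, Matrix.IsHermitian]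
  | succ n ih =>
    rw [gram_succ]
    refine ih.add ?_
    simp [Matrix.IsHermitian, Matrix.transpose_vecMulVec]

theorem gram_posDef {d : ℕ} {lam : ℝ} (hlam : 0 < lam) (n : ℕ) (x : ℕ → Fin d → ℝ) :
    (gram lam n x).PosDef := by
  refine Matrix.PosDef.of_dotProduct_mulVec_pos (gram_isHermitian _ _ _) fun v hv => ?_
  have h : 0 < v ⬝ᵥ v := by
    have := Matrix.dotProduct_star_self_pos_iff (v := v)
    simp at this
    exact this.2 hv
  simp only [star_trivial]
  rw [gram_quadratic]
  have := Finset.sum_nonneg (s := Finset.range n) (f := fun i => (v ⬝ᵥ x i) ^ 2)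
    fun i _ => sq_nonneg _
  positivity

theorem det_gram_pos {d : ℕ} {lam : ℝ} (hlam : 0 < lam) (n : ℕ) (x : ℕ → Fin d → ℝ) :
    0 < (gram lam n x).det := (gram_posDef hlam n x).det_pos

theorem gram_zero {d : ℕ} (lam : ℝ) (x : ℕ → Fin d → ℝ) :
    gram lam 0 x = lam • (1 : Matrix (Fin d) (Fin d) ℝ) := by simp [gram]

theorem det_smul_one {d : ℕ} (lam : ℝ) :
    (lam • (1 : Matrix (Fin d) (Fin d) ℝ)).det = lam ^ d := by simp

/-- `V ≥ λ I`, hence `V⁻¹ ≤ I / λ`. -/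
theorem matNorm_inv_gram_le {d : ℕ} {lam : ℝ} (hlam : 0 < lam) (n : ℕ) (x : ℕ → Fin d → ℝ)
    (v : Fin d → ℝ) : √lam * matNorm (gram lam n x)⁻¹ v ≤ euclNorm v := by
  have hV := gram_posDef hlam n x
  set V := gram lam n x
  set y := V⁻¹.mulVec v with hy
  have h1 : matNorm V⁻¹ v ^ 2 = v ⬝ᵥ y := matNorm_sq hV.inv v
  have h2 : V.mulVec y = v := mulVec_inv_mulVec (isUnit_det_of_posDef hV) v
  have h3 : lam * euclNorm y ^ 2 ≤ v ⬝ᵥ y := by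
    rw [euclNorm_sq, dotProduct_comm v y]
    conv_rhs => rw [← h2]
    rw [gram_quadratic]
    have := Finset.sum_nonneg (s := Finset.range n) (f := fun i => (y ⬝ᵥ x i) ^ 2)
      fun i _ => sq_nonneg _
    linarith
  have h4 : v ⬝ᵥ y ≤ euclNorm v * euclNorm y := (le_abs_self _).trans (abs_dotProduct_le _ _)
  have hy0 := euclNorm_nonneg y
  have hv0 := euclNorm_nonneg v
  refine abs_le_of_sq_le_sq' ?_ hv0 |>.2
  rw [mul_pow, Real.sq_sqrt hlam.le, h1]
  -- `λ‖y‖² ≤ ⟨v, y⟩ ≤ ‖v‖‖y‖` gives `λ‖y‖ ≤ ‖v‖`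
  have h5 : lam * euclNorm y ≤ euclNorm v := by
    rcases hy0.eq_or_lt with h | h
    · rw [← h]; simpa using hv0
    · nlinarith
  nlinarith

/-- The matrix determinant lemma for Gram matrices. -/
theorem det_gram_succ {d : ℕ} {lam : ℝ} (hlam : 0 < lam) (n : ℕ) (x : ℕ → Fin d → ℝ) :
    (gram lam (n + 1) x).det =
      (gram lam n x).det * (1 + matNorm (gram lam n x)⁻¹ (x n) ^ 2) := by
  have hV := gram_posDef hlam n x
  rw [gram_succ, Matrix.vecMulVec_eq Unit,
    Matrix.det_add_replicateCol_mul_replicateRow (isUnit_det_of_posDef hV), matNorm_sq hV.inv]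
  congr 2
  rw [Matrix.mul_assoc, ← Matrix.replicateCol_mulVec, Matrix.det_unique]
  simp [Matrix.mul_apply, dotProduct]

theorem det_gram_mono {d : ℕ} {lam : ℝ} (hlam : 0 < lam) (x : ℕ → Fin d → ℝ) :
    Monotone fun n => (gram lam n x).det := by
  refine monotone_nat_of_le_succ fun n => ?_
  rw [det_gram_succ hlam]
  have := det_gram_pos hlam n x
  nlinarith [sq_nonneg (matNorm (gram lam n x)⁻¹ (x n))]

/-- Adding `x xᵀ` to `V` shrinks the dual norm by a factor of at most `1 + ‖x‖²_{V⁻¹}`, which is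
the factor by which the determinant grows. -/
theorem matNorm_inv_gram_sq_le_succ {d : ℕ} {lam : ℝ} (hlam : 0 < lam) (n : ℕ)
    (x : ℕ → Fin d → ℝ) (y : Fin d → ℝ) :
    matNorm (gram lam n x)⁻¹ y ^ 2 ≤ (1 + matNorm (gram lam n x)⁻¹ (x n) ^ 2) *
      matNorm (gram lam (n + 1) x)⁻¹ y ^ 2 := by
  have hV := gram_posDef hlam n x
  have hV' := gram_posDef hlam (n + 1) x
  have hsucc := gram_succ lam n x
  set V := gram lam n x
  set V' := gram lam (n + 1) x
  set a := x n
  set z := V'⁻¹.mulVec y with hz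
  have hz' : V'.mulVec z = y := mulVec_inv_mulVec (isUnit_det_of_posDef hV') y
  have hVz : V.mulVec z + (a ⬝ᵥ z) • a = y := by
    rw [← hz', hsucc, Matrix.add_mulVec, Matrix.vecMulVec_mulVec]
    simp
  have hu : V⁻¹.mulVec y = z + (a ⬝ᵥ z) • V⁻¹.mulVec a := by
    rw [← hVz, Matrix.mulVec_add, inv_mulVec_mulVec (isUnit_det_of_posDef hV),
      Matrix.mulVec_smul]
  have hyz : matNorm V'⁻¹ y ^ 2 = matNorm V z ^ 2 + (a ⬝ᵥ z) ^ 2 := by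
    rw [matNorm_sq hV'.inv, matNorm_sq hV]
    change y ⬝ᵥ z = _
    rw [← hVz, add_dotProduct, smul_dotProduct, smul_eq_mul, dotProduct_comm _ z]
    ring
  have hya : y ⬝ᵥ V⁻¹.mulVec a = (a ⬝ᵥ z) * (1 + matNorm V⁻¹ a ^ 2) := by
    rw [dotProduct_mulVec_symm hV.inv.isHermitian, hu, add_dotProduct, smul_dotProduct,
      smul_eq_mul, matNorm_sq hV.inv, dotProduct_comm _ a, dotProduct_comm _ a]
    ring
  have hyu : matNorm V⁻¹ y ^ 2 = matNorm V'⁻¹ y ^ 2 +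
      (a ⬝ᵥ z) ^ 2 * (1 + matNorm V⁻¹ a ^ 2) := by
    rw [matNorm_sq hV.inv, hu, dotProduct_add, dotProduct_smul, hya, smul_eq_mul,
      matNorm_sq hV'.inv]
    change y ⬝ᵥ z + _ = y ⬝ᵥ z + _
    ring
  have hcs := sq_le_sq.2 ((abs_dotProduct_le_matNorm hV a z).trans (le_abs_self _))
  rw [hyu, hyz]
  nlinarith

/-- Comparison of dual norms along the growth of the Gram matrix: freezing the matrix at time `n`
costs at most the ratio of the determinants. -/
theorem matNorm_inv_gram_sq_le {d : ℕ} {lam : ℝ} (hlam : 0 < lam) {n m : ℕ} (hnm : n ≤ m)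
    (x : ℕ → Fin d → ℝ) (y : Fin d → ℝ) :
    (gram lam n x).det * matNorm (gram lam n x)⁻¹ y ^ 2 ≤
      (gram lam m x).det * matNorm (gram lam m x)⁻¹ y ^ 2 := by
  induction m, hnm using Nat.le_induction with
  | base => rfl
  | succ m _ ih =>
    refine ih.trans ?_
    rw [det_gram_succ hlam, mul_assoc]
    exact mul_le_mul_of_nonneg_left (matNorm_inv_gram_sq_le_succ hlam m x y)
      (det_gram_pos hlam m x).le

theorem min_one_le_two_mul_log {w : ℝ} (hw : 0 ≤ w) : min 1 w ≤ 2 * Real.log (1 + w) := by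
  have h := Real.one_sub_inv_le_log_of_pos (show 0 < 1 + w by linarith)
  have h2 : min 1 w ≤ 2 * (1 - (1 + w)⁻¹) := by
    have h3 : 1 - (1 + w)⁻¹ = w / (1 + w) := by field_simp; ring
    rw [h3, ← mul_div_assoc, le_div_iff₀ (by linarith)]
    rcases le_total 1 w with h | h
    · rw [min_eq_left h]; linarith
    · rw [min_eq_right h]; nlinarith
  linarith

/-- The elliptical potential lemma. -/
theorem sum_min_one_matNorm_sq_le {d : ℕ} {lam : ℝ} (hlam : 0 < lam) (n : ℕ)
    (x : ℕ → Fin d → ℝ) :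
    ∑ t ∈ Finset.range n, min 1 (matNorm (gram lam t x)⁻¹ (x t) ^ 2) ≤
      2 * Real.log ((gram lam n x).det / lam ^ d) := by
  induction n with
  | zero => simp [gram_zero, (pow_pos hlam d).ne']
  | succ n ih =>
    have h1 := det_gram_pos hlam n x
    have h2 := min_one_le_two_mul_log (sq_nonneg (matNorm (gram lam n x)⁻¹ (x n)))
    have h3 : 0 < 1 + matNorm (gram lam n x)⁻¹ (x n) ^ 2 := by positivity
    rw [Finset.sum_range_succ, det_gram_succ hlam, mul_div_right_comm,
      Real.log_mul (div_pos h1 (pow_pos hlam d)).ne' h3.ne']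
    linarith

theorem trace_gram {d : ℕ} (lam : ℝ) (n : ℕ) (x : ℕ → Fin d → ℝ) :
    (gram lam n x).trace = d * lam + ∑ i ∈ Finset.range n, euclNorm (x i) ^ 2 := by
  rw [gram, Matrix.trace_add, Matrix.trace_smul, Matrix.trace_one, Matrix.trace_sum]
  simp [Matrix.trace_vecMulVec, euclNorm_sq, mul_comm]

/-- The determinant of a Gram matrix with `T` points of norm at most `L`, by the inequality
between the arithmetic and geometric means of the eigenvalues. -/
theorem det_gram_le {d : ℕ} {lam L : ℝ} (hd : 1 ≤ d) (hlam : 0 < lam) (n : ℕ)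
    (x : ℕ → Fin d → ℝ) (hx : ∀ i < n, euclNorm (x i) ≤ L) :
    (gram lam n x).det ≤ lam ^ d * (1 + n * L ^ 2 / (lam * d)) ^ d := by
  have hV := gram_posDef hlam n x
  have hd0 : (0 : ℝ) < d := by exact_mod_cast hd
  have htr : (gram lam n x).trace ≤ d * lam + n * L ^ 2 := by
    rw [trace_gram]
    gcongr
    calc _ ≤ ∑ _i ∈ Finset.range n, L ^ 2 := by
          gcongr with i hi
          · exact euclNorm_nonneg _
          · exact hx i (Finset.mem_range.1 hi)
      _ = _ := by simp
  have hdet := hV.isHermitian.det_eq_prod_eigenvalues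
  have htr2 := hV.isHermitian.trace_eq_sum_eigenvalues
  simp only [RCLike.ofReal_real_eq_id, id_eq] at hdet htr2
  have hnn : ∀ i, 0 ≤ hV.isHermitian.eigenvalues i := hV.posSemidef.eigenvalues_nonneg
  have hgm := Real.geom_mean_le_arith_mean_weighted Finset.univ (fun _ : Fin d => (1 / d : ℝ))
    hV.isHermitian.eigenvalues (fun _ _ => by positivity) (by simp [hd0.ne'])
    (fun i _ => hnn i)
  rw [← Finset.mul_sum, ← htr2] at hgm
  have hpow : ∏ i, hV.isHermitian.eigenvalues i =
      (∏ i, hV.isHermitian.eigenvalues i ^ (1 / d : ℝ)) ^ d := by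
    rw [← Finset.prod_pow]
    refine Finset.prod_congr rfl fun i _ => ?_
    rw [← Real.rpow_natCast, ← Real.rpow_mul (hnn i), one_div_mul_cancel hd0.ne', Real.rpow_one]
  rw [hdet, hpow, ← mul_pow]
  refine pow_le_pow_left₀ (Finset.prod_nonneg fun i _ => Real.rpow_nonneg (hnn i) _) ?_ d
  refine hgm.trans ?_
  calc 1 / (d : ℝ) * (gram lam n x).trace ≤ 1 / d * (d * lam + n * L ^ 2) := by gcongr
    _ = _ := by field_simp

/-- The error of the ridge estimator: a noise term and a bias term. -/
theorem matNorm_ridge_sub_le {d : ℕ} {lam S : ℝ} (hlam : 0 < lam) (n : ℕ)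
    (x : ℕ → Fin d → ℝ) (y e : ℕ → ℝ) (θ : Fin d → ℝ) (hθ : euclNorm θ ≤ S)
    (hy : ∀ i < n, y i = x i ⬝ᵥ θ + e i) :
    matNorm (gram lam n x) (ridge lam n x y - θ) ≤
      matNorm (gram lam n x)⁻¹ (∑ i ∈ Finset.range n, e i • x i) + √lam * S := by
  have hV := gram_posDef hlam n x
  have h1 : ridge lam n x y - θ = (gram lam n x)⁻¹.mulVec
      (∑ i ∈ Finset.range n, e i • x i + (-lam) • θ) := by
    have h2 : ∑ i ∈ Finset.range n, e i • x i + (-lam) • θ =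
        ∑ i ∈ Finset.range n, y i • x i - (gram lam n x).mulVec θ := by
      have h3 : ∑ i ∈ Finset.range n, y i • x i =
          ∑ i ∈ Finset.range n, (x i ⬝ᵥ θ) • x i + ∑ i ∈ Finset.range n, e i • x i := by
        rw [← Finset.sum_add_distrib]
        refine Finset.sum_congr rfl fun i hi => ?_
        rw [hy i (Finset.mem_range.1 hi), add_smul]
      rw [gram_mulVec, h3, neg_smul]
      abel
    rw [h2, Matrix.mulVec_sub, inv_mulVec_mulVec (isUnit_det_of_posDef hV), ridge]
  rw [h1, matNorm_inv_mulVec hV]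
  refine (matNorm_add_le hV.inv _ _).trans ?_
  gcongr
  rw [matNorm_smul hV.inv, abs_neg, abs_of_pos hlam]
  calc lam * matNorm (gram lam n x)⁻¹ θ = √lam * (√lam * matNorm (gram lam n x)⁻¹ θ) := by
        rw [← mul_assoc, Real.mul_self_sqrt hlam.le]
    _ ≤ √lam * S := by
        gcongr
        exact (matNorm_inv_gram_le hlam n x θ).trans hθ

end RepLin

namespace RepLin

/-! ### Measurability of the algorithm -/

theorem continuous_gram {d : ℕ} (lam : ℝ) (n : ℕ) :
    Continuous fun x : ℕ → Fin d → ℝ => gram lam n x := by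
  unfold gram
  fun_prop

open scoped Matrix.Norms.L2Operator in
theorem continuous_matSqrt_gram {d : ℕ} (lam : ℝ) (n : ℕ) :
    Continuous fun x : ℕ → Fin d → ℝ => matSqrt (gram lam n x) := by
  unfold matSqrt
  refine Continuous.cfc_of_mem_nhdsSet (s := Set.univ) Real.sqrt Filter.univ_mem
    (continuous_gram lam n) (fun x => gram_isHermitian lam n x)
    Real.continuous_sqrt.continuousOn

theorem continuous_inv_of_det_ne_zero {d : ℕ} {X : Type*} [TopologicalSpace X]
    {f : X → Matrix (Fin d) (Fin d) ℝ} (hf : Continuous f) (h : ∀ x, (f x).det ≠ 0) :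
    Continuous fun x => (f x)⁻¹ := by
  refine continuous_iff_continuousAt.2 fun x => ?_
  have h1 : ContinuousAt (fun M : Matrix (Fin d) (Fin d) ℝ => M⁻¹) (f x) := by
    refine continuousAt_matrix_inv _ ?_
    rw [Ring.inverse_eq_inv']
    exact continuousAt_inv₀ (h x)
  exact ContinuousAt.comp (f := f) h1 hf.continuousAt

theorem continuous_ridge {d : ℕ} {lam : ℝ} (hlam : 0 < lam) (n : ℕ) :
    Continuous fun p : (ℕ → Fin d → ℝ) × (ℕ → ℝ) => ridge lam n p.1 p.2 := by
  unfold ridge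
  refine Continuous.matrix_mulVec ?_ (by fun_prop)
  exact continuous_inv_of_det_ne_zero ((continuous_gram lam n).comp continuous_fst)
    fun p => (det_gram_pos hlam n p.1).ne'

theorem continuous_confRadius {d : ℕ} (sigma S : ℝ) {lam delta : ℝ} (hlam : 0 < lam)
    (hdelta : 0 < delta) (n : ℕ) :
    Continuous fun x : ℕ → Fin d → ℝ => confRadius sigma S lam delta n x := by
  unfold confRadius
  have h : Continuous fun x : ℕ → Fin d → ℝ => (gram lam n x).det :=
    (continuous_gram lam n).matrix_det
  have h0 : 0 < √((lam • (1 : Matrix (Fin d) (Fin d) ℝ)).det) := by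
    rw [det_smul_one]; positivity
  refine Continuous.add (continuous_const.mul (Continuous.sqrt (continuous_const.mul
    (Continuous.log (h.sqrt.div_const _) fun x => ?_)))) continuous_const
  have := Real.sqrt_pos.2 (det_gram_pos hlam n x)
  positivity

theorem continuous_gridWidth {d : ℕ} (sigma S rho : ℝ) {lam delta : ℝ} (hlam : 0 < lam)
    (hdelta : 0 < delta) (n : ℕ) :
    Continuous fun x : ℕ → Fin d → ℝ => gridWidth sigma S lam delta rho n x := by
  unfold gridWidth
  have := continuous_confRadius (d := d) sigma S hlam hdelta n
  fun_prop

theorem measurable_gridRound {d : ℕ} :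
    Measurable fun p : ℝ × (Fin d → ℝ) × (Fin d → ℝ) => gridRound p.1 p.2.1 p.2.2 := by
  unfold gridRound
  fun_prop

/-- The vector `V^{1/2} θ̂` that is rounded by replicable ridge regression. -/
noncomputable def whitened {d : ℕ} (lam : ℝ) (n : ℕ) (x : ℕ → Fin d → ℝ) (y : ℕ → ℝ) :
    Fin d → ℝ :=
  (matSqrt (gram lam n x)).mulVec (ridge lam n x y)

theorem continuous_whitened {d : ℕ} {lam : ℝ} (hlam : 0 < lam) (n : ℕ) :
    Continuous fun p : (ℕ → Fin d → ℝ) × (ℕ → ℝ) => whitened lam n p.1 p.2 :=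
  Continuous.matrix_mulVec ((continuous_matSqrt_gram lam n).comp continuous_fst)
    (continuous_ridge hlam n)

theorem repRidge_eq {d : ℕ} (sigma S lam delta rho : ℝ) (n : ℕ) (x : ℕ → Fin d → ℝ)
    (y : ℕ → ℝ) (w : Fin d → ℝ) :
    repRidge sigma S lam delta rho n x y w = (matSqrt (gram lam n x))⁻¹.mulVec
      (gridRound (gridWidth sigma S lam delta rho n x)
        (gridWidth sigma S lam delta rho n x • w) (whitened lam n x y)) := rfl

theorem measurable_mulVec {α : Type*} [MeasurableSpace α] {d : ℕ}
    {M : α → Matrix (Fin d) (Fin d) ℝ} {v : α → Fin d → ℝ}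
    (hM : ∀ i j, Measurable fun a => M a i j) (hv : Measurable v) :
    Measurable fun a => (M a).mulVec (v a) := by
  refine measurable_pi_lambda _ fun i => ?_
  simp only [Matrix.mulVec, dotProduct]
  exact Finset.measurable_sum _ fun j _ => (hM i j).mul ((measurable_pi_apply j).comp hv)

attribute [local irreducible] matSqrt gram ridge confRadius gridWidth gridRound repRidge whitened

theorem measurable_repRidge {d : ℕ} (sigma S rho : ℝ) {lam delta : ℝ} (hlam : 0 < lam)
    (hdelta : 0 < delta) (n : ℕ) :
    Measurable fun p : ((ℕ → Fin d → ℝ) × (ℕ → ℝ)) × (Fin d → ℝ) =>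
      repRidge sigma S lam delta rho n p.1.1 p.1.2 p.2 := by
  have h1 : Continuous fun x : ℕ → Fin d → ℝ => (matSqrt (gram lam n x))⁻¹ :=
    continuous_inv_of_det_ne_zero (continuous_matSqrt_gram lam n)
      fun x => det_matSqrt_ne_zero (gram_posDef hlam n x)
  have h2 : Measurable fun p : ((ℕ → Fin d → ℝ) × (ℕ → ℝ)) × (Fin d → ℝ) =>
      gridWidth sigma S lam delta rho n p.1.1 :=
    (continuous_gridWidth (d := d) sigma S rho hlam hdelta n).measurable.comp
      measurable_fst.fst
  have h3 : Measurable fun p : ((ℕ → Fin d → ℝ) × (ℕ → ℝ)) × (Fin d → ℝ) =>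
      whitened lam n p.1.1 p.1.2 :=
    (continuous_whitened (d := d) hlam n).measurable.comp measurable_fst
  have h4 : Measurable fun p : ((ℕ → Fin d → ℝ) × (ℕ → ℝ)) × (Fin d → ℝ) =>
      gridRound (gridWidth sigma S lam delta rho n p.1.1)
        (gridWidth sigma S lam delta rho n p.1.1 • p.2) (whitened lam n p.1.1 p.1.2) :=
    measurable_gridRound.comp (h2.prodMk ((h2.smul measurable_snd).prodMk h3))
  simp only [repRidge_eq]
  exact measurable_mulVec (fun i j => (h1.matrix_elem i j).measurable.comp measurable_fst.fst) h4

/-- The σ-algebra on states for which the four components are measurable. -/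
instance instMeasurableSpaceState (d : ℕ) : MeasurableSpace (State d) :=
  MeasurableSpace.comap (fun st => (st.actions, st.rewards, st.batch, st.start)) inferInstance

theorem measurable_state_mk {α : Type*} [MeasurableSpace α] {d : ℕ}
    {x : α → ℕ → Fin d → ℝ} {y : α → ℕ → ℝ} {b n : α → ℕ} (hx : Measurable x)
    (hy : Measurable y) (hb : Measurable b) (hn : Measurable n) :
    Measurable fun a => (⟨x a, y a, b a, n a⟩ : State d) := by
  refine measurable_comap_iff.2 ?_
  exact hx.prodMk (hy.prodMk (hb.prodMk hn))

theorem measurable_state_tuple (d : ℕ) : Measurable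
    fun st : State d => (st.actions, st.rewards, st.batch, st.start) := comap_measurable _

theorem measurable_state_actions (d : ℕ) : Measurable fun st : State d => st.actions :=
  (measurable_state_tuple d).fst

theorem measurable_state_rewards (d : ℕ) : Measurable fun st : State d => st.rewards :=
  (measurable_state_tuple d).snd.fst

theorem measurable_state_batch (d : ℕ) : Measurable fun st : State d => st.batch :=
  (measurable_state_tuple d).snd.snd.fst

theorem measurable_state_start (d : ℕ) : Measurable fun st : State d => st.start :=
  (measurable_state_tuple d).snd.snd.snd

/-- A function of a countable parameter and a point is measurable along a measurable choice of
the parameter. -/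
theorem measurable_comp_countable {α β γ ι : Type*} [MeasurableSpace α] [MeasurableSpace β]
    [MeasurableSpace γ] [Countable ι] [MeasurableSpace ι] [MeasurableSingletonClass ι]
    {f : ι → β → γ} (hf : ∀ i, Measurable (f i)) {i : α → ι} {g : α → β} (hi : Measurable i)
    (hg : Measurable g) : Measurable fun a => f (i a) (g a) :=
  (measurable_from_prod_countable_right (f := fun p : ι × β => f p.1 p.2) hf).comp
    (hi.prodMk hg)

theorem measurable_batchEstimate {d : ℕ} {P : Params} (hlam : 0 < P.lam)
    (hdelta : ∀ b, 0 < P.deltaB b) :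
    Measurable fun p : Seed d × State d => batchEstimate P p.1 p.2 := by
  have h : ∀ i : ℕ × ℕ, Measurable fun q : ((ℕ → Fin d → ℝ) × (ℕ → ℝ)) × Seed d =>
      repRidge P.sigma P.S P.lam (P.deltaB i.1) (P.rhoB i.1) i.2 q.1.1 q.1.2 (q.2 i.1) :=
    fun i => (measurable_repRidge P.sigma P.S (P.rhoB i.1) hlam (hdelta i.1) i.2).comp
      (measurable_fst.prodMk ((measurable_pi_apply i.1).comp measurable_snd))
  have hx := measurable_state_actions d
  have hy := measurable_state_rewards d
  have hb := measurable_state_batch d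
  have hn := measurable_state_start d
  exact measurable_comp_countable h
    ((hb.prodMk hn).comp measurable_snd)
    (((hx.prodMk hy).comp measurable_snd).prodMk measurable_fst)

theorem measurable_batchRadius {d : ℕ} {P : Params} (hlam : 0 < P.lam)
    (hdelta : ∀ b, 0 < P.deltaB b) :
    Measurable fun st : State d => batchRadius P st := by
  have h : ∀ i : ℕ × ℕ, Measurable fun x : ℕ → Fin d → ℝ =>
      confRadius P.sigma P.S P.lam (P.deltaB i.1) i.2 x *
        (1 + (d : ℝ) / (P.rhoB i.1 - 2 * P.deltaB i.1)) :=
    fun i => ((continuous_confRadius P.sigma P.S hlam (hdelta i.1) i.2).mul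
      continuous_const).measurable
  exact measurable_comp_countable h
    ((measurable_state_batch d).prodMk (measurable_state_start d)) (measurable_state_actions d)

theorem measurable_gram_apply {d : ℕ} (lam : ℝ) :
    Measurable fun p : ℕ × (ℕ → Fin d → ℝ) => fun i j => gram lam p.1 p.2 i j := by
  refine measurable_from_prod_countable_right fun n => ?_
  have h := continuous_gram (d := d) lam n
  exact (measurable_pi_lambda _ fun i => measurable_pi_lambda _ fun j =>
    (h.matrix_elem i j).measurable)

theorem measurable_det_gram {d : ℕ} (lam : ℝ) :
    Measurable fun p : ℕ × (ℕ → Fin d → ℝ) => (gram lam p.1 p.2).det :=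
  measurable_from_prod_countable_right fun n => (continuous_gram lam n).matrix_det.measurable

attribute [local irreducible] batchEstimate batchRadius

theorem measurable_chooseAction {d : ℕ} {P : Params} (hlam : 0 < P.lam)
    (hdelta : ∀ b, 0 < P.deltaB b) {rule : ℕ → ScoreArg d → Fin d → ℝ} {t : ℕ}
    (hrule : Measurable (rule t)) :
    Measurable fun p : Seed d × State d => chooseAction P rule p.1 t p.2 := by
  refine hrule.comp ((measurable_batchEstimate hlam hdelta).prodMk
    (Measurable.prodMk ((measurable_batchRadius hlam hdelta).comp measurable_snd) ?_))
  exact (measurable_gram_apply P.lam).comp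
    (((measurable_state_start d).prodMk (measurable_state_actions d)).comp measurable_snd)

attribute [local irreducible] chooseAction

theorem measurable_update_nat {α β : Type*} [MeasurableSpace α] [MeasurableSpace β] (t : ℕ)
    {f : α → ℕ → β} {g : α → β} (hf : Measurable f) (hg : Measurable g) :
    Measurable fun a => Function.update (f a) t (g a) := by
  refine measurable_pi_lambda _ fun s => ?_
  by_cases h : s = t
  · subst h; simpa using hg
  · simpa [Function.update_of_ne h, Function.comp_def] using (measurable_pi_apply s).comp hf

theorem measurable_stateUpdate {α : Type*} [MeasurableSpace α] {d : ℕ} (P : Params) (t : ℕ)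
    {st : α → State d} {a : α → Fin d → ℝ} {r : α → ℝ} (hst : Measurable st)
    (ha : Measurable a) (hr : Measurable r) :
    Measurable fun p => (st p).update P t (a p) (r p) := by
  classical
  have hx := measurable_update_nat t ((measurable_state_actions d).comp hst) ha
  have hy := measurable_update_nat t ((measurable_state_rewards d).comp hst) hr
  have hb := (measurable_state_batch d).comp hst
  have hn := (measurable_state_start d).comp hst
  have hset : MeasurableSet {p | (st p).batch + 2 ≤ P.B ∧
      P.q * (gram P.lam (st p).start (Function.update (st p).actions t (a p))).det <
        (gram P.lam (t + 1) (Function.update (st p).actions t (a p))).det} := by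
    refine MeasurableSet.inter ?_ ?_
    · exact hb (measurableSet_le (measurable_id.add_const 2) measurable_const :
        MeasurableSet {b : ℕ | b + 2 ≤ P.B})
    · exact measurableSet_lt (measurable_const.mul ((measurable_det_gram P.lam).comp
        (hn.prodMk hx))) ((measurable_det_gram P.lam).comp (measurable_const.prodMk hx))
  unfold State.update
  exact Measurable.ite hset
    (measurable_state_mk hx hy (hb.add_const 1) (measurable_const (a := t + 1)))
    (measurable_state_mk hx hy hb hn)

/-- The measurable part of the hypotheses on the parameters, the maximization rule and the noise
model. -/
structure MeasurableModel {d : ℕ} {E : Type*} [MeasurableSpace E] (P : Params)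
    (rule : ℕ → ScoreArg d → Fin d → ℝ) (noise : Noise d E) : Prop where
  lam_pos : 0 < P.lam
  delta_pos : ∀ b, 0 < P.deltaB b
  rule : ∀ t, Measurable (rule t)
  noise : ∀ t, Measurable fun p : E × (Fin (t + 1) → Fin d → ℝ) => noise t p.1 p.2

/-- One round of the interaction. -/
noncomputable def step {d : ℕ} {E : Type*} (P : Params) (rule : ℕ → ScoreArg d → Fin d → ℝ)
    (θ : Fin d → ℝ) (noise : Noise d E) (w : Seed d) (ω : E) (t : ℕ) (st : State d) : State d :=
  st.update P t (chooseAction P rule w t st)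
    (chooseAction P rule w t st ⬝ᵥ θ +
      noise t ω (fun s => Function.update st.actions t (chooseAction P rule w t st) (s : ℕ)))

theorem run_succ {d : ℕ} {E : Type*} (P : Params) (rule : ℕ → ScoreArg d → Fin d → ℝ)
    (θ : Fin d → ℝ) (noise : Noise d E) (w : Seed d) (ω : E) (t : ℕ) :
    run P rule θ noise w ω (t + 1) =
      step P rule θ noise w ω t (run P rule θ noise w ω t) := rfl

theorem measurable_step {α : Type*} [MeasurableSpace α] {d : ℕ} {E : Type*} [MeasurableSpace E]
    {P : Params} {rule : ℕ → ScoreArg d → Fin d → ℝ} (θ : Fin d → ℝ) {noise : Noise d E}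
    (hM : MeasurableModel P rule noise) (t : ℕ) {w : α → Seed d} {ω : α → E} {st : α → State d}
    (hw : Measurable w) (hω : Measurable ω) (hst : Measurable st) :
    Measurable fun p => step P rule θ noise (w p) (ω p) t (st p) := by
  have ha : Measurable fun p => chooseAction P rule (w p) t (st p) :=
    (measurable_chooseAction hM.lam_pos hM.delta_pos (hM.rule t)).comp (hw.prodMk hst)
  refine measurable_stateUpdate P t hst ha (Measurable.add ?_ ?_)
  · have : Continuous fun x : Fin d → ℝ => x ⬝ᵥ θ := by fun_prop
    exact this.measurable.comp ha
  · refine (hM.noise t).comp (hω.prodMk (measurable_pi_lambda _ fun s => ?_))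
    exact (measurable_pi_apply (s : ℕ)).comp
      (measurable_update_nat t ((measurable_state_actions d).comp hst) ha)

attribute [local irreducible] step

theorem measurable_run {d : ℕ} {E : Type*} [MeasurableSpace E] {P : Params}
    {rule : ℕ → ScoreArg d → Fin d → ℝ} (θ : Fin d → ℝ) {noise : Noise d E}
    (hM : MeasurableModel P rule noise) (t : ℕ) :
    Measurable fun p : Seed d × E => run P rule θ noise p.1 p.2 t := by
  induction t with
  | zero => exact measurable_const
  | succ t ih =>
    simp only [run_succ]
    exact measurable_step θ hM t measurable_fst measurable_snd ih

theorem measurable_action {d : ℕ} {E : Type*} [MeasurableSpace E] {P : Params}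
    {rule : ℕ → ScoreArg d → Fin d → ℝ} (θ : Fin d → ℝ) {noise : Noise d E}
    (hM : MeasurableModel P rule noise) (t : ℕ) :
    Measurable (action P rule θ noise t) :=
  (measurable_chooseAction hM.lam_pos hM.delta_pos (hM.rule t)).comp
    (measurable_fst.prodMk (measurable_run θ hM t))

theorem measurable_noiseAt {d : ℕ} {E : Type*} [MeasurableSpace E] {P : Params}
    {rule : ℕ → ScoreArg d → Fin d → ℝ} (θ : Fin d → ℝ) {noise : Noise d E}
    (hM : MeasurableModel P rule noise) (t : ℕ) :
    Measurable (noiseAt P rule θ noise t) :=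
  (hM.noise t).comp (measurable_snd.prodMk
    (measurable_pi_lambda _ fun s => measurable_action θ hM (s : ℕ)))

theorem measurable_reward {d : ℕ} {E : Type*} [MeasurableSpace E] {P : Params}
    {rule : ℕ → ScoreArg d → Fin d → ℝ} (θ : Fin d → ℝ) {noise : Noise d E}
    (hM : MeasurableModel P rule noise) (t : ℕ) :
    Measurable (reward P rule θ noise t) := by
  have : Continuous fun x : Fin d → ℝ => x ⬝ᵥ θ := by fun_prop
  exact (this.measurable.comp (measurable_action θ hM t)).add (measurable_noiseAt θ hM t)

theorem pastSigma_le {d : ℕ} {E : Type*} [MeasurableSpace E] {P : Params}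
    {rule : ℕ → ScoreArg d → Fin d → ℝ} (θ : Fin d → ℝ) {noise : Noise d E}
    (hM : MeasurableModel P rule noise) (t : ℕ) :
    pastSigma P rule θ noise t ≤ (inferInstance : MeasurableSpace (Seed d × E)) := by
  refine Measurable.comap_le (Measurable.prodMk (measurable_pi_lambda _ fun s => ?_)
    (measurable_action θ hM t))
  exact (measurable_action θ hM _).prodMk (measurable_reward θ hM _)

theorem measurable_action_pastSigma {d : ℕ} {E : Type*} [MeasurableSpace E] (P : Params)
    (rule : ℕ → ScoreArg d → Fin d → ℝ) (θ : Fin d → ℝ) (noise : Noise d E) {s t : ℕ}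
    (hst : s ≤ t) : Measurable[pastSigma P rule θ noise t] (action P rule θ noise s) := by
  have h := comap_measurable (m := inferInstance) (fun p => ((fun s : Fin t =>
        (action P rule θ noise (s : ℕ) p, reward P rule θ noise (s : ℕ) p)),
      action P rule θ noise t p))
  rcases hst.eq_or_lt with rfl | hst
  · exact h.snd
  · exact ((measurable_pi_apply (⟨s, hst⟩ : Fin t)).comp h.fst).fst

theorem measurable_reward_pastSigma {d : ℕ} {E : Type*} [MeasurableSpace E] (P : Params)
    (rule : ℕ → ScoreArg d → Fin d → ℝ) (θ : Fin d → ℝ) (noise : Noise d E) {s t : ℕ}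
    (hst : s < t) : Measurable[pastSigma P rule θ noise t] (reward P rule θ noise s) := by
  have h := comap_measurable (m := inferInstance) (fun p => ((fun s : Fin t =>
        (action P rule θ noise (s : ℕ) p, reward P rule θ noise (s : ℕ) p)),
      action P rule θ noise t p))
  exact ((measurable_pi_apply (⟨s, hst⟩ : Fin t)).comp h.fst).snd

theorem measurable_noiseAt_pastSigma {d : ℕ} {E : Type*} [MeasurableSpace E] (P : Params)
    (rule : ℕ → ScoreArg d → Fin d → ℝ) (θ : Fin d → ℝ) (noise : Noise d E) {s t : ℕ}
    (hst : s < t) : Measurable[pastSigma P rule θ noise t] (noiseAt P rule θ noise s) := by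
  have h : noiseAt P rule θ noise s = fun p => reward P rule θ noise s p -
      action P rule θ noise s p ⬝ᵥ θ := by
    ext p; simp [reward]
  have h2 : Continuous fun x : Fin d → ℝ => x ⬝ᵥ θ := by fun_prop
  rw [h]
  exact (measurable_reward_pastSigma P rule θ noise hst).sub
    (h2.measurable.comp (measurable_action_pastSigma P rule θ noise hst.le))

end RepLin

namespace RepLin

open scoped ENNReal

/-! ### Conditionally sub-Gaussian noise -/

/-- The sub-Gaussian bound integrated against a weight known to the past. -/
theorem lintegral_mul_exp_const_le {Ω : Type*} {m mΩ : MeasurableSpace Ω} {μ : Measure Ω}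
    [IsProbabilityMeasure μ] (hm : m ≤ mΩ) {sigma c : ℝ} {ε : Ω → ℝ} (hε : Measurable ε)
    (hint : Integrable (fun ω => Real.exp (c * ε ω)) μ)
    (hce : μ[fun ω => Real.exp (c * ε ω) | m] ≤ᵐ[μ]
      fun _ => Real.exp (sigma ^ 2 * c ^ 2 / 2))
    {g : Ω → ℝ≥0∞} (hg : Measurable[m] g) :
    ∫⁻ ω, g ω * ENNReal.ofReal (Real.exp (c * ε ω - sigma ^ 2 * c ^ 2 / 2)) ∂μ ≤
      ∫⁻ ω, g ω ∂μ := by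
  set f : Ω → ℝ≥0∞ :=
    fun ω => ENNReal.ofReal (Real.exp (c * ε ω - sigma ^ 2 * c ^ 2 / 2)) with hf
  have hfm : Measurable f := by fun_prop
  have hle : (μ.withDensity f).trim hm ≤ μ.trim hm := by
    refine Measure.le_iff.2 fun A hA => ?_
    rw [trim_measurableSet_eq hm hA, trim_measurableSet_eq hm hA,
      withDensity_apply _ (hm A hA)]
    have h1 : ∫ ω in A, Real.exp (c * ε ω) ∂μ ≤ μ.real A * Real.exp (sigma ^ 2 * c ^ 2 / 2) := by
      rw [← setIntegral_condExp hm hint hA]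
      calc _ ≤ ∫ _ in A, Real.exp (sigma ^ 2 * c ^ 2 / 2) ∂μ :=
            setIntegral_mono_ae integrable_condExp.integrableOn
              (integrable_const _).integrableOn hce
        _ = _ := by simp
    have h2 : ∀ ω, Real.exp (c * ε ω - sigma ^ 2 * c ^ 2 / 2) =
        Real.exp (c * ε ω) * Real.exp (-(sigma ^ 2 * c ^ 2 / 2)) := fun ω => by
      rw [← Real.exp_add, sub_eq_add_neg]
    have h3 : ∫ ω in A, Real.exp (c * ε ω - sigma ^ 2 * c ^ 2 / 2) ∂μ ≤ μ.real A := by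
      simp only [h2]
      rw [integral_mul_const]
      calc _ ≤ μ.real A * Real.exp (sigma ^ 2 * c ^ 2 / 2) *
            Real.exp (-(sigma ^ 2 * c ^ 2 / 2)) := by gcongr
        _ = μ.real A := by rw [mul_assoc, ← Real.exp_add]; simp
    rw [hf, ← ofReal_integral_eq_lintegral_ofReal]
    · exact ENNReal.ofReal_le_of_le_toReal h3
    · simp only [h2]
      exact (hint.mul_const _).integrableOn
    · exact Filter.Eventually.of_forall fun ω => (Real.exp_pos _).le
  calc ∫⁻ ω, g ω * f ω ∂μ = ∫⁻ ω, g ω ∂(μ.withDensity f) := by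
        rw [lintegral_withDensity_eq_lintegral_mul _ hfm (hg.mono hm le_rfl)]
        simp [mul_comm]
    _ = ∫⁻ ω, g ω ∂((μ.withDensity f).trim hm) := (lintegral_trim hm hg).symm
    _ ≤ ∫⁻ ω, g ω ∂(μ.trim hm) := lintegral_mono' hle le_rfl
    _ = ∫⁻ ω, g ω ∂μ := lintegral_trim hm hg

theorem exists_seq_tendsto_of_measurable {Ω : Type*} [MeasurableSpace Ω] {γ : Ω → ℝ}
    (hγ : Measurable γ) : ∃ φ : ℕ → Ω → ℝ, (∀ n, Measurable (φ n)) ∧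
      (∀ n, (Set.range (φ n)).Finite) ∧
      ∀ ω, Filter.Tendsto (fun n => φ n ω) Filter.atTop (nhds (γ ω)) :=
  ⟨fun n => SimpleFunc.approxOn γ hγ Set.univ 0 (Set.mem_univ _) n,
    fun _ => SimpleFunc.measurable _, fun _ => SimpleFunc.finite_range _,
    fun _ => SimpleFunc.tendsto_approxOn hγ (Set.mem_univ _) (by simp)⟩

/-- The sub-Gaussian bound for a multiplier `γ` known to the past, by approximation with simple
functions and Fatou's lemma. -/
theorem lintegral_mul_exp_le {Ω : Type*} {m mΩ : MeasurableSpace Ω} {μ : Measure Ω}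
    [IsProbabilityMeasure μ] (hm : m ≤ mΩ) {sigma : ℝ} {ε : Ω → ℝ} (hε : Measurable ε)
    (hint : ∀ c : ℝ, Integrable (fun ω => Real.exp (c * ε ω)) μ)
    (hce : ∀ c : ℝ, μ[fun ω => Real.exp (c * ε ω) | m] ≤ᵐ[μ]
      fun _ => Real.exp (sigma ^ 2 * c ^ 2 / 2))
    {g : Ω → ℝ≥0∞} (hg : Measurable[m] g) {γ : Ω → ℝ} (hγ : Measurable[m] γ) :
    ∫⁻ ω, g ω * ENNReal.ofReal (Real.exp (γ ω * ε ω - sigma ^ 2 * γ ω ^ 2 / 2)) ∂μ ≤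
      ∫⁻ ω, g ω ∂μ := by
  have hsimple : ∀ φ : Ω → ℝ, Measurable[m] φ → (Set.range φ).Finite →
      ∫⁻ ω, g ω * ENNReal.ofReal (Real.exp (φ ω * ε ω - sigma ^ 2 * φ ω ^ 2 / 2)) ∂μ ≤
        ∫⁻ ω, g ω ∂μ := by
    intro φ hφm hφf
    have hfib : ∀ c, MeasurableSet[m] (φ ⁻¹' {c}) := fun c =>
      hφm (measurableSet_singleton c)
    have hgi : ∀ c, Measurable[m] ((φ ⁻¹' {c}).indicator g) := fun c =>
      hg.indicator (hfib c)
    have hsplit : ∀ F : ℝ → Ω → ℝ≥0∞, ∀ ω, g ω * F (φ ω) ω =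
        ∑ c ∈ hφf.toFinset, (φ ⁻¹' {c}).indicator g ω * F c ω := by
      intro F ω
      rw [Finset.sum_eq_single (φ ω)]
      · simp
      · intro c _ hc
        rw [Set.indicator_of_notMem (by simpa using hc.symm), zero_mul]
      · intro h
        exact absurd (hφf.mem_toFinset.2 (Set.mem_range_self ω)) h
    calc _ = ∫⁻ ω, ∑ c ∈ hφf.toFinset, (φ ⁻¹' {c}).indicator g ω *
          ENNReal.ofReal (Real.exp (c * ε ω - sigma ^ 2 * c ^ 2 / 2)) ∂μ :=
          lintegral_congr fun ω => hsplit
            (fun c ω => ENNReal.ofReal (Real.exp (c * ε ω - sigma ^ 2 * c ^ 2 / 2))) ω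
      _ = ∑ c ∈ hφf.toFinset, ∫⁻ ω, (φ ⁻¹' {c}).indicator g ω *
          ENNReal.ofReal (Real.exp (c * ε ω - sigma ^ 2 * c ^ 2 / 2)) ∂μ := by
          refine lintegral_finsetSum _ fun c _ => ?_
          exact ((hgi c).mono hm le_rfl).mul (by fun_prop)
      _ ≤ ∑ c ∈ hφf.toFinset, ∫⁻ ω, (φ ⁻¹' {c}).indicator g ω ∂μ :=
          Finset.sum_le_sum fun c _ =>
            lintegral_mul_exp_const_le hm hε (hint c) (hce c) (hgi c)
      _ = ∫⁻ ω, ∑ c ∈ hφf.toFinset, (φ ⁻¹' {c}).indicator g ω ∂μ :=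
          (lintegral_finsetSum _ fun c _ => (hgi c).mono hm le_rfl).symm
      _ = ∫⁻ ω, g ω ∂μ := lintegral_congr fun ω => by
          simpa using (hsplit (fun _ _ => 1) ω).symm
  obtain ⟨φ, hφm, hφf, hφ⟩ := @exists_seq_tendsto_of_measurable Ω m γ hγ
  have hlim : ∀ ω, Filter.Tendsto (fun n => g ω *
      ENNReal.ofReal (Real.exp (φ n ω * ε ω - sigma ^ 2 * φ n ω ^ 2 / 2))) Filter.atTop
      (nhds (g ω * ENNReal.ofReal (Real.exp (γ ω * ε ω - sigma ^ 2 * γ ω ^ 2 / 2)))) := by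
    intro ω
    refine ENNReal.Tendsto.const_mul ?_ (Or.inl ?_)
    · refine ENNReal.tendsto_ofReal ((Real.continuous_exp.tendsto _).comp ?_)
      exact ((hφ ω).mul_const _).sub ((((hφ ω).pow 2).const_mul _).div_const _)
    · simp [Real.exp_pos]
  calc _ = ∫⁻ ω, Filter.liminf (fun n => g ω *
        ENNReal.ofReal (Real.exp (φ n ω * ε ω - sigma ^ 2 * φ n ω ^ 2 / 2))) Filter.atTop ∂μ :=
        lintegral_congr fun ω => (hlim ω).liminf_eq.symm
    _ ≤ Filter.liminf (fun n => ∫⁻ ω, g ω *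
        ENNReal.ofReal (Real.exp (φ n ω * ε ω - sigma ^ 2 * φ n ω ^ 2 / 2)) ∂μ) Filter.atTop := by
        refine lintegral_liminf_le fun n => ?_
        have hn : Measurable (φ n) := (hφm n).mono hm le_rfl
        exact (hg.mono hm le_rfl).mul (by fun_prop)
    _ ≤ ∫⁻ ω, g ω ∂μ :=
        Filter.liminf_le_of_frequently_le' (Filter.Frequently.of_forall fun n =>
          hsimple (φ n) (hφm n) (hφf n))

/-! ### A maximal inequality -/

/-- Ville's inequality for a nonnegative supermartingale over a finite horizon. -/
theorem mul_measure_exists_le {Ω : Type*} {mΩ : MeasurableSpace Ω} {μ : Measure Ω}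
    {m : ℕ → MeasurableSpace Ω} (T : ℕ) (hm : ∀ t ≤ T, m t ≤ mΩ) {M : ℕ → Ω → ℝ≥0∞}
    (hM : ∀ t ≤ T, ∀ s ≤ t, Measurable[m t] (M s))
    (hstep : ∀ t < T, ∀ A, MeasurableSet[m t] A → ∫⁻ ω in A, M (t + 1) ω ∂μ ≤ ∫⁻ ω in A, M t ω ∂μ)
    (c : ℝ≥0∞) :
    c * μ {ω | ∃ t ≤ T, c ≤ M t ω} ≤ ∫⁻ ω, M 0 ω ∂μ := by
  have hmeas : ∀ t ≤ T, MeasurableSet[m t] {ω | ∃ s ≤ t, c ≤ M s ω} := by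
    intro t ht
    have : {ω | ∃ s ≤ t, c ≤ M s ω} = ⋃ s ∈ Finset.range (t + 1), {ω | c ≤ M s ω} := by
      ext ω; simp
    rw [this]
    refine @Finset.measurableSet_biUnion _ _ (m t) _ _ fun s hs => ?_
    exact @measurableSet_le _ _ _ _ _ (m t) _ _ _ _ _ (@measurable_const _ _ _ (m t) _)
      (hM t ht s (Nat.lt_succ_iff.1 (Finset.mem_range.1 hs)))
  have hMm : ∀ t ≤ T, Measurable (M t) := fun t ht => (hM t ht t le_rfl).mono (hm t ht) le_rfl
  have key : ∀ t ≤ T, c * μ {ω | ∃ s ≤ t, c ≤ M s ω} +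
      ∫⁻ ω in {ω | ∃ s ≤ t, c ≤ M s ω}ᶜ, M t ω ∂μ ≤ ∫⁻ ω, M 0 ω ∂μ := by
    intro t
    induction t with
    | zero =>
      intro ht
      rw [← lintegral_add_compl (μ := μ) (M 0) (hm 0 ht _ (hmeas 0 ht))]
      refine add_le_add (α := ℝ≥0∞) ?_ le_rfl
      rw [← setLIntegral_const]
      refine setLIntegral_mono (hMm 0 ht) fun ω hω => ?_
      obtain ⟨s, hs, h⟩ := hω
      rwa [Nat.le_zero.1 hs] at h
    | succ t ih =>
      intro ht
      refine le_trans ?_ (ih (by omega))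
      have hA := hmeas t (by omega)
      set A := {ω | ∃ s ≤ t, c ≤ M s ω} with hAdef
      have hN : MeasurableSet {ω | c ≤ M (t + 1) ω} :=
        measurableSet_le measurable_const (hMm (t + 1) ht)
      have hsucc : {ω | ∃ s ≤ t + 1, c ≤ M s ω} = A ∪ (Aᶜ ∩ {ω | c ≤ M (t + 1) ω}) := by
        ext ω
        simp only [hAdef, Set.mem_ofPred_eq, Set.mem_union, Set.mem_inter_iff, Set.mem_compl_iff]
        constructor
        · rintro ⟨s, hs, h⟩
          by_cases hex : ∃ s ≤ t, c ≤ M s ω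
          · exact Or.inl hex
          · refine Or.inr ⟨hex, ?_⟩
            rcases Nat.lt_or_ge s (t + 1) with h' | h'
            · exact absurd ⟨s, by omega, h⟩ hex
            · rwa [show t + 1 = s by omega]
        · rintro (⟨s, hs, h⟩ | ⟨_, h⟩)
          · exact ⟨s, by omega, h⟩
          · exact ⟨t + 1, le_rfl, h⟩
      have hcompl : {ω | ∃ s ≤ t + 1, c ≤ M s ω}ᶜ = Aᶜ ∩ {ω | c ≤ M (t + 1) ω}ᶜ := by
        rw [hsucc]
        ext ω
        simp only [Set.mem_compl_iff, Set.mem_union, Set.mem_inter_iff]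
        tauto
      rw [hcompl, hsucc]
      calc _ ≤ c * (μ A + μ (Aᶜ ∩ {ω | c ≤ M (t + 1) ω})) +
            ∫⁻ ω in Aᶜ ∩ {ω | c ≤ M (t + 1) ω}ᶜ, M (t + 1) ω ∂μ := by
            gcongr
            exact measure_union_le _ _
        _ ≤ c * μ A + (∫⁻ ω in Aᶜ ∩ {ω | c ≤ M (t + 1) ω}, M (t + 1) ω ∂μ +
            ∫⁻ ω in Aᶜ ∩ {ω | c ≤ M (t + 1) ω}ᶜ, M (t + 1) ω ∂μ) := by
            rw [mul_add, add_assoc]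
            gcongr
            rw [← setLIntegral_const]
            exact setLIntegral_mono (hMm (t + 1) ht) fun ω hω => hω.2
        _ = c * μ A + ∫⁻ ω in Aᶜ, M (t + 1) ω ∂μ := by
            rw [← lintegral_inter_add_sdiff _ Aᶜ hN, Set.sdiff_eq]
        _ ≤ c * μ A + ∫⁻ ω in Aᶜ, M t ω ∂μ := by
            gcongr 1
            exact hstep t (by omega) _ (@MeasurableSet.compl _ _ (m t) hA)
  exact le_self_add.trans (key T le_rfl)

/-! ### The method of mixtures -/

/-- The exponent of the exponential supermartingale in direction `v`, with a Gaussian weight of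
precision `σ² λ`. -/
noncomputable def mixExp {d : ℕ} (sigma lam : ℝ) (n : ℕ) (x : ℕ → Fin d → ℝ) (e : ℕ → ℝ)
    (v : Fin d → ℝ) : ℝ :=
  -(sigma ^ 2 * lam / 2 * (v ⬝ᵥ v)) +
    ∑ i ∈ Finset.range n, (v ⬝ᵥ x i * e i - sigma ^ 2 * (v ⬝ᵥ x i) ^ 2 / 2)

/-- The mixture of the exponential supermartingales over all directions. The Gaussian weight is
not normalized. -/
noncomputable def mixture {d : ℕ} (sigma lam : ℝ) (n : ℕ) (x : ℕ → Fin d → ℝ) (e : ℕ → ℝ) :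
    ℝ≥0∞ :=
  ∫⁻ v, ENNReal.ofReal (Real.exp (mixExp sigma lam n x e v))

theorem mixExp_succ {d : ℕ} (sigma lam : ℝ) (n : ℕ) (x : ℕ → Fin d → ℝ) (e : ℕ → ℝ)
    (v : Fin d → ℝ) : mixExp sigma lam (n + 1) x e v =
      mixExp sigma lam n x e v + (v ⬝ᵥ x n * e n - sigma ^ 2 * (v ⬝ᵥ x n) ^ 2 / 2) := by
  rw [mixExp, mixExp, Finset.sum_range_succ, add_assoc]

theorem mixExp_eq {d : ℕ} (sigma lam : ℝ) (n : ℕ) (x : ℕ → Fin d → ℝ) (e : ℕ → ℝ)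
    (v : Fin d → ℝ) : mixExp sigma lam n x e v =
      v ⬝ᵥ (∑ i ∈ Finset.range n, e i • x i) -
        sigma ^ 2 / 2 * (v ⬝ᵥ (gram lam n x).mulVec v) := by
  rw [mixExp, gram_quadratic, dotProduct_sum, Finset.sum_sub_distrib, mul_add, Finset.mul_sum]
  have h1 : ∑ i ∈ Finset.range n, v ⬝ᵥ x i * e i = ∑ i ∈ Finset.range n, v ⬝ᵥ e i • x i :=
    Finset.sum_congr rfl fun i _ => by rw [dotProduct_smul, smul_eq_mul, mul_comm]
  have h2 : ∑ i ∈ Finset.range n, sigma ^ 2 * (v ⬝ᵥ x i) ^ 2 / 2 =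
      ∑ i ∈ Finset.range n, sigma ^ 2 / 2 * (v ⬝ᵥ x i) ^ 2 :=
    Finset.sum_congr rfl fun i _ => by ring
  rw [h1, h2]
  ring

theorem measurable_dotProduct' {α : Type*} {d : ℕ} [MeasurableSpace α] {f g : α → Fin d → ℝ}
    (hf : Measurable f) (hg : Measurable g) : Measurable fun a => f a ⬝ᵥ g a := by
  simp only [dotProduct]
  exact Finset.measurable_sum _ fun i _ =>
    ((measurable_pi_apply i).comp hf).mul ((measurable_pi_apply i).comp hg)

theorem measurable_mixExp {α : Type*} [MeasurableSpace α] {d : ℕ} (sigma lam : ℝ) (n : ℕ)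
    {x : ℕ → α → Fin d → ℝ} {e : ℕ → α → ℝ} {v : α → Fin d → ℝ}
    (hx : ∀ i < n, Measurable (x i)) (he : ∀ i < n, Measurable (e i)) (hv : Measurable v) :
    Measurable fun a => mixExp sigma lam n (fun i => x i a) (fun i => e i a) (v a) := by
  unfold mixExp
  refine ((measurable_dotProduct' hv hv).const_mul _).neg.add
    (Finset.measurable_sum _ fun i hi => ?_)
  have hi := Finset.mem_range.1 hi
  have h := measurable_dotProduct' hv (hx i hi)
  exact (h.mul (he i hi)).sub (((h.pow_const 2).const_mul _).div_const _)

attribute [local irreducible] mixExp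

theorem measurable_mixture {α : Type*} [MeasurableSpace α] {d : ℕ} (sigma lam : ℝ) (n : ℕ)
    {x : ℕ → α → Fin d → ℝ} {e : ℕ → α → ℝ}
    (hx : ∀ i < n, Measurable (x i)) (he : ∀ i < n, Measurable (e i)) :
    Measurable fun a => mixture sigma lam n (fun i => x i a) (fun i => e i a) := by
  unfold mixture
  refine Measurable.lintegral_prod_right' (f := fun p : α × (Fin d → ℝ) =>
    ENNReal.ofReal (Real.exp (mixExp sigma lam n (fun i => x i p.1) (fun i => e i p.1) p.2))) ?_
  exact (measurable_mixExp sigma lam n (x := fun i p => x i p.1) (e := fun i p => e i p.1)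
    (fun i hi => (hx i hi).comp (f := Prod.fst) measurable_fst)
    (fun i hi => (he i hi).comp (f := Prod.fst) measurable_fst) measurable_snd).exp.ennreal_ofReal

/-- The supermartingale property of the mixture, by Tonelli from that of every direction. -/
theorem setLIntegral_mixture_succ_le {Ω : Type*} {m mΩ : MeasurableSpace Ω} {μ : Measure Ω}
    [IsProbabilityMeasure μ] (hm : m ≤ mΩ) {d : ℕ} {sigma lam : ℝ} {n : ℕ}
    {x : ℕ → Ω → Fin d → ℝ} {e : ℕ → Ω → ℝ}
    (hx : ∀ i ≤ n, Measurable[m] (x i)) (he : ∀ i < n, Measurable[m] (e i))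
    (hen : Measurable (e n))
    (hint : ∀ c : ℝ, Integrable (fun ω => Real.exp (c * e n ω)) μ)
    (hce : ∀ c : ℝ, μ[fun ω => Real.exp (c * e n ω) | m] ≤ᵐ[μ]
      fun _ => Real.exp (sigma ^ 2 * c ^ 2 / 2))
    {A : Set Ω} (hA : MeasurableSet[m] A) :
    ∫⁻ ω in A, mixture sigma lam (n + 1) (fun i => x i ω) (fun i => e i ω) ∂μ ≤
      ∫⁻ ω in A, mixture sigma lam n (fun i => x i ω) (fun i => e i ω) ∂μ := by
  have hx' : ∀ i < n + 1, Measurable (x i) := fun i hi =>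
    (hx i (Nat.lt_succ_iff.1 hi)).mono hm le_rfl
  have he' : ∀ i < n + 1, Measurable (e i) := fun i hi => by
    rcases Nat.lt_succ_iff_lt_or_eq.1 hi with h | rfl
    · exact (he i h).mono hm le_rfl
    · exact hen
  have hjoint : ∀ k ≤ n + 1, Measurable fun p : Ω × (Fin d → ℝ) => ENNReal.ofReal
      (Real.exp (mixExp sigma lam k (fun i => x i p.1) (fun i => e i p.1) p.2)) := fun k hk =>
    (measurable_mixExp sigma lam k (x := fun i p => x i p.1) (e := fun i p => e i p.1)
      (fun i hi => (hx' i (by omega)).comp (f := Prod.fst) measurable_fst)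
      (fun i hi => (he' i (by omega)).comp (f := Prod.fst) measurable_fst) measurable_snd).exp.ennreal_ofReal
  unfold mixture
  have hswap : ∀ k ≤ n + 1, ∫⁻ ω in A, (∫⁻ v, ENNReal.ofReal (Real.exp
      (mixExp sigma lam k (fun i => x i ω) (fun i => e i ω) v))) ∂μ =
      ∫⁻ v, (∫⁻ ω in A, ENNReal.ofReal (Real.exp
      (mixExp sigma lam k (fun i => x i ω) (fun i => e i ω) v)) ∂μ) := fun k hk =>
    lintegral_lintegral_swap (f := fun ω v => ENNReal.ofReal (Real.exp
      (mixExp sigma lam k (fun i => x i ω) (fun i => e i ω) v))) (hjoint k hk).aemeasurable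
  rw [hswap (n + 1) le_rfl, hswap n (by omega)]
  refine lintegral_mono fun v => ?_
  have hg : Measurable[m] fun ω => ENNReal.ofReal
      (Real.exp (mixExp sigma lam n (fun i => x i ω) (fun i => e i ω) v)) :=
    (@measurable_mixExp Ω m d sigma lam n x e (fun _ => v) (fun i hi => hx i hi.le) he
      (@measurable_const _ _ _ m v)).exp.ennreal_ofReal
  have hγ : Measurable[m] fun ω => v ⬝ᵥ x n ω :=
    @measurable_dotProduct' Ω d m _ _ (@measurable_const _ _ _ m v) (hx n le_rfl)
  have h := lintegral_mul_exp_le hm hen hint hce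
    (hg.indicator hA) hγ
  rw [← lintegral_indicator (hm A hA), ← lintegral_indicator (hm A hA)]
  refine le_trans (le_of_eq (lintegral_congr fun ω => ?_)) h
  by_cases hω : ω ∈ A
  · simp only [Set.indicator_of_mem hω]
    rw [mixExp_succ, Real.exp_add, ENNReal.ofReal_mul (Real.exp_pos _).le]
  · simp only [Set.indicator_of_notMem hω, zero_mul]

/-- The Gaussian mass `∫ exp(-σ² ‖v‖² / 2) dv`. -/
noncomputable def gaussMass (d : ℕ) (sigma : ℝ) : ℝ≥0∞ :=
  ∫⁻ v : Fin d → ℝ, ENNReal.ofReal (Real.exp (-(sigma ^ 2 / 2 * (v ⬝ᵥ v))))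

theorem gaussMass_ne_zero (d : ℕ) (sigma : ℝ) : gaussMass d sigma ≠ 0 := by
  intro h
  rw [gaussMass, lintegral_eq_zero_iff (by
    exact ((measurable_dotProduct' measurable_id measurable_id).const_mul
      _).neg.exp.ennreal_ofReal)] at h
  have h2 : ∀ᵐ v : Fin d → ℝ, False := by
    filter_upwards [h] with v hv
    simp at hv
    exact absurd hv (Real.exp_pos _).not_ge
  simp only [Filter.eventually_false_iff_eq_bot, ae_eq_bot] at h2
  exact NeZero.ne (volume : Measure (Fin d → ℝ)) h2

theorem gaussMass_ne_top (d : ℕ) {sigma : ℝ} (hs : 0 < sigma) : gaussMass d sigma ≠ ∞ := by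
  have h : ∀ v : Fin d → ℝ, Real.exp (-(sigma ^ 2 / 2 * (v ⬝ᵥ v))) =
      ∏ i, Real.exp (-(sigma ^ 2 / 2) * v i ^ 2) := by
    intro v
    rw [← Real.exp_sum]
    congr 1
    rw [dotProduct, Finset.mul_sum, ← Finset.sum_neg_distrib]
    exact Finset.sum_congr rfl fun i _ => by ring
  have hint := integrable_exp_neg_mul_sq (b := sigma ^ 2 / 2) (by positivity)
  have hprod := Integrable.fintype_prod (ι := Fin d) (𝕜 := ℝ) (μ := fun _ => volume)
    (f := fun _ y => Real.exp (-(sigma ^ 2 / 2) * y ^ 2)) (fun _ => hint)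
  rw [gaussMass]
  simp only [h]
  exact hprod.lintegral_lt_top.ne

/-- The mixture in closed form. Completing the square moves the centre of the Gaussian to
`V⁻¹ S / σ²`, and the substitution `V^{1/2}` turns it into the standard one. -/
theorem mixture_eq {d : ℕ} {sigma lam : ℝ} (hs : 0 < sigma) (hlam : 0 < lam) (n : ℕ)
    (x : ℕ → Fin d → ℝ) (e : ℕ → ℝ) :
    mixture sigma lam n x e = ENNReal.ofReal
      (Real.exp (matNorm (gram lam n x)⁻¹ (∑ i ∈ Finset.range n, e i • x i) ^ 2 /
        (2 * sigma ^ 2)) / √(gram lam n x).det) * gaussMass d sigma := by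
  have hV := gram_posDef hlam n x
  unfold mixture
  simp only [mixExp_eq]
  set V := gram lam n x
  set s := ∑ i ∈ Finset.range n, e i • x i
  set c : Fin d → ℝ := (sigma ^ 2)⁻¹ • V⁻¹.mulVec s with hc
  have hVc : V.mulVec c = (sigma ^ 2)⁻¹ • s := by
    rw [hc, Matrix.mulVec_smul, mulVec_inv_mulVec (isUnit_det_of_posDef hV)]
  have hcs : c ⬝ᵥ s = (sigma ^ 2)⁻¹ * matNorm V⁻¹ s ^ 2 := by
    rw [hc, smul_dotProduct, smul_eq_mul, matNorm_sq hV.inv, dotProduct_comm]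
  have hsq : ∀ v : Fin d → ℝ, (v + c) ⬝ᵥ s - sigma ^ 2 / 2 * ((v + c) ⬝ᵥ V.mulVec (v + c)) =
      matNorm V⁻¹ s ^ 2 / (2 * sigma ^ 2) +
        -(sigma ^ 2 / 2 * ((matSqrt V).mulVec v ⬝ᵥ (matSqrt V).mulVec v)) := by
    intro v
    have h1 : (matSqrt V).mulVec v ⬝ᵥ (matSqrt V).mulVec v = v ⬝ᵥ V.mulVec v := by
      rw [← dotProduct_mulVec_symm (matSqrt_isHermitian V), Matrix.mulVec_mulVec,
        matSqrt_mul_self hV]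
    have h2 : c ⬝ᵥ V.mulVec v = (sigma ^ 2)⁻¹ * (v ⬝ᵥ s) := by
      rw [dotProduct_mulVec_symm hV.isHermitian, hVc, smul_dotProduct, smul_eq_mul,
        dotProduct_comm]
    rw [h1, Matrix.mulVec_add, add_dotProduct, add_dotProduct, dotProduct_add, dotProduct_add,
      h2, hVc, dotProduct_smul, dotProduct_smul, hcs, smul_eq_mul, smul_eq_mul]
    have : sigma ≠ 0 := hs.ne'
    field_simp
    ring
  have hdet : LinearMap.det (Matrix.toLin' (matSqrt V)) ≠ 0 := by
    rw [LinearMap.det_toLin']; exact det_matSqrt_ne_zero hV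
  have habs : |(matSqrt V).det| = √V.det := by
    rw [← det_matSqrt_sq hV, Real.sqrt_sq_eq_abs]
  have hgm : Measurable fun v : Fin d → ℝ =>
      ENNReal.ofReal (Real.exp (-(sigma ^ 2 / 2 * (v ⬝ᵥ v)))) :=
    ((measurable_dotProduct' measurable_id measurable_id).const_mul _).neg.exp.ennreal_ofReal
  have hlin : Measurable (Matrix.toLin' (matSqrt V)) :=
    (LinearMap.continuous_of_finiteDimensional _).measurable
  rw [← lintegral_add_right_eq_self _ c]
  simp only [hsq, Real.exp_add, ENNReal.ofReal_mul (Real.exp_pos _).le]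
  rw [lintegral_const_mul]
  · have hmap : ∫⁻ v : Fin d → ℝ, ENNReal.ofReal (Real.exp
        (-(sigma ^ 2 / 2 * ((matSqrt V).mulVec v ⬝ᵥ (matSqrt V).mulVec v)))) =
        ∫⁻ v, ENNReal.ofReal (Real.exp (-(sigma ^ 2 / 2 * (v ⬝ᵥ v))))
          ∂(Measure.map (Matrix.toLin' (matSqrt V)) volume) := by
      rw [lintegral_map hgm hlin]
      simp
    rw [hmap, Real.map_linearMap_volume_pi_eq_smul_volume_pi hdet, lintegral_smul_measure,
      LinearMap.det_toLin', abs_inv, habs, div_eq_mul_inv (Real.exp _),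
      ENNReal.ofReal_mul (Real.exp_pos _).le, mul_assoc]
    rfl
  · exact hgm.comp hlin

end RepLin

namespace RepLin

open scoped ENNReal

/-! ### Confidence ellipsoids -/

/-- The self-normalized deviation inequality, uniformly over the horizon: the maximal inequality
for the mixture supermartingale. -/
theorem measure_selfNormalized_le {Ω : Type*} {mΩ : MeasurableSpace Ω} {μ : Measure Ω}
    [IsProbabilityMeasure μ] {m : ℕ → MeasurableSpace Ω} {T : ℕ} (hm : ∀ t, m t ≤ mΩ)
    {d : ℕ} {sigma lam delta : ℝ} (hs : 0 < sigma) (hlam : 0 < lam) (hdelta : 0 < delta)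
    {x : ℕ → Ω → Fin d → ℝ} {e : ℕ → Ω → ℝ}
    (hx : ∀ t, ∀ i ≤ t, Measurable[m t] (x i)) (he : ∀ t, ∀ i < t, Measurable[m t] (e i))
    (hsub : ∀ t < T, ∀ c : ℝ, Integrable (fun ω => Real.exp (c * e t ω)) μ ∧
      μ[fun ω => Real.exp (c * e t ω) | m t] ≤ᵐ[μ] fun _ => Real.exp (sigma ^ 2 * c ^ 2 / 2)) :
    μ {ω | ∃ t ≤ T, sigma * √(2 * Real.log (√((gram lam t fun i => x i ω).det) /
      (√((lam • (1 : Matrix (Fin d) (Fin d) ℝ)).det) * delta))) <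
      matNorm (gram lam t fun i => x i ω)⁻¹ (∑ i ∈ Finset.range t, e i ω • x i ω)} ≤
      ENNReal.ofReal delta := by
  set D := √((lam • (1 : Matrix (Fin d) (Fin d) ℝ)).det) with hD
  have hD0 : 0 < D := by
    rw [hD, det_smul_one]
    exact Real.sqrt_pos.2 (pow_pos hlam d)
  set M : ℕ → Ω → ℝ≥0∞ := fun t ω => mixture sigma lam t (fun i => x i ω) (fun i => e i ω)
  set c : ℝ≥0∞ := ENNReal.ofReal (1 / (D * delta)) * gaussMass d sigma with hc
  have hc0 : c ≠ 0 := by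
    refine mul_ne_zero ?_ (gaussMass_ne_zero d sigma)
    rw [Ne, ENNReal.ofReal_eq_zero, not_le]
    positivity
  have hctop : c ≠ ∞ := ENNReal.mul_ne_top ENNReal.ofReal_ne_top (gaussMass_ne_top d hs)
  have hville := mul_measure_exists_le (μ := μ) (m := m) T (fun t _ => hm t) (M := M)
    (fun t _ s hst => @measurable_mixture Ω (m t) d sigma lam s x e
      (fun i hi => hx t i (by omega)) (fun i hi => he t i (by omega)))
    (fun t ht A hA => setLIntegral_mixture_succ_le (hm t) (hx t) (he t)
      ((he (t + 1) t (by omega)).mono (hm (t + 1)) le_rfl)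
      (fun c => (hsub t ht c).1) (fun c => (hsub t ht c).2) hA) c
  have hM0 : ∫⁻ ω, M 0 ω ∂μ = c * ENNReal.ofReal delta := by
    have : ∀ ω, M 0 ω = c * ENNReal.ofReal delta := by
      intro ω
      simp only [M]
      rw [mixture_eq hs hlam, gram_zero, hc, mul_right_comm,
        ← ENNReal.ofReal_mul (by positivity)]
      congr 2
      rw [Finset.range_zero, Finset.sum_empty]
      have h0 : matNorm (lam • (1 : Matrix (Fin d) (Fin d) ℝ))⁻¹ 0 = 0 := by simp [matNorm]
      rw [h0, ← hD]
      simp only [ne_eq, OfNat.ofNat_ne_zero, not_false_eq_true, zero_pow, zero_div, Real.exp_zero]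
      field_simp
    simp [this]
  rw [hM0, ENNReal.mul_le_mul_iff_right hc0 hctop] at hville
  refine le_trans (measure_mono ?_) hville
  rintro ω ⟨t, ht, h⟩
  refine ⟨t, ht, ?_⟩
  simp only [M]
  rw [mixture_eq hs hlam, hc]
  gcongr ENNReal.ofReal ?_ * _
  have hdet : 0 < √((gram lam t fun i => x i ω).det) :=
    Real.sqrt_pos.2 (det_gram_pos hlam t _)
  set N := matNorm (gram lam t fun i => x i ω)⁻¹ (∑ i ∈ Finset.range t, e i ω • x i ω)
  set R := √((gram lam t fun i => x i ω).det)
  have h1 : √(2 * Real.log (R / (D * delta))) < N / sigma := by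
    rw [lt_div_iff₀ hs]; linarith
  have h2 : 2 * Real.log (R / (D * delta)) < (N / sigma) ^ 2 := Real.lt_sq_of_sqrt_lt h1
  have h3 : R / (D * delta) ≤ Real.exp (N ^ 2 / (2 * sigma ^ 2)) := by
    rw [← Real.log_le_iff_le_exp (by positivity)]
    have : (N / sigma) ^ 2 = 2 * (N ^ 2 / (2 * sigma ^ 2)) := by field_simp
    linarith
  rw [le_div_iff₀ hdet]
  calc 1 / (D * delta) * R = R / (D * delta) := by ring
    _ ≤ _ := h3

/-- Noise that is sub-Gaussian with variance proxy `0` vanishes almost surely, because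
`cosh ε ≥ 1` with equality only at `ε = 0`. -/
theorem ae_eq_zero_of_condSubGaussian_zero {Ω : Type*} {m mΩ : MeasurableSpace Ω}
    {μ : Measure Ω} [IsProbabilityMeasure μ] (hm : m ≤ mΩ) {ε : Ω → ℝ}
    (hint : ∀ c : ℝ, Integrable (fun ω => Real.exp (c * ε ω)) μ)
    (hce : ∀ c : ℝ, μ[fun ω => Real.exp (c * ε ω) | m] ≤ᵐ[μ] fun _ => 1) :
    ∀ᵐ ω ∂μ, ε ω = 0 := by
  have h1 : ∀ c : ℝ, ∫ ω, Real.exp (c * ε ω) ∂μ ≤ 1 := fun c => by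
    rw [← integral_condExp hm]
    calc _ ≤ ∫ _, (1 : ℝ) ∂μ := integral_mono_ae integrable_condExp (integrable_const _) (hce c)
      _ = 1 := by simp
  have hadd : Integrable (fun ω => Real.exp (1 * ε ω) + Real.exp (-1 * ε ω)) μ :=
    (hint 1).add (hint (-1))
  have hi : Integrable (fun ω => Real.exp (1 * ε ω) + Real.exp (-1 * ε ω) - 2) μ :=
    hadd.sub (integrable_const 2)
  have hnn : ∀ ω, 0 ≤ Real.exp (1 * ε ω) + Real.exp (-1 * ε ω) - 2 := fun ω => by
    have := Real.one_le_cosh (ε ω)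
    rw [Real.cosh_eq] at this
    simp only [one_mul, neg_mul]
    linarith
  have h2 : ∫ ω, (Real.exp (1 * ε ω) + Real.exp (-1 * ε ω) - 2) ∂μ ≤ 0 := by
    rw [integral_sub hadd (integrable_const 2),
      integral_add (hint 1) (hint (-1))]
    have := h1 1
    have := h1 (-1)
    simp only [integral_const, probReal_univ, smul_eq_mul]
    linarith
  have h3 := (integral_eq_zero_iff_of_nonneg hnn hi).1 (le_antisymm h2 (integral_nonneg hnn))
  filter_upwards [h3] with ω hω
  by_contra hne
  have := Real.one_lt_cosh.2 hne
  rw [Real.cosh_eq] at this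
  simp only [one_mul, neg_mul, Pi.zero_apply] at hω
  linarith

/-- The executions in which, at every time, the ridge estimate on all the data recorded so far is
within the confidence radius of the true parameter. -/
def confident {d : ℕ} {E : Type*} (T : ℕ) (P : Params) (rule : ℕ → ScoreArg d → Fin d → ℝ)
    (θ : Fin d → ℝ) (noise : Noise d E) (delta : ℝ) : Set (Seed d × E) :=
  {p | ∀ t ≤ T, matNorm (gram P.lam t fun i => action P rule θ noise i p)
      (ridge P.lam t (fun i => action P rule θ noise i p)
        (fun i => reward P rule θ noise i p) - θ) ≤
    confRadius P.sigma P.S P.lam delta t fun i => action P rule θ noise i p}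

theorem measure_compl_confident_le {d : ℕ} {E : Type*} [MeasurableSpace E] {envLaw : Measure E}
    [IsProbabilityMeasure envLaw] {T : ℕ} {P : Params} {rule : ℕ → ScoreArg d → Fin d → ℝ}
    {θ : Fin d → ℝ} {noise : Noise d E} (hM : MeasurableModel P rule noise)
    (hs : 0 ≤ P.sigma) (hθ : euclNorm θ ≤ P.S)
    (hsub : CondSubGaussian T P rule θ noise envLaw) {delta : ℝ} (hdelta : 0 < delta) :
    ((seedLaw d).prod envLaw) (confident T P rule θ noise delta)ᶜ ≤ ENNReal.ofReal delta := by
  have hlam := hM.lam_pos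
  have hbound : ∀ p t, matNorm (gram P.lam t fun i => action P rule θ noise i p)
      (ridge P.lam t (fun i => action P rule θ noise i p)
        (fun i => reward P rule θ noise i p) - θ) ≤
      matNorm (gram P.lam t fun i => action P rule θ noise i p)⁻¹
        (∑ i ∈ Finset.range t, noiseAt P rule θ noise i p • action P rule θ noise i p) +
        √P.lam * P.S := fun p t =>
    matNorm_ridge_sub_le hlam t (fun i => action P rule θ noise i p)
      (fun i => reward P rule θ noise i p) (fun i => noiseAt P rule θ noise i p) θ hθ
      fun i _ => rfl
  rcases hs.eq_or_lt with hs0 | hs0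
  · have hz : ∀ᵐ p ∂((seedLaw d).prod envLaw), ∀ t < T, noiseAt P rule θ noise t p = 0 := by
      rw [ae_all_iff]
      intro t
      refine Filter.eventually_imp_distrib_left.2 fun ht => ?_
      refine ae_eq_zero_of_condSubGaussian_zero (pastSigma_le θ hM t)
        (fun c => (hsub t ht c).1) fun c => ?_
      have := (hsub t ht c).2
      simpa [← hs0] using this
    have hsubset : (confident T P rule θ noise delta)ᶜ ⊆
        {p | ¬ ∀ t < T, noiseAt P rule θ noise t p = 0} := by
      intro p hp hz
      refine hp fun t ht => (hbound p t).trans ?_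
      rw [Finset.sum_eq_zero fun i hi => by
        rw [hz i ((Finset.mem_range.1 hi).trans_le ht), zero_smul]]
      simp [matNorm, confRadius, ← hs0]
    have h0 : ((seedLaw d).prod envLaw) (confident T P rule θ noise delta)ᶜ = 0 :=
      measure_mono_null hsubset hz
    simp [h0]
  · refine le_trans (measure_mono ?_) (measure_selfNormalized_le (μ := (seedLaw d).prod envLaw)
      (m := fun t => pastSigma P rule θ noise t) (T := T) (fun t => pastSigma_le θ hM t) hs0 hlam
      hdelta (x := fun i p => action P rule θ noise i p)
      (e := fun i p => noiseAt P rule θ noise i p)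
      (fun t i hi => measurable_action_pastSigma P rule θ noise hi)
      (fun t i hi => measurable_noiseAt_pastSigma P rule θ noise hi)
      (fun t ht c => hsub t ht c))
    intro p hp
    simp only [confident, Set.mem_compl_iff, Set.mem_ofPred_eq, not_forall, not_le] at hp
    obtain ⟨t, ht, h⟩ := hp
    refine ⟨t, ht, ?_⟩
    have := hbound p t
    simp only [confRadius] at h
    linarith

end RepLin

namespace RepLin

/-! ### The run of the algorithm -/

theorem ridge_congr {d : ℕ} (lam : ℝ) {n : ℕ} {x x' : ℕ → Fin d → ℝ} {y y' : ℕ → ℝ}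
    (hx : ∀ i < n, x i = x' i) (hy : ∀ i < n, y i = y' i) :
    ridge lam n x y = ridge lam n x' y' := by
  rw [ridge, ridge, gram_congr lam hx]
  congr 1
  refine Finset.sum_congr rfl fun i hi => ?_
  rw [hx i (Finset.mem_range.1 hi), hy i (Finset.mem_range.1 hi)]

theorem confRadius_congr {d : ℕ} (sigma S lam delta : ℝ) {n : ℕ} {x x' : ℕ → Fin d → ℝ}
    (hx : ∀ i < n, x i = x' i) :
    confRadius sigma S lam delta n x = confRadius sigma S lam delta n x' := by
  rw [confRadius, confRadius, gram_congr lam hx]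

theorem gridWidth_congr {d : ℕ} (sigma S lam delta rho : ℝ) {n : ℕ} {x x' : ℕ → Fin d → ℝ}
    (hx : ∀ i < n, x i = x' i) :
    gridWidth sigma S lam delta rho n x = gridWidth sigma S lam delta rho n x' := by
  rw [gridWidth, gridWidth, confRadius_congr sigma S lam delta hx]

theorem whitened_congr {d : ℕ} (lam : ℝ) {n : ℕ} {x x' : ℕ → Fin d → ℝ} {y y' : ℕ → ℝ}
    (hx : ∀ i < n, x i = x' i) (hy : ∀ i < n, y i = y' i) :
    whitened lam n x y = whitened lam n x' y' := by
  rw [whitened, whitened, gram_congr lam hx, ridge_congr lam hx hy]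

theorem repRidge_congr {d : ℕ} (sigma S lam delta rho : ℝ) {n : ℕ} {x x' : ℕ → Fin d → ℝ}
    {y y' : ℕ → ℝ} (w : Fin d → ℝ) (hx : ∀ i < n, x i = x' i) (hy : ∀ i < n, y i = y' i) :
    repRidge sigma S lam delta rho n x y w = repRidge sigma S lam delta rho n x' y' w := by
  rw [repRidge_eq, repRidge_eq, gram_congr lam hx, gridWidth_congr sigma S lam delta rho hx,
    whitened_congr lam hx hy]

theorem update_actions {d : ℕ} (P : Params) (t : ℕ) (st : State d) (a : Fin d → ℝ) (r : ℝ) :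
    (st.update P t a r).actions = Function.update st.actions t a := by
  unfold State.update
  dsimp only
  split_ifs <;> rfl

theorem update_rewards {d : ℕ} (P : Params) (t : ℕ) (st : State d) (a : Fin d → ℝ) (r : ℝ) :
    (st.update P t a r).rewards = Function.update st.rewards t r := by
  unfold State.update
  dsimp only
  split_ifs <;> rfl

/-- Either a new batch starts after the round, because the budget allows it and the determinant
has grown enough, or the batch goes on. -/
theorem update_cases {d : ℕ} (P : Params) (t : ℕ) (st : State d) (a : Fin d → ℝ) (r : ℝ) :
    ((st.batch + 2 ≤ P.B ∧ P.q * (gram P.lam st.start (Function.update st.actions t a)).det <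
        (gram P.lam (t + 1) (Function.update st.actions t a)).det) ∧
      (st.update P t a r).batch = st.batch + 1 ∧ (st.update P t a r).start = t + 1) ∨
    (¬ (st.batch + 2 ≤ P.B ∧ P.q * (gram P.lam st.start (Function.update st.actions t a)).det <
        (gram P.lam (t + 1) (Function.update st.actions t a)).det) ∧
      (st.update P t a r).batch = st.batch ∧ (st.update P t a r).start = st.start) := by
  unfold State.update
  by_cases h : st.batch + 2 ≤ P.B ∧
      P.q * (gram P.lam st.start (Function.update st.actions t a)).det <
        (gram P.lam (t + 1) (Function.update st.actions t a)).det
  · left; refine ⟨h, ?_⟩; simp [h]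
  · right; refine ⟨h, ?_⟩
    simp only [if_neg h, and_self]

section Run

variable {d : ℕ} {E : Type*} (P : Params) (rule : ℕ → ScoreArg d → Fin d → ℝ)
  (θ : Fin d → ℝ) (noise : Noise d E)

/-- The state records the actions and rewards of the past rounds. -/
theorem run_data (p : Seed d × E) (t : ℕ) : ∀ i < t,
    (run P rule θ noise p.1 p.2 t).actions i = action P rule θ noise i p ∧
    (run P rule θ noise p.1 p.2 t).rewards i = reward P rule θ noise i p := by
  induction t with
  | zero => intro i hi; omega
  | succ t ih =>
    intro i hi
    rw [run_succ, step, update_actions, update_rewards]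
    rcases Nat.lt_succ_iff_lt_or_eq.1 hi with h | rfl
    · rw [Function.update_of_ne h.ne, Function.update_of_ne h.ne]
      exact ih i h
    · rw [Function.update_self, Function.update_self]
      refine ⟨rfl, ?_⟩
      rw [reward, noiseAt, action]
      congr 2
      funext s
      rcases Nat.lt_succ_iff_lt_or_eq.1 s.2 with h | h
      · rw [Function.update_of_ne h.ne]
        exact (ih s h).1
      · rw [h, Function.update_self]
        rfl

theorem run_update_data (p : Seed d × E) (t : ℕ) : ∀ i < t + 1,
    Function.update (run P rule θ noise p.1 p.2 t).actions t
      (chooseAction P rule p.1 t (run P rule θ noise p.1 p.2 t)) i =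
      action P rule θ noise i p := by
  intro i hi
  have h := (run_data P rule θ noise p (t + 1) i hi).1
  rwa [run_succ, step, update_actions] at h

theorem run_start_le (p : Seed d × E) (t : ℕ) : (run P rule θ noise p.1 p.2 t).start ≤ t := by
  induction t with
  | zero => rfl
  | succ t ih =>
    rw [run_succ, step]
    rcases update_cases P t (run P rule θ noise p.1 p.2 t)
      (chooseAction P rule p.1 t (run P rule θ noise p.1 p.2 t)) _ with ⟨_, _, h⟩ | ⟨_, _, h⟩
    · exact h.le
    · exact h.le.trans (by omega)

theorem run_batch_lt (hB : 1 ≤ P.B) (p : Seed d × E) (t : ℕ) :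
    (run P rule θ noise p.1 p.2 t).batch < P.B := by
  induction t with
  | zero => exact hB
  | succ t ih =>
    rw [run_succ, step]
    rcases update_cases P t (run P rule θ noise p.1 p.2 t)
      (chooseAction P rule p.1 t (run P rule θ noise p.1 p.2 t)) _ with ⟨h', h, _⟩ | ⟨_, h, _⟩
    · rw [h]; omega
    · rwa [h]

/-- Each batch multiplies the determinant by more than `q`, and as long as the batch budget is not
exhausted the determinant stays within the factor `q` of its value at the start of the batch. -/
theorem run_det (hlam : 0 < P.lam) (hq : 1 ≤ P.q) (p : Seed d × E) (t : ℕ) :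
    P.q ^ (run P rule θ noise p.1 p.2 t).batch * P.lam ^ d ≤
      (gram P.lam (run P rule θ noise p.1 p.2 t).start
        fun i => action P rule θ noise i p).det ∧
    ((run P rule θ noise p.1 p.2 t).batch + 2 ≤ P.B →
      (gram P.lam t fun i => action P rule θ noise i p).det ≤
        P.q * (gram P.lam (run P rule θ noise p.1 p.2 t).start
          fun i => action P rule θ noise i p).det) := by
  induction t with
  | zero =>
    have h0 : (run P rule θ noise p.1 p.2 0).batch = 0 := rfl
    have h1 : (run P rule θ noise p.1 p.2 0).start = 0 := rfl
    rw [h0, h1, gram_zero, det_smul_one]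
    refine ⟨by simp, fun _ => ?_⟩
    have := pow_pos hlam d
    nlinarith
  | succ t ih =>
    have hstart := run_start_le P rule θ noise p t
    have hdata := run_update_data P rule θ noise p t
    have hg1 := gram_congr P.lam hdata
    have hg2 := gram_congr P.lam (n := (run P rule θ noise p.1 p.2 t).start)
      fun i hi => hdata i (by omega)
    have hpos := det_gram_pos hlam (t + 1) fun i => action P rule θ noise i p
    rw [run_succ, step]
    rcases update_cases P t (run P rule θ noise p.1 p.2 t)
      (chooseAction P rule p.1 t (run P rule θ noise p.1 p.2 t))
      (chooseAction P rule p.1 t (run P rule θ noise p.1 p.2 t) ⬝ᵥ θ + noise t p.2 fun s =>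
        Function.update (run P rule θ noise p.1 p.2 t).actions t
          (chooseAction P rule p.1 t (run P rule θ noise p.1 p.2 t)) s) with
      ⟨hc, hb, hs⟩ | ⟨hc, hb, hs⟩
    · rw [hb, hs]
      rw [hg1, hg2] at hc
      refine ⟨?_, fun _ => by nlinarith⟩
      refine le_trans ?_ hc.2.le
      rw [pow_succ]
      nlinarith [ih.1]
    · rw [hb, hs]
      rw [hg1, hg2] at hc
      exact ⟨ih.1, fun h => not_lt.1 fun h' => hc ⟨h, h'⟩⟩

/-- The batch budget suffices to keep the determinant within the factor `q` of its value at the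
start of the current batch. -/
theorem det_gram_le_mul_start (hlam : 0 < P.lam) (hq : 1 ≤ P.q) (hB : 1 ≤ P.B)
    (p : Seed d × E) (t : ℕ)
    (hdet : (gram P.lam t fun i => action P rule θ noise i p).det ≤ P.q ^ P.B * P.lam ^ d) :
    (gram P.lam t fun i => action P rule θ noise i p).det ≤
      P.q * (gram P.lam (run P rule θ noise p.1 p.2 t).start
        fun i => action P rule θ noise i p).det := by
  obtain ⟨h1, h2⟩ := run_det P rule θ noise hlam hq p t
  by_cases hb : (run P rule θ noise p.1 p.2 t).batch + 2 ≤ P.B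
  · exact h2 hb
  · have h3 := run_batch_lt P rule θ noise hB p t
    have h4 : P.B = (run P rule θ noise p.1 p.2 t).batch + 1 := by omega
    rw [h4, pow_succ] at hdet
    nlinarith

end Run

/-! ### Optimism -/

theorem abs_gridRound_sub_le {d : ℕ} {α : ℝ} (hα : 0 < α) (u z : Fin d → ℝ) (j : Fin d) :
    |(gridRound α u z - z) j| ≤ α / 2 := by
  have h1 := Int.floor_le ((z j - u j) / α)
  have h2 := Int.lt_floor_add_one ((z j - u j) / α)
  rw [le_div_iff₀ hα] at h1
  rw [div_lt_iff₀ hα] at h2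
  simp only [Pi.sub_apply, gridRound]
  rw [abs_le]
  constructor <;> nlinarith

theorem confRadius_nonneg {d : ℕ} {sigma S lam : ℝ} (delta : ℝ) (hs : 0 ≤ sigma) (hS : 0 ≤ S)
    (n : ℕ) (x : ℕ → Fin d → ℝ) : 0 ≤ confRadius sigma S lam delta n x := by
  unfold confRadius
  positivity

/-- Rounding inflates the confidence radius by the factor `1 + d / (ρ - 2 δ)`. -/
theorem matNorm_repRidge_sub_le {d : ℕ} {sigma S lam delta rho : ℝ} (hs : 0 ≤ sigma)
    (hS : 0 ≤ S) (hlam : 0 < lam) (hgap : 0 < rho - 2 * delta) (hd : 1 ≤ d) {n : ℕ}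
    {x : ℕ → Fin d → ℝ} {y : ℕ → ℝ} (w : Fin d → ℝ) {θ : Fin d → ℝ} (hθ : euclNorm θ ≤ S)
    (hconf : matNorm (gram lam n x) (ridge lam n x y - θ) ≤ confRadius sigma S lam delta n x) :
    matNorm (gram lam n x) (repRidge sigma S lam delta rho n x y w - θ) ≤
      confRadius sigma S lam delta n x * (1 + d / (rho - 2 * delta)) := by
  have hV := gram_posDef hlam n x
  have hβ := confRadius_nonneg (lam := lam) delta hs hS n x
  have hd0 : (0 : ℝ) < d := by exact_mod_cast hd
  rcases hβ.eq_or_lt with h0 | hpos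
  · -- a vanishing radius forces `S = 0`, hence `θ = 0`, and the grid of width `0` rounds to `0`
    have hS0 : S = 0 := by
      have h1 : √lam * S ≤ confRadius sigma S lam delta n x := by
        unfold confRadius
        have : 0 ≤ sigma * √(2 * Real.log (√((gram lam n x).det) /
          (√((lam • (1 : Matrix (Fin d) (Fin d) ℝ)).det) * delta))) := by positivity
        linarith
      rw [← h0] at h1
      have := Real.sqrt_pos.2 hlam
      nlinarith
    have hθ0 : θ = 0 := by
      rw [hS0] at hθ
      have := le_antisymm hθ (euclNorm_nonneg θ)
      simpa [euclNorm] using this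
    have hα : gridWidth sigma S lam delta rho n x = 0 := by
      rw [gridWidth, ← h0]; simp
    have hr : repRidge sigma S lam delta rho n x y w = 0 := by
      rw [repRidge_eq, hα]
      have : gridRound 0 ((0 : ℝ) • w) (whitened lam n x y) = 0 := by
        ext j; simp [gridRound]
      rw [this, Matrix.mulVec_zero]
    rw [hr, hθ0, ← h0]
    simp [matNorm]
  · have hα : 0 < gridWidth sigma S lam delta rho n x := by
      unfold gridWidth
      have : 0 < √(d : ℝ) := Real.sqrt_pos.2 hd0
      positivity
    have hsplit : repRidge sigma S lam delta rho n x y w - θ =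
        (repRidge sigma S lam delta rho n x y w - ridge lam n x y) +
          (ridge lam n x y - θ) := by abel
    have hround : matNorm (gram lam n x) (repRidge sigma S lam delta rho n x y w -
        ridge lam n x y) ≤ confRadius sigma S lam delta n x * (d / (rho - 2 * delta)) := by
      rw [matNorm_eq_euclNorm hV, Matrix.mulVec_sub, repRidge_eq,
        mulVec_inv_mulVec (isUnit_det_matSqrt hV)]
      refine (euclNorm_le_of_abs_le (half_pos hα).le
        (abs_gridRound_sub_le hα _ (whitened lam n x y))).trans (le_of_eq ?_)
      rw [gridWidth]
      have := Real.mul_self_sqrt hd0.le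
      field_simp
      rw [sq, this]
    rw [hsplit]
    refine (matNorm_add_le hV _ _).trans ?_
    rw [mul_add, mul_one, add_comm]
    gcongr

/-- The optimism argument: inside the confidence ellipsoid the loss of the maximizer of the score
is at most twice its bonus. -/
theorem dotProduct_sub_le_of_ucb {d : ℕ} {V : Matrix (Fin d) (Fin d) ℝ} (hV : V.PosDef)
    {θ θ' a b : Fin d → ℝ} {β : ℝ} (hβ : matNorm V (θ' - θ) ≤ β)
    (hmax : ucbScore θ' β V b ≤ ucbScore θ' β V a) :
    b ⬝ᵥ θ - a ⬝ᵥ θ ≤ 2 * β * matNorm V⁻¹ a := by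
  unfold ucbScore at hmax
  have h1 := abs_le.1 (abs_dotProduct_le_matNorm hV a (θ' - θ))
  have h2 := abs_le.1 (abs_dotProduct_le_matNorm hV b (θ' - θ))
  rw [dotProduct_sub] at h1 h2
  have h3 := mul_le_mul_of_nonneg_left hβ (matNorm_nonneg V⁻¹ a)
  have h4 := mul_le_mul_of_nonneg_left hβ (matNorm_nonneg V⁻¹ b)
  linarith [h1.2, h2.1]

theorem action_mem {d : ℕ} {E : Type*} {T : ℕ} {A : ℕ → Set (Fin d → ℝ)} {P : Params}
    {rule : ℕ → ScoreArg d → Fin d → ℝ} (hrule : IsArgmaxRule T A rule) (hlam : 0 < P.lam)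
    (θ : Fin d → ℝ) (noise : Noise d E) {t : ℕ} (ht : t < T) (p : Seed d × E) :
    action P rule θ noise t p ∈ A t :=
  hrule.mem t ht _ _ _ (gram_posDef hlam _ _)

/-- The loss of one round on the confidence event, in terms of the width of the played action in
the current Gram matrix. -/
theorem loss_le_of_confident {d : ℕ} {E : Type*} {T : ℕ} {A : ℕ → Set (Fin d → ℝ)}
    {P : Params} {rule : ℕ → ScoreArg d → Fin d → ℝ} {θ : Fin d → ℝ} {noise : Noise d E}
    (hrule : IsArgmaxRule T A rule) (hs : 0 ≤ P.sigma) (hS : 0 ≤ P.S) (hlam : 0 < P.lam)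
    (hq : 1 ≤ P.q) (hB : 1 ≤ P.B) (hd : 1 ≤ d) (hθ : euclNorm θ ≤ P.S) {delta rho : ℝ}
    (hdelta : ∀ b, P.deltaB b = delta) (hrho : ∀ b, P.rhoB b = rho)
    (hgap : 0 < rho - 2 * delta) {p : Seed d × E}
    (hp : p ∈ confident T P rule θ noise delta)
    (hdet : ∀ t ≤ T, (gram P.lam t fun i => action P rule θ noise i p).det ≤
      P.q ^ P.B * P.lam ^ d) {β : ℝ}
    (hβ : ∀ t ≤ T, confRadius P.sigma P.S P.lam delta t
      (fun i => action P rule θ noise i p) * (1 + d / (rho - 2 * delta)) ≤ β)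
    {t : ℕ} (ht : t < T) {b : Fin d → ℝ} (hb : b ∈ A t) :
    b ⬝ᵥ θ - action P rule θ noise t p ⬝ᵥ θ ≤ 2 * β * √P.q *
      matNorm (gram P.lam t fun i => action P rule θ noise i p)⁻¹
        (action P rule θ noise t p) := by
  set st := run P rule θ noise p.1 p.2 t with hst
  have hstart : st.start ≤ t := run_start_le P rule θ noise p t
  have hdata := run_data P rule θ noise p t
  have hx : ∀ i < st.start, st.actions i = action P rule θ noise i p :=
    fun i hi => (hdata i (by omega)).1
  have hy : ∀ i < st.start, st.rewards i = reward P rule θ noise i p :=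
    fun i hi => (hdata i (by omega)).2
  have hV := gram_posDef hlam st.start fun i => action P rule θ noise i p
  have hmax := hrule.isMax t ht (batchEstimate P p.1 st) (batchRadius P st)
    (fun i j => gram P.lam st.start st.actions i j) (gram_posDef hlam _ _) b hb
  change ucbScore (batchEstimate P p.1 st) (batchRadius P st)
    (gram P.lam st.start st.actions) b ≤ ucbScore (batchEstimate P p.1 st) (batchRadius P st)
    (gram P.lam st.start st.actions) (action P rule θ noise t p) at hmax
  have hrad : batchRadius P st = confRadius P.sigma P.S P.lam delta st.start
      (fun i => action P rule θ noise i p) * (1 + d / (rho - 2 * delta)) := by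
    rw [batchRadius, hdelta, hrho, confRadius_congr _ _ _ _ hx]
  have hest : matNorm (gram P.lam st.start fun i => action P rule θ noise i p)
      (batchEstimate P p.1 st - θ) ≤ batchRadius P st := by
    rw [hrad, batchEstimate, hdelta, hrho, repRidge_congr _ _ _ _ _ _ hx hy]
    exact matNorm_repRidge_sub_le hs hS hlam hgap hd _ hθ (hp st.start (by omega))
  rw [gram_congr P.lam hx] at hmax
  have hloss := dotProduct_sub_le_of_ucb hV hest hmax
  have hcmp : matNorm (gram P.lam st.start fun i => action P rule θ noise i p)⁻¹
      (action P rule θ noise t p) ≤ √P.q *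
      matNorm (gram P.lam t fun i => action P rule θ noise i p)⁻¹
        (action P rule θ noise t p) := by
    have h1 := matNorm_inv_gram_sq_le hlam hstart (fun i => action P rule θ noise i p)
      (action P rule θ noise t p)
    have h2 := det_gram_le_mul_start P rule θ noise hlam hq hB p t (hdet t ht.le)
    have h3 := det_gram_pos hlam st.start fun i => action P rule θ noise i p
    rw [← hst] at h2
    set N := matNorm (gram P.lam t fun i => action P rule θ noise i p)⁻¹
      (action P rule θ noise t p) with hN
    have hN0 : 0 ≤ N := matNorm_nonneg _ _
    refine abs_le_of_sq_le_sq' ?_ (by positivity) |>.2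
    rw [mul_pow, Real.sq_sqrt (by linarith)]
    have h4 := mul_le_mul_of_nonneg_right h2 (sq_nonneg N)
    refine le_of_mul_le_mul_left ?_ h3
    linarith
  have hrad0 : 0 ≤ batchRadius P st := (matNorm_nonneg _ _).trans hest
  have hradβ : batchRadius P st ≤ β := hrad ▸ hβ st.start (by omega)
  have hw0 := matNorm_nonneg (gram P.lam t fun i => action P rule θ noise i p)⁻¹
        (action P rule θ noise t p)
  calc _ ≤ 2 * batchRadius P st * _ := hloss
    _ ≤ 2 * batchRadius P st * (√P.q *
      matNorm (gram P.lam t fun i => action P rule θ noise i p)⁻¹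
        (action P rule θ noise t p)) := by gcongr
    _ ≤ 2 * β * (√P.q *
      matNorm (gram P.lam t fun i => action P rule θ noise i p)⁻¹
        (action P rule θ noise t p)) := by gcongr
    _ = _ := by ring

/-- From the elliptical potential to the regret, by Cauchy–Schwarz. -/
theorem sum_le_of_le_mul_sqrt {T : ℕ} {r m : ℕ → ℝ} {D Λ : ℝ} (hD : 0 ≤ D)
    (hm : ∀ t, 0 ≤ m t) (hsum : ∑ t ∈ Finset.range T, m t ≤ 2 * Λ)
    (hr : ∀ t < T, r t ≤ D * √(m t)) :
    ∑ t ∈ Finset.range T, r t ≤ 2 * D * √(T * Λ) := by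
  have h1 : ∑ t ∈ Finset.range T, √(m t) ≤ 2 * √(T * Λ) := by
    have h2 : √(T * (2 * Λ)) ≤ 2 * √(T * Λ) := by
      have hΛ : 0 ≤ Λ := by
        have := Finset.sum_nonneg (s := Finset.range T) fun t _ => hm t
        linarith
      apply Real.sqrt_le_iff.2
      refine ⟨by positivity, ?_⟩
      rw [mul_pow, Real.sq_sqrt (by positivity)]
      nlinarith [mul_nonneg (Nat.cast_nonneg (α := ℝ) T) hΛ]
    refine le_trans (Real.le_sqrt_of_sq_le ?_) h2
    have h3 := sq_sum_le_card_mul_sum_sq (s := Finset.range T) (f := fun t => √(m t))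
    simp only [Finset.card_range, Real.sq_sqrt (hm _)] at h3
    exact h3.trans (by gcongr)
  calc ∑ t ∈ Finset.range T, r t ≤ ∑ t ∈ Finset.range T, D * √(m t) :=
        Finset.sum_le_sum fun t ht => hr t (Finset.mem_range.1 ht)
    _ = D * ∑ t ∈ Finset.range T, √(m t) := by rw [Finset.mul_sum]
    _ ≤ D * (2 * √(T * Λ)) := by gcongr
    _ = _ := by ring

end RepLin

namespace RepLin

open scoped ENNReal

/-! ### The parameters -/

section Parameters

variable {d T : ℕ} {sigma S lam L delta rho : ℝ}

theorem growth_pos (hd : 1 ≤ d) (hT : 1 ≤ T) (hlam : 0 < lam) (hL : 0 < L) :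
    0 < T * L ^ 2 / (lam * d) := by
  have : (0 : ℝ) < d := by exact_mod_cast hd
  have : (0 : ℝ) < T := by exact_mod_cast hT
  positivity

theorem logDet_pos (hd : 1 ≤ d) (hT : 1 ≤ T) (hlam : 0 < lam) (hL : 0 < L) :
    0 < logDet d T lam L := by
  have h := growth_pos hd hT hlam hL
  have : (0 : ℝ) < d := by exact_mod_cast hd
  exact mul_pos this (Real.log_pos (by linarith))

theorem one_le_numBatches (hd : 1 ≤ d) (hT : 1 ≤ T) (hlam : 0 < lam) (hL : 0 < L) :
    1 ≤ numBatches d T lam L :=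
  Nat.one_le_ceil_iff.2 (logDet_pos hd hT hlam hL)

theorem mainParams_q_eq (hd : 1 ≤ d) (hT : 1 ≤ T) (hlam : 0 < lam) (hL : 0 < L) :
    (mainParams d T sigma S lam L delta rho).q =
      Real.exp (logDet d T lam L / numBatches d T lam L) := by
  have h := growth_pos hd hT hlam hL
  simp only [mainParams]
  rw [Real.rpow_def_of_pos (by linarith), logDet]
  congr 1
  ring

theorem one_le_mainParams_q (hd : 1 ≤ d) (hT : 1 ≤ T) (hlam : 0 < lam) (hL : 0 < L) :
    1 ≤ (mainParams d T sigma S lam L delta rho).q := by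
  rw [mainParams_q_eq hd hT hlam hL]
  have := logDet_pos hd hT hlam hL
  exact Real.one_le_exp (by positivity)

theorem sqrt_mainParams_q_le (hd : 1 ≤ d) (hT : 1 ≤ T) (hlam : 0 < lam) (hL : 0 < L) :
    √(mainParams d T sigma S lam L delta rho).q ≤ 2 := by
  rw [mainParams_q_eq hd hT hlam hL]
  have hB := one_le_numBatches hd hT hlam hL
  have hB' : (0 : ℝ) < numBatches d T lam L := by exact_mod_cast hB
  have h1 : logDet d T lam L / numBatches d T lam L ≤ 1 :=
    (div_le_one hB').2 (Nat.le_ceil _)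
  apply Real.sqrt_le_iff.2
  refine ⟨by norm_num, ?_⟩
  have := Real.exp_le_exp.2 h1
  have := Real.exp_one_lt_d9
  linarith

theorem mainParams_q_pow (hd : 1 ≤ d) (hT : 1 ≤ T) (hlam : 0 < lam) (hL : 0 < L) :
    (mainParams d T sigma S lam L delta rho).q ^ (mainParams d T sigma S lam L delta rho).B =
      (1 + T * L ^ 2 / (lam * d)) ^ d := by
  have h := growth_pos hd hT hlam hL
  have hB := one_le_numBatches hd hT hlam hL
  have hB' : (0 : ℝ) < numBatches d T lam L := by exact_mod_cast hB
  simp only [mainParams]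
  rw [← Real.rpow_natCast, ← Real.rpow_mul (by linarith), div_mul_cancel₀ _ hB'.ne',
    Real.rpow_natCast]

/-- The confidence radius at confidence `δ / B` in terms of the bound on the determinants. The
factor `2` absorbs the `2` in front of `log (B / δ)`. -/
theorem confRadius_le_of_det_le (hs : 0 ≤ sigma) (hlam : 0 < lam)
    (hdelta : 0 < delta) (hdelta1 : delta < 1) {B : ℕ} (hB : 1 ≤ B) {n : ℕ}
    {x : ℕ → Fin d → ℝ} {Λ : ℝ} (hΛ : 0 ≤ Λ)
    (hdet : Real.log ((gram lam n x).det / lam ^ d) ≤ Λ) (hS : 0 ≤ S) :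
    confRadius sigma S lam (delta / B) n x ≤
      2 * (sigma * √(Λ + Real.log (B / delta)) + √lam * S) := by
  have hB' : (1 : ℝ) ≤ B := by exact_mod_cast hB
  have hdet0 := det_gram_pos hlam n x
  have hlog0 : 0 ≤ Real.log (B / delta) :=
    Real.log_nonneg ((one_le_div hdelta).2 (by linarith))
  have hlog : 2 * Real.log (√((gram lam n x).det) /
      (√((lam • (1 : Matrix (Fin d) (Fin d) ℝ)).det) * (delta / B))) ≤
      2 ^ 2 * (Λ + Real.log (B / delta)) := by
    rw [det_smul_one]
    have h1 : √((gram lam n x).det) / (√(lam ^ d) * (delta / B)) =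
        √((gram lam n x).det / lam ^ d) * (B / delta) := by
      rw [Real.sqrt_div hdet0.le]
      field_simp
    have h2 : 0 < (gram lam n x).det / lam ^ d := by positivity
    rw [h1, Real.log_mul (Real.sqrt_pos.2 h2).ne' (by positivity), Real.log_sqrt h2.le]
    linarith
  have hsqrt := Real.sqrt_le_sqrt hlog
  rw [Real.sqrt_mul (show (0 : ℝ) ≤ 2 ^ 2 by norm_num), Real.sqrt_sq (by norm_num)] at hsqrt
  have h3 := mul_le_mul_of_nonneg_left hsqrt hs
  have h4 : 0 ≤ √lam * S := by positivity
  unfold confRadius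
  linarith

/-- The gap `ρ - 2 δ` is at least `ρ / 3`. -/
theorem one_add_div_gap_le (hdelta : 0 < delta) (hrho : 3 * delta < rho) {B : ℕ} (hB : 1 ≤ B) :
    1 + (d : ℝ) / (rho / B - 2 * (delta / B)) ≤ 3 * (1 + d * B / rho) := by
  have hB' : (0 : ℝ) < B := by exact_mod_cast hB
  have h1 : rho / B - 2 * (delta / B) = (rho - 2 * delta) / B := by ring
  have h2 : (d : ℝ) * B / (rho - 2 * delta) ≤ 3 * (d * B / rho) := by
    rw [← mul_div_assoc, div_le_div_iff₀ (by linarith) (by linarith)]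
    have : (0 : ℝ) ≤ d * B := by positivity
    nlinarith
  rw [h1, div_div_eq_mul_div]
  linarith

end Parameters

/-! ### Regret -/

section Regret

variable {d T : ℕ} {sigma S lam L delta rho : ℝ} {A : ℕ → Set (Fin d → ℝ)}
  {rule : ℕ → ScoreArg d → Fin d → ℝ} {θ : Fin d → ℝ} {E : Type*} {noise : Noise d E}

theorem radiusBound_nonneg (hs : 0 ≤ sigma) (hS : 0 ≤ S) (hrho : 0 < rho) :
    0 ≤ radiusBound d T sigma S lam L delta rho := by
  unfold radiusBound
  positivity

/-- The loss of one round and the sum of the squared widths, on the confidence event. -/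
theorem loss_le_and_potential_le (hd : 1 ≤ d) (hT : 1 ≤ T) (hs : 0 ≤ sigma) (hS : 0 ≤ S)
    (hlam : 0 < lam) (hL : 0 < L) (hdelta : 0 < delta) (hdelta1 : delta < 1)
    (hrho : 3 * delta < rho)
    (hA : ∀ t < T, ∀ a ∈ A t, euclNorm a ≤ L) (hrule : IsArgmaxRule T A rule)
    (hθ : euclNorm θ ≤ S) {p : Seed d × E}
    (hp : p ∈ confident T (mainParams d T sigma S lam L delta rho) rule θ noise
      (delta / numBatches d T lam L)) :
    (∀ t < T, ∀ b ∈ A t,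
      b ⬝ᵥ θ - action (mainParams d T sigma S lam L delta rho) rule θ noise t p ⬝ᵥ θ ≤
        24 * radiusBound d T sigma S lam L delta rho *
        matNorm (gram lam t fun i =>
          action (mainParams d T sigma S lam L delta rho) rule θ noise i p)⁻¹
          (action (mainParams d T sigma S lam L delta rho) rule θ noise t p)) ∧
    ∑ t ∈ Finset.range T, min 1 (matNorm (gram lam t fun i =>
          action (mainParams d T sigma S lam L delta rho) rule θ noise i p)⁻¹
          (action (mainParams d T sigma S lam L delta rho) rule θ noise t p) ^ 2) ≤
        2 * logDet d T lam L := by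
  set P := mainParams d T sigma S lam L delta rho with hP
  have hB := one_le_numBatches hd hT hlam hL
  have hB' : (1 : ℝ) ≤ numBatches d T lam L := by exact_mod_cast hB
  have hΛ := logDet_pos hd hT hlam hL
  have hgrow := growth_pos hd hT hlam hL
  have hx : ∀ i < T, euclNorm (action P rule θ noise i p) ≤ L := fun i hi =>
    hA i hi _ (action_mem hrule hlam θ noise hi p)
  have hdetT := det_gram_le hd hlam T (fun i => action P rule θ noise i p) hx
  have hdet : ∀ t ≤ T, (gram lam t fun i => action P rule θ noise i p).det ≤
      lam ^ d * (1 + T * L ^ 2 / (lam * d)) ^ d := fun t ht =>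
    (det_gram_mono hlam (fun i => action P rule θ noise i p) ht).trans hdetT
  have hlogdet : ∀ t ≤ T, Real.log ((gram lam t fun i => action P rule θ noise i p).det /
      lam ^ d) ≤ logDet d T lam L := by
    intro t ht
    have h0 := det_gram_pos hlam t fun i => action P rule θ noise i p
    rw [logDet, ← Real.log_pow]
    refine Real.log_le_log (by positivity) ?_
    rw [div_le_iff₀ (by positivity), mul_comm]
    exact hdet t ht
  have hgap : 0 < rho / numBatches d T lam L - 2 * (delta / numBatches d T lam L) := by
    rw [← mul_div_assoc, ← sub_div]
    exact div_pos (by linarith) (by linarith)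
  refine ⟨fun t ht b hb => ?_, ?_⟩
  · have hβ : ∀ t ≤ T, confRadius P.sigma P.S P.lam (delta / numBatches d T lam L) t
        (fun i => action P rule θ noise i p) * (1 + d / (rho / numBatches d T lam L -
          2 * (delta / numBatches d T lam L))) ≤
        6 * radiusBound d T sigma S lam L delta rho := by
      intro t ht
      have h1 := confRadius_le_of_det_le (sigma := sigma) (S := S) hs hlam hdelta hdelta1 hB
        hΛ.le (hlogdet t ht) hS
      have h2 := one_add_div_gap_le (d := d) hdelta hrho hB
      have h3 : 0 ≤ 1 + (d : ℝ) / (rho / numBatches d T lam L -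
          2 * (delta / numBatches d T lam L)) := by positivity
      have h4 : 0 ≤ 2 * (sigma * √(logDet d T lam L +
        Real.log (numBatches d T lam L / delta)) + √lam * S) := by positivity
      calc _ ≤ _ * _ := mul_le_mul h1 h2 h3 h4
        _ = _ := by rw [radiusBound]; ring
    have h := loss_le_of_confident (P := P) hrule hs hS hlam
      (one_le_mainParams_q hd hT hlam hL) hB hd hθ (fun _ => rfl) (fun _ => rfl) hgap hp
      (fun t ht => by
        rw [hP, mainParams_q_pow hd hT hlam hL, mul_comm]
        exact hdet t ht) hβ ht hb
    refine h.trans ?_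
    have h5 := sqrt_mainParams_q_le (sigma := sigma) (S := S) (delta := delta) (rho := rho)
      hd hT hlam hL
    have h6 := radiusBound_nonneg (d := d) (T := T) (lam := lam) (L := L) (delta := delta)
      hs hS (show 0 < rho by linarith)
    have h7 := matNorm_nonneg (gram lam t fun i => action P rule θ noise i p)⁻¹
      (action P rule θ noise t p)
    -- `24 = 2 · 6 · 2`: the optimism argument, the radius and `√q ≤ 2`
    calc _ ≤ 2 * (6 * radiusBound d T sigma S lam L delta rho) * 2 * _ := by
          gcongr
      _ = _ := by
          rw [show P.lam = lam from rfl]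
          ring
  · refine (sum_min_one_matNorm_sq_le hlam T fun i => action P rule θ noise i p).trans ?_
    have := hlogdet T le_rfl
    linarith

theorem regret_le_of_confident (hd : 1 ≤ d) (hT : 1 ≤ T) (hs : 0 ≤ sigma) (hS : 0 ≤ S)
    (hlam : 0 < lam) (hL : 0 < L) (hdelta : 0 < delta) (hdelta1 : delta < 1)
    (hrho : 3 * delta < rho)
    (hA : ∀ t < T, ∀ a ∈ A t, euclNorm a ≤ L) (hrule : IsArgmaxRule T A rule)
    (hθ : euclNorm θ ≤ S) {aStar : ℕ → Fin d → ℝ} (haStar : ∀ t < T, aStar t ∈ A t)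
    {p : Seed d × E}
    (hp : p ∈ confident T (mainParams d T sigma S lam L delta rho) rule θ noise
      (delta / numBatches d T lam L)) :
    regret T (mainParams d T sigma S lam L delta rho) rule θ noise aStar p ≤
      48 * max 1 (L / √lam) * radiusBound d T sigma S lam L delta rho *
        √(T * logDet d T lam L) := by
  obtain ⟨h1, h2⟩ := loss_le_and_potential_le hd hT hs hS hlam hL hdelta hdelta1 hrho hA hrule
    hθ hp
  have hR := radiusBound_nonneg (d := d) (T := T) (lam := lam) (L := L) (delta := delta)
      hs hS (show 0 < rho by linarith)
  have hmax : 0 ≤ max 1 (L / √lam) := zero_le_one.trans (le_max_left _ _)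
  refine (sum_le_of_le_mul_sqrt (D := 24 * radiusBound d T sigma S lam L delta rho *
    max 1 (L / √lam)) (by positivity) (fun t => le_min zero_le_one (sq_nonneg _)) h2
    fun t ht => (h1 t ht _ (haStar t ht)).trans ?_).trans (le_of_eq (by ring))
  rw [mul_assoc _ (max _ _)]
  gcongr
  set a := action (mainParams d T sigma S lam L delta rho) rule θ noise t p
  set V := gram lam t fun i => action (mainParams d T sigma S lam L delta rho) rule θ noise i p
  have hw0 := matNorm_nonneg V⁻¹ a
  rcases le_total 1 (matNorm V⁻¹ a) with h | h
  · -- a width above `1` is at most `L / √λ`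
    rw [min_eq_left (by nlinarith), Real.sqrt_one, mul_one]
    refine le_trans ?_ (le_max_right _ _)
    rw [le_div_iff₀ (Real.sqrt_pos.2 hlam), mul_comm]
    exact (matNorm_inv_gram_le hlam t _ a).trans
      (hA t ht _ (action_mem hrule hlam θ noise ht p))
  · rw [min_eq_right (by nlinarith), Real.sqrt_sq hw0]
    exact le_mul_of_one_le_left hw0 (le_max_left _ _)

theorem regret_le_of_confident_of_loss_le (hd : 1 ≤ d) (hT : 1 ≤ T) (hs : 0 ≤ sigma)
    (hS : 0 ≤ S) (hlam : 0 < lam) (hL : 0 < L) (hdelta : 0 < delta) (hdelta1 : delta < 1)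
    (hrho : 3 * delta < rho)
    (hA : ∀ t < T, ∀ a ∈ A t, euclNorm a ≤ L) (hrule : IsArgmaxRule T A rule)
    (hθ : euclNorm θ ≤ S) {aStar : ℕ → Fin d → ℝ} (haStar : ∀ t < T, aStar t ∈ A t)
    {G : ℝ} (hG : ∀ t < T, ∀ a ∈ A t, aStar t ⬝ᵥ θ - a ⬝ᵥ θ ≤ G) {p : Seed d × E}
    (hp : p ∈ confident T (mainParams d T sigma S lam L delta rho) rule θ noise
      (delta / numBatches d T lam L)) :
    regret T (mainParams d T sigma S lam L delta rho) rule θ noise aStar p ≤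
      48 * max G (radiusBound d T sigma S lam L delta rho) * √(T * logDet d T lam L) := by
  obtain ⟨h1, h2⟩ := loss_le_and_potential_le hd hT hs hS hlam hL hdelta hdelta1 hrho hA hrule
    hθ hp
  have hR := radiusBound_nonneg (d := d) (T := T) (lam := lam) (L := L) (delta := delta)
      hs hS (show 0 < rho by linarith)
  have hmax : 0 ≤ max G (radiusBound d T sigma S lam L delta rho) := hR.trans (le_max_right _ _)
  refine (sum_le_of_le_mul_sqrt (D := 24 * max G (radiusBound d T sigma S lam L delta rho))
    (by positivity) (fun t => le_min zero_le_one (sq_nonneg _)) h2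
    fun t ht => ?_).trans (le_of_eq (by ring))
  have h3 := h1 t ht _ (haStar t ht)
  have h4 := hG t ht _ (action_mem (P := mainParams d T sigma S lam L delta rho) hrule hlam θ
    noise ht p)
  set a := action (mainParams d T sigma S lam L delta rho) rule θ noise t p
  set V := gram lam t fun i => action (mainParams d T sigma S lam L delta rho) rule θ noise i p
  have hw0 := matNorm_nonneg V⁻¹ a
  rcases le_total 1 (matNorm V⁻¹ a) with h | h
  · rw [min_eq_left (by nlinarith), Real.sqrt_one, mul_one]
    have := le_max_left G (radiusBound d T sigma S lam L delta rho)
    linarith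
  · rw [min_eq_right (by nlinarith), Real.sqrt_sq hw0]
    refine h3.trans ?_
    gcongr
    exact le_max_right _ _

/-- The regret bound in terms of `d`, `T`, `ρ` and a squared logarithm. -/
theorem regretBound_le_rate (hd : 1 ≤ d) (hT : 1 ≤ T) (hs : 0 ≤ sigma) (hS : 0 ≤ S)
    (hlam : 0 < lam) (hL : 0 < L) (hdelta : 0 < delta) (hdelta1 : delta < 1) (hrho0 : 0 < rho) :
    radiusBound d T sigma S lam L delta rho * √(T * logDet d T lam L) ≤
      (2 * sigma * √(Real.log (1 + L ^ 2 / lam) + 1) + √lam * S) *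
        (2 * (Real.log (1 + L ^ 2 / lam) + 1) * √(Real.log (1 + L ^ 2 / lam) + 1)) *
      ((d + d ^ 3 / rho) * √T * Real.log (Real.exp 1 + d * T / delta) ^ 2) := by
  have hd1 : (1 : ℝ) ≤ d := by exact_mod_cast hd
  have hT1 : (1 : ℝ) ≤ T := by exact_mod_cast hT
  have he : (2 : ℝ) ≤ Real.exp 1 := by
    have := Real.add_one_le_exp (1 : ℝ)
    linarith
  have hc : 0 < L ^ 2 / lam := by positivity
  have hdT : (1 : ℝ) ≤ d * T := by nlinarith
  have hdTδ : (d * T : ℝ) ≤ d * T / delta := by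
    rw [le_div_iff₀ hdelta]; nlinarith
  set k := Real.log (1 + L ^ 2 / lam) + 1 with hk
  set ℓ := Real.log (Real.exp 1 + d * T / delta) with hℓ
  have hk1 : 1 ≤ k := by
    have := Real.log_nonneg (show 1 ≤ 1 + L ^ 2 / lam by linarith)
    linarith
  have hℓ1 : 1 ≤ ℓ := by
    rw [hℓ, Real.le_log_iff_exp_le (by positivity)]
    linarith
  have hlogT : Real.log (1 + T) ≤ ℓ := by
    refine Real.log_le_log (by linarith) ?_
    nlinarith
  have hlogδ : Real.log (1 / delta) ≤ ℓ := by
    refine Real.log_le_log (by positivity) ?_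
    have : 1 / delta ≤ d * T / delta := by gcongr
    linarith
  have hΛ0 := logDet_pos hd hT hlam hL
  have hΛ : logDet d T lam L ≤ d * (k * ℓ) := by
    unfold logDet
    gcongr
    have h0 := growth_pos hd hT hlam hL
    have h1 : 1 + T * L ^ 2 / (lam * d) ≤ (1 + L ^ 2 / lam) * (1 + T) := by
      have : T * L ^ 2 / (lam * d) ≤ L ^ 2 / lam * T := by
        rw [div_mul_eq_mul_div, mul_comm (L ^ 2)]
        gcongr
        exact le_mul_of_one_le_right hlam.le hd1
      nlinarith
    calc _ ≤ Real.log ((1 + L ^ 2 / lam) * (1 + T)) := Real.log_le_log (by linarith) h1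
      _ = Real.log (1 + L ^ 2 / lam) + Real.log (1 + T) := by
          rw [Real.log_mul (by positivity) (by positivity)]
      _ ≤ k * ℓ := by
          have := Real.log_nonneg (show 1 ≤ 1 + L ^ 2 / lam by linarith)
          rw [hk]; nlinarith
  have hkℓ : 1 ≤ k * ℓ := one_le_mul_of_one_le_of_one_le hk1 hℓ1
  have hdkℓ : 1 ≤ d * (k * ℓ) := one_le_mul_of_one_le_of_one_le hd1 hkℓ
  have hB := one_le_numBatches hd hT hlam hL
  set B := numBatches d T lam L with hBdef
  have hB1 : (1 : ℝ) ≤ B := by exact_mod_cast hB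
  have hBle : (B : ℝ) ≤ 2 * (d * (k * ℓ)) := by
    have := Nat.ceil_lt_add_one hΛ0.le
    rw [← numBatches, ← hBdef] at this
    linarith
  have hrad : logDet d T lam L + Real.log (B / delta) ≤ 2 ^ 2 * k * (d * ℓ) := by
    have h1 : Real.log (B / delta) = Real.log B + Real.log (1 / delta) := by
      rw [← Real.log_mul (by positivity) (by positivity)]
      congr 1
      ring
    have h2 : Real.log B ≤ B := (Real.log_le_sub_one_of_pos (by linarith)).trans (by linarith)
    have h3 : ℓ ≤ d * (k * ℓ) := by nlinarith
    rw [h1]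
    linarith
  have hdℓ : 1 ≤ d * ℓ := one_le_mul_of_one_le_of_one_le hd1 hℓ1
  have hsq : 1 ≤ √(d * ℓ) := Real.one_le_sqrt.2 hdℓ
  have f1 : sigma * √(logDet d T lam L + Real.log (B / delta)) + √lam * S ≤
      (2 * sigma * √k + √lam * S) * √(d * ℓ) := by
    have h1 := Real.sqrt_le_sqrt hrad
    rw [Real.sqrt_mul (by positivity), Real.sqrt_mul (by positivity),
      Real.sqrt_sq (by norm_num)] at h1
    have h2 : √lam * S ≤ √lam * S * √(d * ℓ) := le_mul_of_one_le_right (by positivity) hsq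
    have h3 := mul_le_mul_of_nonneg_left h1 hs
    linarith
  have f2 : 1 + d * B / rho ≤ 2 * k * ℓ * (1 + d ^ 2 / rho) := by
    have h1 : d * B / rho ≤ d * (2 * (d * (k * ℓ))) / rho := by gcongr
    have h2 : d * (2 * (d * (k * ℓ))) / rho = 2 * k * ℓ * (d ^ 2 / rho) := by ring
    linarith
  have f3 : √(T * logDet d T lam L) ≤ √T * (√k * √(d * ℓ)) := by
    rw [Real.sqrt_mul (by positivity), ← Real.sqrt_mul (by positivity) (d * ℓ)]
    refine mul_le_mul_of_nonneg_left (Real.sqrt_le_sqrt ?_) (Real.sqrt_nonneg _)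
    linarith
  have g1 : 0 ≤ sigma * √(logDet d T lam L + Real.log (B / delta)) + √lam * S := by positivity
  calc radiusBound d T sigma S lam L delta rho * √(T * logDet d T lam L)
      ≤ ((2 * sigma * √k + √lam * S) * √(d * ℓ)) * (2 * k * ℓ * (1 + d ^ 2 / rho)) *
        (√T * (√k * √(d * ℓ))) := by
        rw [radiusBound]
        gcongr
    _ = (2 * sigma * √k + √lam * S) * (2 * k * √k) * ((√(d * ℓ) * √(d * ℓ)) * ℓ *
        (1 + d ^ 2 / rho) * √T) := by ring
    _ = _ := by
        rw [Real.mul_self_sqrt (by positivity)]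
        ring

/-- A bound on the confidence event holds with probability at least `1 - δ`. -/
theorem regretAtMost_of_confident [MeasurableSpace E] {envLaw : Measure E}
    [IsProbabilityMeasure envLaw] {P : Params} (hM : MeasurableModel P rule noise)
    (hs : 0 ≤ P.sigma) (hθ : euclNorm θ ≤ P.S)
    (hsub : CondSubGaussian T P rule θ noise envLaw) {delta' : ℝ} (hdelta' : 0 < delta')
    (hle : delta' ≤ delta) {aStar : ℕ → Fin d → ℝ} {R : ℝ}
    (h : ∀ p ∈ confident T P rule θ noise delta', regret T P rule θ noise aStar p ≤ R) :
    RegretAtMost T P rule θ noise envLaw aStar delta R := by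
  have h1 := measure_compl_confident_le hM hs hθ hsub hdelta'
  have h2 : ENNReal.ofReal (1 - delta) ≤
      ((seedLaw d).prod envLaw) (confident T P rule θ noise delta') := by
    rw [ENNReal.ofReal_sub _ (hdelta'.le.trans hle), ENNReal.ofReal_one, tsub_le_iff_right]
    calc (1 : ℝ≥0∞) = ((seedLaw d).prod envLaw) (confident T P rule θ noise delta' ∪
          (confident T P rule θ noise delta')ᶜ) := by rw [Set.union_compl_self, measure_univ]
      _ ≤ _ := measure_union_le _ _
      _ ≤ _ := by
          gcongr
          exact h1.trans (ENNReal.ofReal_le_ofReal hle)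
  exact h2.trans (measure_mono h)

end Regret

end RepLin

namespace RepLin

open scoped ENNReal

/-! ### Rounding on a randomly shifted grid -/

/-- Two reals at distance `r` fall in different cells of a uniformly shifted unit grid with
probability at most `r`: the integer translates of the interval between them cover it only once
modulo `1`. -/
theorem volume_floor_ne_le (x y : ℝ) :
    ((volume : Measure ℝ).restrict (Set.Ico 0 1)) {w | ⌊x - w⌋ ≠ ⌊y - w⌋} ≤
      ENNReal.ofReal |x - y| := by
  wlog hxy : x ≤ y generalizing x y
  · have := this y x (le_of_not_ge hxy)
    rw [abs_sub_comm]
    simpa only [ne_comm] using this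
  rw [Measure.restrict_apply (by
    refine (measurableSet_eq_fun ?_ ?_).compl
    · exact Int.measurable_floor.comp (measurable_const.sub measurable_id)
    · exact Int.measurable_floor.comp (measurable_const.sub measurable_id))]
  have hsub : {w | ⌊x - w⌋ ≠ ⌊y - w⌋} ∩ Set.Ico 0 1 ⊆
      ⋃ n : ℤ, (fun w => w + (n : ℝ)) ⁻¹' (Set.Ioc x y ∩ Set.Ico (n : ℝ) (n + 1)) := by
    rintro w ⟨hw, hw0, hw1⟩
    have hlt : ⌊x - w⌋ < ⌊y - w⌋ :=
      lt_of_le_of_ne (Int.floor_le_floor (by linarith)) hw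
    refine Set.mem_iUnion.2 ⟨⌊y - w⌋, ⟨?_, ?_⟩, ?_, ?_⟩
    · have := Int.floor_lt.1 hlt
      linarith
    · have := Int.floor_le (y - w)
      linarith
    · change (⌊y - w⌋ : ℝ) ≤ w + ⌊y - w⌋
      linarith
    · change w + (⌊y - w⌋ : ℝ) < ⌊y - w⌋ + 1
      linarith
  have hdisj : Pairwise (Function.onFun Disjoint fun n : ℤ =>
      Set.Ioc x y ∩ Set.Ico (n : ℝ) (n + 1)) := fun m n hmn =>
    (Set.pairwise_disjoint_Ico_intCast ℝ hmn).mono Set.inter_subset_right Set.inter_subset_right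
  calc _ ≤ volume (⋃ n : ℤ, (fun w => w + (n : ℝ)) ⁻¹'
        (Set.Ioc x y ∩ Set.Ico (n : ℝ) (n + 1))) := measure_mono hsub
    _ ≤ ∑' n : ℤ, volume ((fun w => w + (n : ℝ)) ⁻¹'
        (Set.Ioc x y ∩ Set.Ico (n : ℝ) (n + 1))) := measure_iUnion_le _
    _ = ∑' n : ℤ, volume (Set.Ioc x y ∩ Set.Ico (n : ℝ) (n + 1)) := by
        simp only [measure_preimage_add_right]
    _ = volume (⋃ n : ℤ, Set.Ioc x y ∩ Set.Ico (n : ℝ) (n + 1)) :=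
        (measure_iUnion hdisj fun n => measurableSet_Ioc.inter measurableSet_Ico).symm
    _ ≤ volume (Set.Ioc x y) := measure_mono (Set.iUnion_subset fun n => Set.inter_subset_left)
    _ = ENNReal.ofReal |x - y| := by
        rw [Real.volume_Ioc, abs_sub_comm, abs_of_nonneg (by linarith)]

theorem unitCube_gridRound_ne_le {d : ℕ} {α : ℝ} (hα : 0 < α) (z z' : Fin d → ℝ) :
    unitCube d {w | gridRound α (α • w) z ≠ gridRound α (α • w) z'} ≤
      ENNReal.ofReal (√(d : ℝ) * euclNorm (z - z') / α) := by
  have hfloor : ∀ (v w : Fin d → ℝ) (j : Fin d), (v j - (α • w) j) / α = v j / α - w j := by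
    intro v w j
    simp only [Pi.smul_apply, smul_eq_mul]
    field_simp
  have hsub : {w | gridRound α (α • w) z ≠ gridRound α (α • w) z'} ⊆
      ⋃ j : Fin d, Function.eval j ⁻¹' {w : ℝ | ⌊z j / α - w⌋ ≠ ⌊z' j / α - w⌋} := by
    intro w hw
    by_contra hcon
    simp only [Set.mem_iUnion, Set.mem_preimage, Set.mem_ofPred_eq, not_exists, not_not,
      Function.eval] at hcon
    refine hw ?_
    ext j
    simp only [gridRound, hfloor, hcon j]
  have hmeas : ∀ j : Fin d, MeasurableSet {w : ℝ | ⌊z j / α - w⌋ ≠ ⌊z' j / α - w⌋} := by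
    intro j
    refine (measurableSet_eq_fun ?_ ?_).compl
    · exact Int.measurable_floor.comp (measurable_const.sub measurable_id)
    · exact Int.measurable_floor.comp (measurable_const.sub measurable_id)
  have hprob : IsProbabilityMeasure ((volume : Measure ℝ).restrict (Set.Ico 0 1)) := ⟨by simp⟩
  calc _ ≤ ∑ j : Fin d, unitCube d
        (Function.eval j ⁻¹' {w : ℝ | ⌊z j / α - w⌋ ≠ ⌊z' j / α - w⌋}) :=
        (measure_mono hsub).trans (measure_iUnion_fintype_le _ _)
    _ = ∑ j : Fin d, ((volume : Measure ℝ).restrict (Set.Ico 0 1))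
        {w : ℝ | ⌊z j / α - w⌋ ≠ ⌊z' j / α - w⌋} := by
        refine Finset.sum_congr rfl fun j _ => ?_
        exact (measurePreserving_eval (fun _ : Fin d =>
          (volume : Measure ℝ).restrict (Set.Ico 0 1)) j).measure_preimage
          (hmeas j).nullMeasurableSet
    _ ≤ ∑ j : Fin d, ENNReal.ofReal |z j / α - z' j / α| :=
        Finset.sum_le_sum fun j _ => volume_floor_ne_le _ _
    _ = ENNReal.ofReal ((∑ j : Fin d, |(z - z') j|) / α) := by
        rw [← ENNReal.ofReal_sum_of_nonneg fun _ _ => abs_nonneg _, Finset.sum_div]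
        congr 1
        refine Finset.sum_congr rfl fun j _ => ?_
        rw [← sub_div, abs_div, abs_of_pos hα, Pi.sub_apply]
    _ ≤ _ := by
        gcongr
        exact sum_abs_le_sqrt_mul_euclNorm (z - z')

/-- The width of the grid is chosen so that two points within twice the confidence radius are
rounded differently with probability at most `ρ - 2 δ`. -/
theorem unitCube_gridRound_ne_le_gap {d : ℕ} (hd : 1 ≤ d) {β gap : ℝ} (hβ : 0 ≤ β)
    (hgap : 0 < gap) {z z' : Fin d → ℝ} (hz : euclNorm (z - z') ≤ 2 * β) :
    unitCube d {w | gridRound (2 * β * √(d : ℝ) / gap) ((2 * β * √(d : ℝ) / gap) • w) z ≠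
      gridRound (2 * β * √(d : ℝ) / gap) ((2 * β * √(d : ℝ) / gap) • w) z'} ≤
      ENNReal.ofReal gap := by
  have hd0 : 0 < √(d : ℝ) := Real.sqrt_pos.2 (by exact_mod_cast hd)
  rcases hβ.eq_or_lt with rfl | hpos
  · have : ∀ w : Fin d → ℝ, gridRound (2 * 0 * √(d : ℝ) / gap)
        ((2 * 0 * √(d : ℝ) / gap) • w) z =
        gridRound (2 * 0 * √(d : ℝ) / gap) ((2 * 0 * √(d : ℝ) / gap) • w) z' := by
      intro w; ext j; simp [gridRound]
    refine (measure_mono_null (t := ∅) ?_ measure_empty).trans_le zero_le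
    exact fun w hw => hw (this w)
  · refine (unitCube_gridRound_ne_le (by positivity) z z').trans
      (ENNReal.ofReal_le_ofReal ?_)
    rw [div_le_iff₀ (by positivity)]
    calc √(d : ℝ) * euclNorm (z - z') ≤ √(d : ℝ) * (2 * β) := by gcongr
      _ = _ := by field_simp

/-! ### Fresh randomness in every batch -/

/-- Resampling one coordinate does not change the law of the internal randomness. -/
theorem map_update_seedLaw (d b : ℕ) :
    ((seedLaw d).prod (unitCube d)).map (fun q => Function.update q.1 b q.2) = seedLaw d := by
  have hmeas : Measurable fun q : Seed d × (Fin d → ℝ) => Function.update q.1 b q.2 :=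
    measurable_update_nat b measurable_fst measurable_snd
  refine Measure.eq_infinitePi _ fun s t ht => ?_
  have hbox : MeasurableSet (Set.pi (s : Set ℕ) t) :=
    MeasurableSet.pi s.countable_toSet fun i _ => ht i
  rw [Measure.map_apply hmeas hbox]
  have hpi : ∀ s' : Finset ℕ, seedLaw d (Set.pi s' t) = ∏ i ∈ s', unitCube d (t i) := fun s' =>
    Measure.infinitePi_pi _ fun i _ => ht i
  by_cases hb : b ∈ s
  · have hpre : (fun q : Seed d × (Fin d → ℝ) => Function.update q.1 b q.2) ⁻¹'
        Set.pi (s : Set ℕ) t = Set.pi ((s.erase b : Finset ℕ) : Set ℕ) t ×ˢ t b := by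
      ext q
      simp only [Set.mem_preimage, Set.mem_pi, Set.mem_prod, Finset.mem_coe, Finset.mem_erase]
      constructor
      · intro h
        refine ⟨fun i hi => ?_, by simpa using h b hb⟩
        simpa [Function.update_of_ne hi.1] using h i hi.2
      · rintro ⟨h1, h2⟩ i hi
        by_cases hib : i = b
        · subst hib; simpa using h2
        · simpa [Function.update_of_ne hib] using h1 i ⟨hib, hi⟩
    rw [hpre, Measure.prod_prod, hpi, Finset.prod_erase_mul _ _ hb]
  · have hpre : (fun q : Seed d × (Fin d → ℝ) => Function.update q.1 b q.2) ⁻¹'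
        Set.pi (s : Set ℕ) t = Set.pi (s : Set ℕ) t ×ˢ Set.univ := by
      ext q
      simp only [Set.mem_preimage, Set.mem_pi, Set.mem_prod, Finset.mem_coe, Set.mem_univ,
        and_true]
      refine forall₂_congr fun i hi => ?_
      rw [Function.update_of_ne (show i ≠ b by rintro rfl; exact hb hi)]
    rw [hpre, Measure.prod_prod, hpi, measure_univ, mul_one]

/-- An event of the internal randomness has probability at most `r` if it does so conditionally on
all coordinates but one. -/
theorem seedLaw_le_of_update {d b : ℕ} {W : Set (Seed d)} (hW : MeasurableSet W) {r : ℝ≥0∞}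
    (h : ∀ w, unitCube d {u | Function.update w b u ∈ W} ≤ r) : seedLaw d W ≤ r := by
  have hmeas : Measurable fun q : Seed d × (Fin d → ℝ) => Function.update q.1 b q.2 :=
    measurable_update_nat b measurable_fst measurable_snd
  rw [← map_update_seedLaw d b, Measure.map_apply hmeas hW, Measure.prod_apply (hmeas hW)]
  calc _ ≤ ∫⁻ _, r ∂(seedLaw d) := lintegral_mono fun w => h w
    _ = r := by simp

open Classical in
/-- The run stopped at the start of batch `b`. Its state involves the seeds of the batches before
`b` only. -/
noncomputable def stoppedRun {d : ℕ} {E : Type*} (P : Params)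
    (rule : ℕ → ScoreArg d → Fin d → ℝ) (θ : Fin d → ℝ) (noise : Noise d E) (b : ℕ)
    (w : Seed d) (ω : E) : ℕ → State d
  | 0 => State.init d
  | t + 1 =>
    if b ≤ (stoppedRun P rule θ noise b w ω t).batch then stoppedRun P rule θ noise b w ω t
    else step P rule θ noise w ω t (stoppedRun P rule θ noise b w ω t)

section Stopped

variable {d : ℕ} {E : Type*} (P : Params) (rule : ℕ → ScoreArg d → Fin d → ℝ)
  (θ : Fin d → ℝ) (noise : Noise d E)

theorem measurable_stoppedRun [MeasurableSpace E] {P : Params}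
    {rule : ℕ → ScoreArg d → Fin d → ℝ} {noise : Noise d E}
    (hM : MeasurableModel P rule noise) (b t : ℕ) :
    Measurable fun p : Seed d × E => stoppedRun P rule θ noise b p.1 p.2 t := by
  induction t with
  | zero => exact measurable_const
  | succ t ih =>
    simp only [stoppedRun]
    refine Measurable.ite ?_ ih (measurable_step θ hM t measurable_fst measurable_snd ih)
    exact ((measurable_state_batch d).comp ih) (measurableSet_le measurable_const measurable_id :
      MeasurableSet {n : ℕ | b ≤ n})

theorem step_update_seed (w : Seed d) (ω : E) (b : ℕ) (u : Fin d → ℝ) (t : ℕ) (st : State d)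
    (h : st.batch ≠ b) :
    step P rule θ noise (Function.update w b u) ω t st = step P rule θ noise w ω t st := by
  simp only [step, chooseAction, batchEstimate, Function.update_of_ne h]

theorem stoppedRun_update_seed (w : Seed d) (ω : E) (b : ℕ) (u : Fin d → ℝ) (t : ℕ) :
    stoppedRun P rule θ noise b (Function.update w b u) ω t =
      stoppedRun P rule θ noise b w ω t := by
  induction t with
  | zero => rfl
  | succ t ih =>
    simp only [stoppedRun, ih]
    split_ifs with h
    · rfl
    · exact step_update_seed P rule θ noise w ω b u t _ (by omega)

theorem step_batch_cases (w : Seed d) (ω : E) (t : ℕ) (st : State d) :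
    (step P rule θ noise w ω t st).batch = st.batch + 1 ∨
    ((step P rule θ noise w ω t st).batch = st.batch ∧
      (step P rule θ noise w ω t st).start = st.start) := by
  unfold step
  rcases update_cases P t st (chooseAction P rule w t st) (chooseAction P rule w t st ⬝ᵥ θ +
      noise t ω (fun s => Function.update st.actions t (chooseAction P rule w t st) (s : ℕ)))
    with ⟨_, h, _⟩ | ⟨_, h⟩
  · exact Or.inl h
  · exact Or.inr h

/-- During batch `b` the stopped run and the run have the same batch data. -/
theorem stoppedRun_spec (b : ℕ) (p : Seed d × E) (t : ℕ) :
    ((run P rule θ noise p.1 p.2 t).batch < b →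
      stoppedRun P rule θ noise b p.1 p.2 t = run P rule θ noise p.1 p.2 t) ∧
    ((run P rule θ noise p.1 p.2 t).batch = b →
      (stoppedRun P rule θ noise b p.1 p.2 t).batch = b ∧
      (stoppedRun P rule θ noise b p.1 p.2 t).start = (run P rule θ noise p.1 p.2 t).start ∧
      ∀ i < (run P rule θ noise p.1 p.2 t).start,
        (stoppedRun P rule θ noise b p.1 p.2 t).actions i = action P rule θ noise i p ∧
        (stoppedRun P rule θ noise b p.1 p.2 t).rewards i = reward P rule θ noise i p) := by
  induction t with
  | zero => exact ⟨fun _ => rfl, fun h => ⟨h, rfl, fun i hi => absurd hi (Nat.not_lt_zero i)⟩⟩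
  | succ t ih =>
    have hstep : (run P rule θ noise p.1 p.2 t).batch < b →
        stoppedRun P rule θ noise b p.1 p.2 (t + 1) = run P rule θ noise p.1 p.2 (t + 1) := by
      intro h
      rw [run_succ, ← ih.1 h]
      simp only [stoppedRun]
      rw [if_neg]
      rw [ih.1 h]
      omega
    have hcases := step_batch_cases P rule θ noise p.1 p.2 t (run P rule θ noise p.1 p.2 t)
    rw [← run_succ] at hcases
    refine ⟨fun h => hstep (by omega), fun h => ?_⟩
    by_cases hlt : (run P rule θ noise p.1 p.2 t).batch < b
    · rw [hstep hlt]
      refine ⟨h, rfl, fun i hi => ?_⟩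
      have := run_start_le P rule θ noise p (t + 1)
      exact run_data P rule θ noise p (t + 1) i (by omega)
    · have hb : (run P rule θ noise p.1 p.2 t).batch = b := by omega
      have hs : (run P rule θ noise p.1 p.2 (t + 1)).start =
          (run P rule θ noise p.1 p.2 t).start := by
        rcases hcases with h' | h'
        · omega
        · exact h'.2
      have hfrozen : stoppedRun P rule θ noise b p.1 p.2 (t + 1) =
          stoppedRun P rule θ noise b p.1 p.2 t := by
        simp only [stoppedRun]
        rw [if_pos (ih.2 hb).1.ge]
      rw [hfrozen, hs]
      exact ih.2 hb

theorem stoppedRun_eq_of_le (b : ℕ) (w : Seed d) (ω : E) {t T : ℕ} (htT : t ≤ T)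
    (h : b ≤ (stoppedRun P rule θ noise b w ω t).batch) :
    stoppedRun P rule θ noise b w ω T = stoppedRun P rule θ noise b w ω t := by
  induction T, htT using Nat.le_induction with
  | base => rfl
  | succ T _ ih =>
    simp only [stoppedRun]
    rw [if_pos (by rwa [ih]), ih]

/-! ### Replicability -/

/-- The schedule of the batches is determined by the actions. -/
theorem run_schedule_congr {p p' : Seed d × E} (t : ℕ)
    (h : ∀ i < t, action P rule θ noise i p = action P rule θ noise i p') :
    (run P rule θ noise p.1 p.2 t).batch = (run P rule θ noise p'.1 p'.2 t).batch ∧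
    (run P rule θ noise p.1 p.2 t).start = (run P rule θ noise p'.1 p'.2 t).start := by
  induction t with
  | zero => exact ⟨rfl, rfl⟩
  | succ t ih =>
    obtain ⟨hb, hs⟩ := ih fun i hi => h i (by omega)
    have hg : ∀ n ≤ t + 1, gram P.lam n
        (Function.update (run P rule θ noise p.1 p.2 t).actions t
          (chooseAction P rule p.1 t (run P rule θ noise p.1 p.2 t))) =
        gram P.lam n (Function.update (run P rule θ noise p'.1 p'.2 t).actions t
          (chooseAction P rule p'.1 t (run P rule θ noise p'.1 p'.2 t))) := by
      intro n hn
      refine gram_congr P.lam fun i hi => ?_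
      rw [run_update_data P rule θ noise p t i (by omega),
        run_update_data P rule θ noise p' t i (by omega), h i (by omega)]
    have hstart := run_start_le P rule θ noise p t
    rw [run_succ, run_succ, step, step]
    unfold State.update
    dsimp only
    rw [hg (t + 1) le_rfl, hg _ (hstart.trans (by omega)), hb, hs]
    split_ifs <;> exact ⟨rfl, rfl⟩

/-- The vector to be rounded at the start of a batch. -/
noncomputable def stateWhitened (P : Params) (st : State d) : Fin d → ℝ :=
  whitened P.lam st.start st.actions st.rewards

/-- The confidence radius at the start of a batch with confidence `δ`. -/
noncomputable def stateRadius (P : Params) (delta : ℝ) (st : State d) : ℝ :=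
  confRadius P.sigma P.S P.lam delta st.start st.actions

attribute [local irreducible] whitened confRadius

theorem measurable_stateWhitened {P : Params} (hlam : 0 < P.lam) :
    Measurable (stateWhitened (d := d) P) :=
  measurable_comp_countable (f := fun n (q : (ℕ → Fin d → ℝ) × (ℕ → ℝ)) =>
      whitened P.lam n q.1 q.2) (fun n => (continuous_whitened hlam n).measurable)
    (measurable_state_start d) ((measurable_state_actions d).prodMk (measurable_state_rewards d))

theorem measurable_stateRadius {P : Params} (hlam : 0 < P.lam) {delta : ℝ} (hdelta : 0 < delta) :
    Measurable (stateRadius (d := d) P delta) :=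
  measurable_comp_countable (f := fun n (x : ℕ → Fin d → ℝ) =>
      confRadius P.sigma P.S P.lam delta n x)
    (fun n => (continuous_confRadius P.sigma P.S hlam hdelta n).measurable)
    (measurable_state_start d) (measurable_state_actions d)

/-- The event that the shared seed of batch `b` separates two executions whose batch data are
within the confidence radius of each other. -/
def separated (P : Params) (rule : ℕ → ScoreArg d → Fin d → ℝ) (θ : Fin d → ℝ)
    (noise : Noise d E) (T : ℕ) (delta gap : ℝ) (b : ℕ) : Set (Seed d × E × E) :=
  {p | euclNorm (stateWhitened P (stoppedRun P rule θ noise b p.1 p.2.1 T) -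
        stateWhitened P (stoppedRun P rule θ noise b p.1 p.2.2 T)) ≤
      2 * stateRadius P delta (stoppedRun P rule θ noise b p.1 p.2.1 T) ∧
    gridRound (2 * stateRadius P delta (stoppedRun P rule θ noise b p.1 p.2.1 T) * √(d : ℝ) / gap)
      ((2 * stateRadius P delta (stoppedRun P rule θ noise b p.1 p.2.1 T) * √(d : ℝ) / gap) •
        p.1 b) (stateWhitened P (stoppedRun P rule θ noise b p.1 p.2.1 T)) ≠
    gridRound (2 * stateRadius P delta (stoppedRun P rule θ noise b p.1 p.2.1 T) * √(d : ℝ) / gap)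
      ((2 * stateRadius P delta (stoppedRun P rule θ noise b p.1 p.2.1 T) * √(d : ℝ) / gap) •
        p.1 b) (stateWhitened P (stoppedRun P rule θ noise b p.1 p.2.2 T))}

attribute [local irreducible] stateWhitened stateRadius gridRound stoppedRun

theorem measurableSet_separated [MeasurableSpace E] {P : Params}
    {rule : ℕ → ScoreArg d → Fin d → ℝ} {noise : Noise d E}
    (hM : MeasurableModel P rule noise) (T : ℕ) {delta : ℝ} (hdelta : 0 < delta) (gap : ℝ)
    (b : ℕ) : MeasurableSet (separated P rule θ noise T delta gap b) := by
  have hs := measurable_stoppedRun θ hM b T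
  have h1 : Measurable fun p : Seed d × E × E => stoppedRun P rule θ noise b p.1 p.2.1 T :=
    hs.comp (measurable_fst.prodMk measurable_snd.fst)
  have h2 : Measurable fun p : Seed d × E × E => stoppedRun P rule θ noise b p.1 p.2.2 T :=
    hs.comp (measurable_fst.prodMk measurable_snd.snd)
  have hz := measurable_stateWhitened (d := d) hM.lam_pos
  have hz1 := hz.comp h1
  have hz2 := hz.comp h2
  have hr := (measurable_stateRadius (d := d) hM.lam_pos hdelta).comp h1
  have hα := ((hr.const_mul 2).mul_const √(d : ℝ)).div_const gap
  have hu : Measurable fun p : Seed d × E × E => p.1 b :=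
    (measurable_pi_apply b).comp measurable_fst
  have hnorm : Measurable fun z : Fin d → ℝ => euclNorm z := by
    simp only [euclNorm_eq_sqrt]
    exact (measurable_dotProduct' measurable_id measurable_id).sqrt
  refine MeasurableSet.inter ?_ ?_
  · exact measurableSet_le (hnorm.comp (hz1.sub hz2)) (hr.const_mul 2)
  · refine (measurableSet_eq_fun ?_ ?_).compl
    · exact measurable_gridRound.comp (hα.prodMk ((hα.smul hu).prodMk hz1))
    · exact measurable_gridRound.comp (hα.prodMk ((hα.smul hu).prodMk hz2))

/-- The seed of batch `b` is independent of the data of the batch, so it separates two executions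
with probability at most `ρ_b - 2 δ_b`. -/
theorem measure_separated_le [MeasurableSpace E] {P : Params}
    {rule : ℕ → ScoreArg d → Fin d → ℝ} {noise : Noise d E}
    (hM : MeasurableModel P rule noise) (hd : 1 ≤ d) (hs : 0 ≤ P.sigma) (hS : 0 ≤ P.S) (T : ℕ)
    {delta gap : ℝ} (hdelta : 0 < delta) (hgap : 0 < gap) (b : ℕ) {ν : Measure (E × E)}
    [IsProbabilityMeasure ν] :
    ((seedLaw d).prod ν) (separated P rule θ noise T delta gap b) ≤ ENNReal.ofReal gap := by
  have hmeas := measurableSet_separated θ hM T hdelta gap b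
  rw [Measure.prod_apply_symm hmeas]
  calc _ ≤ ∫⁻ _, ENNReal.ofReal gap ∂ν := lintegral_mono fun ω => ?_
    _ = ENNReal.ofReal gap := by simp
  refine seedLaw_le_of_update (b := b) (measurable_prodMk_right hmeas) fun w => ?_
  have hβ : 0 ≤ stateRadius P delta (stoppedRun P rule θ noise b w ω.1 T) := by
    unfold stateRadius
    exact confRadius_nonneg _ hs hS _ _
  by_cases hz : euclNorm (stateWhitened P (stoppedRun P rule θ noise b w ω.1 T) -
        stateWhitened P (stoppedRun P rule θ noise b w ω.2 T)) ≤
      2 * stateRadius P delta (stoppedRun P rule θ noise b w ω.1 T)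
  · refine le_trans (measure_mono ?_) (unitCube_gridRound_ne_le_gap hd hβ hgap hz)
    intro u hu
    have h2 := hu.2
    simp only [stoppedRun_update_seed, Function.update_self] at h2
    exact h2
  · refine (measure_mono_null (t := ∅) ?_ measure_empty).trans_le zero_le
    intro u hu
    have h1 := hu.1
    simp only [stoppedRun_update_seed] at h1
    exact hz h1

/-- On the confidence events, two executions with the same seed that play different actions are
separated by the seed of some batch. -/
theorem exists_separated_of_action_ne {P : Params}
    {rule : ℕ → ScoreArg d → Fin d → ℝ} {noise : Noise d E} {T : ℕ} (hlam : 0 < P.lam)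
    (hB : 1 ≤ P.B)
    {delta rho : ℝ} (hdelta : ∀ b, P.deltaB b = delta) (hrho : ∀ b, P.rhoB b = rho)
    {w : Seed d} {ω ω' : E} (hp : (w, ω) ∈ confident T P rule θ noise delta)
    (hp' : (w, ω') ∈ confident T P rule θ noise delta)
    (hne : ∃ t < T, action P rule θ noise t (w, ω) ≠ action P rule θ noise t (w, ω')) :
    ∃ b < P.B, (w, ω, ω') ∈ separated P rule θ noise T delta (rho - 2 * delta) b := by
  classical
  obtain ⟨htT, hneq⟩ := Nat.find_spec hne
  set t := Nat.find hne with ht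
  have hagree : ∀ i < t, action P rule θ noise i (w, ω) = action P rule θ noise i (w, ω') := by
    intro i hi
    by_contra h
    exact Nat.find_min hne hi ⟨by omega, h⟩
  obtain ⟨hb, hs⟩ := run_schedule_congr P rule θ noise (p := (w, ω)) (p' := (w, ω')) t hagree
  have hstart := run_start_le P rule θ noise (w, ω) t
  have hdata := run_data P rule θ noise (w, ω) t
  have hdata' := run_data P rule θ noise (w, ω') t
  have hbB := run_batch_lt P rule θ noise hB (w, ω) t
  dsimp only at hb hs hstart hdata hdata' hbB
  have hspec := (stoppedRun_spec P rule θ noise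
    (run P rule θ noise w ω t).batch (w, ω) t).2 rfl
  have hspec' := (stoppedRun_spec P rule θ noise
    (run P rule θ noise w ω t).batch (w, ω') t).2 hb.symm
  dsimp only at hspec hspec'
  rw [← hs] at hspec'
  have hT := stoppedRun_eq_of_le P rule θ noise _ w ω htT.le hspec.1.ge
  have hT' := stoppedRun_eq_of_le P rule θ noise _ w ω' htT.le hspec'.1.ge
  rw [← hT] at hspec
  rw [← hT'] at hspec'
  set st := run P rule θ noise w ω t
  set st' := run P rule θ noise w ω' t
  set x := fun i => action P rule θ noise i (w, ω)
  have hx' : ∀ i < st.start, action P rule θ noise i (w, ω') = x i :=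
    fun i hi => (hagree i (by omega)).symm
  have hz : stateWhitened P (stoppedRun P rule θ noise st.batch w ω T) =
      whitened P.lam st.start x fun i => reward P rule θ noise i (w, ω) := by
    unfold stateWhitened
    rw [hspec.2.1]
    exact whitened_congr _ (fun i hi => (hspec.2.2 i hi).1) fun i hi => (hspec.2.2 i hi).2
  have hz' : stateWhitened P (stoppedRun P rule θ noise st.batch w ω' T) =
      whitened P.lam st.start x fun i => reward P rule θ noise i (w, ω') := by
    unfold stateWhitened
    rw [hspec'.2.1]
    exact whitened_congr _ (fun i hi => (hspec'.2.2 i hi).1.trans (hx' i hi))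
      fun i hi => (hspec'.2.2 i hi).2
  have hr : stateRadius P delta (stoppedRun P rule θ noise st.batch w ω T) =
      confRadius P.sigma P.S P.lam delta st.start x := by
    unfold stateRadius
    rw [hspec.2.1]
    exact confRadius_congr _ _ _ _ fun i hi => (hspec.2.2 i hi).1
  have hV := gram_posDef hlam st.start x
  have hc := hp st.start (by omega)
  have hc' := hp' st.start (by omega)
  rw [gram_congr P.lam hx', ridge_congr P.lam hx' fun i _ => rfl,
    confRadius_congr _ _ _ _ hx'] at hc'
  refine ⟨st.batch, hbB, ?_, ?_⟩
  · dsimp only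
    rw [hz, hz', hr, whitened, whitened, ← Matrix.mulVec_sub, ← matNorm_eq_euclNorm hV]
    have hsplit : (ridge P.lam st.start x fun i => reward P rule θ noise i (w, ω)) -
        (ridge P.lam st.start x fun i => reward P rule θ noise i (w, ω')) =
        ((ridge P.lam st.start x fun i => reward P rule θ noise i (w, ω)) - θ) +
        (-1 : ℝ) • ((ridge P.lam st.start x fun i => reward P rule θ noise i (w, ω')) - θ) := by
      rw [neg_smul, one_smul]; abel
    rw [hsplit]
    refine (matNorm_add_le hV _ _).trans ?_
    rw [matNorm_smul hV, abs_neg, abs_one, one_mul]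
    linarith
  · dsimp only
    rw [hz, hz', hr]
    intro heq
    refine hneq ?_
    -- equal roundings give equal estimates, hence the same action
    have hest : batchEstimate P w st = batchEstimate P w st' := by
      rw [batchEstimate, batchEstimate, ← hb, ← hs, hdelta, hrho,
        repRidge_congr _ _ _ _ _ _ (fun i hi => (hdata i (by omega)).1)
          (fun i hi => (hdata i (by omega)).2),
        repRidge_congr (x := st'.actions) _ _ _ _ _ _
          (fun i hi => ((hdata' i (by omega)).1.trans (hx' i hi)))
          (fun i hi => (hdata' i (by omega)).2), repRidge_eq, repRidge_eq]
      exact congrArg _ heq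
    have hst : ∀ i < st.start, st.actions i = st'.actions i := fun i hi =>
      (hdata i (by omega)).1.trans (((hdata' i (by omega)).1.trans (hx' i hi)).symm)
    have hrad : batchRadius P st = batchRadius P st' := by
      rw [batchRadius, batchRadius, ← hb, ← hs, confRadius_congr _ _ _ _ hst]
    change chooseAction P rule w t st = chooseAction P rule w t st'
    rw [chooseAction, chooseAction, hest, hrad, ← hs, gram_congr P.lam hst]

end Stopped

/-- Replicability: outside the two confidence events a disagreement needs a separating seed, and a
union bound over the batches adds up the budgets. -/
theorem replicable_of_budget {d : ℕ} {E : Type*} [MeasurableSpace E] {envLaw : Measure E}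
    [IsProbabilityMeasure envLaw] {T : ℕ} {P : Params} {rule : ℕ → ScoreArg d → Fin d → ℝ}
    {θ : Fin d → ℝ} {noise : Noise d E} (hM : MeasurableModel P rule noise) (hd : 1 ≤ d)
    (hs : 0 ≤ P.sigma) (hθ : euclNorm θ ≤ P.S) (hB : 1 ≤ P.B)
    (hsub : CondSubGaussian T P rule θ noise envLaw) {delta' rho' rho : ℝ}
    (hdelta' : 0 < delta') (hgap : 0 < rho' - 2 * delta') (hdeltaB : ∀ b, P.deltaB b = delta')
    (hrhoB : ∀ b, P.rhoB b = rho') (hsum : 2 * delta' + P.B * (rho' - 2 * delta') ≤ rho) :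
    Replicable T P rule θ noise envLaw rho := by
  have hS : 0 ≤ P.S := (euclNorm_nonneg θ).trans hθ
  set μ := (seedLaw d).prod (envLaw.prod envLaw) with hμ
  set ok : Set (Seed d × E × E) := {p | ∀ t < T,
      action P rule θ noise t (p.1, p.2.1) = action P rule θ noise t (p.1, p.2.2)} with hok
  have hconf := measure_compl_confident_le hM hs hθ hsub hdelta'
  have hmp1 : MeasurePreserving (fun p : Seed d × E × E => (p.1, p.2.1)) μ
      ((seedLaw d).prod envLaw) := (MeasurePreserving.id _).prod measurePreserving_fst
  have hmp2 : MeasurePreserving (fun p : Seed d × E × E => (p.1, p.2.2)) μ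
      ((seedLaw d).prod envLaw) := (MeasurePreserving.id _).prod measurePreserving_snd
  have h1 := (hmp1.measure_preimage_le (confident T P rule θ noise delta')ᶜ).trans hconf
  have h2 := (hmp2.measure_preimage_le (confident T P rule θ noise delta')ᶜ).trans hconf
  have hcover : okᶜ ⊆ ((fun p : Seed d × E × E => (p.1, p.2.1)) ⁻¹'
        (confident T P rule θ noise delta')ᶜ ∪
      (fun p : Seed d × E × E => (p.1, p.2.2)) ⁻¹' (confident T P rule θ noise delta')ᶜ) ∪
      ⋃ b ∈ Finset.range P.B, separated P rule θ noise T delta' (rho' - 2 * delta') b := by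
    rintro ⟨w, ω, ω'⟩ hp
    by_cases hc : (w, ω) ∈ confident T P rule θ noise delta'
    · by_cases hc' : (w, ω') ∈ confident T P rule θ noise delta'
      · right
        have hne : ∃ t < T, action P rule θ noise t (w, ω) ≠ action P rule θ noise t (w, ω') := by
          simpa [hok] using hp
        obtain ⟨b, hb, hsep⟩ := exists_separated_of_action_ne θ hM.lam_pos hB hdeltaB hrhoB
          hc hc' hne
        exact Set.mem_biUnion (Finset.mem_coe.2 (Finset.mem_range.2 hb)) hsep
      · exact Or.inl (Or.inr hc')
    · exact Or.inl (Or.inl hc)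
  have hbad : μ okᶜ ≤ ENNReal.ofReal rho := by
    calc μ okᶜ ≤ (ENNReal.ofReal delta' + ENNReal.ofReal delta') +
          ∑ b ∈ Finset.range P.B, ENNReal.ofReal (rho' - 2 * delta') := by
          refine (measure_mono hcover).trans ((measure_union_le _ _).trans ?_)
          refine add_le_add ((measure_union_le _ _).trans (add_le_add h1 h2)) ?_
          refine (measure_biUnion_finset_le _ _).trans (Finset.sum_le_sum fun b _ => ?_)
          exact measure_separated_le θ hM hd hs hS T hdelta' hgap b
      _ = ENNReal.ofReal (2 * delta' + P.B * (rho' - 2 * delta')) := by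
          rw [Finset.sum_const, Finset.card_range, nsmul_eq_mul,
            ENNReal.ofReal_add (by positivity) (by positivity), two_mul,
            ENNReal.ofReal_add hdelta'.le hdelta'.le, ENNReal.ofReal_mul (by positivity),
            ENNReal.ofReal_natCast]
      _ ≤ ENNReal.ofReal rho := ENNReal.ofReal_le_ofReal hsum
  have hrho0 : 0 ≤ rho := le_trans (by positivity) hsum
  change ENNReal.ofReal (1 - rho) ≤ μ ok
  rw [ENNReal.ofReal_sub _ hrho0, ENNReal.ofReal_one, tsub_le_iff_right]
  calc (1 : ℝ≥0∞) = μ (ok ∪ okᶜ) := by rw [Set.union_compl_self, measure_univ]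
    _ ≤ μ ok + μ okᶜ := measure_union_le _ _
    _ ≤ _ := by gcongr

end RepLin

/-! ### Replicability and regret for the chosen parameters -/

theorem mainTheorem2 :
    ∃ C : ℝ, 0 < C ∧ ∃ K : ℝ → ℝ → ℝ → ℝ → ℝ,
    ∀ (d T : ℕ) (sigma S lam L delta rho : ℝ),
      1 ≤ d → 1 ≤ T → 0 ≤ sigma → 0 ≤ S → 0 < lam → 0 < L →
      0 < delta → delta < 1 → 3 * delta < rho → rho < 1 →
    ∀ (A : ℕ → Set (Fin d → ℝ)),
      (∀ t < T, IsCompact (A t) ∧ (A t).Nonempty ∧ ∀ a ∈ A t, euclNorm a ≤ L) →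
    ∀ (rule : ℕ → ScoreArg d → Fin d → ℝ), IsArgmaxRule T A rule →
    ∀ (θ : Fin d → ℝ), euclNorm θ ≤ S →
    ∀ (aStar : ℕ → Fin d → ℝ),
      (∀ t < T, aStar t ∈ A t ∧ ∀ a ∈ A t, a ⬝ᵥ θ ≤ aStar t ⬝ᵥ θ) →
    ∀ (E : Type*) [MeasurableSpace E] (envLaw : Measure E) [IsProbabilityMeasure envLaw]
      (noise : Noise d E),
      (∀ t, Measurable fun p : E × (Fin (t + 1) → Fin d → ℝ) => noise t p.1 p.2) →
      CondSubGaussian T (mainParams d T sigma S lam L delta rho) rule θ noise envLaw →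
    -- replicability
    Replicable T (mainParams d T sigma S lam L delta rho) rule θ noise envLaw rho ∧
    -- the regret bound; the constant is `C` as soon as `L ^ 2 ≤ lam`
    RegretAtMost T (mainParams d T sigma S lam L delta rho) rule θ noise envLaw aStar delta
      (C * max 1 (L / √lam) * radiusBound d T sigma S lam L delta rho *
        √(T * logDet d T lam L)) ∧
    -- the regret bound when the loss of every single round is at most `G`
    (∀ G : ℝ, (∀ t < T, ∀ a ∈ A t, aStar t ⬝ᵥ θ - a ⬝ᵥ θ ≤ G) →
      RegretAtMost T (mainParams d T sigma S lam L delta rho) rule θ noise envLaw aStar delta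
        (C * max G (radiusBound d T sigma S lam L delta rho) *
          √(T * logDet d T lam L))) ∧
    -- the rate in `d`, `T`, `rho`, up to logarithmic factors
    RegretAtMost T (mainParams d T sigma S lam L delta rho) rule θ noise envLaw aStar delta
      (K sigma S lam L * (d + d ^ 3 / rho) * √T *
        Real.log (Real.exp 1 + d * T / delta) ^ 2) := by
  -- `48` is the `24` of `loss_le_and_potential_le` times the `2` of `sum_le_of_le_mul_sqrt`
  refine ⟨48, by norm_num, fun sigma S lam L => 48 * max 1 (L / √lam) *
    ((2 * sigma * √(Real.log (1 + L ^ 2 / lam) + 1) + √lam * S) *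
      (2 * (Real.log (1 + L ^ 2 / lam) + 1) * √(Real.log (1 + L ^ 2 / lam) + 1))), ?_⟩
  intro d T sigma S lam L delta rho hd hT hs hS hlam hL hdelta hdelta1 hrho hrho1 A hA rule hrule
    θ hθ aStar haStar E _ envLaw _ noise hnoise hsub
  have hB := one_le_numBatches hd hT hlam hL
  have hB' : (1 : ℝ) ≤ numBatches d T lam L := by exact_mod_cast hB
  have hB0 : (0 : ℝ) < numBatches d T lam L := by linarith
  have hdeltaB : 0 < delta / numBatches d T lam L := div_pos hdelta hB0
  have hle : delta / numBatches d T lam L ≤ delta := div_le_self hdelta.le hB'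
  have hM : MeasurableModel (mainParams d T sigma S lam L delta rho) rule noise :=
    ⟨hlam, fun _ => hdeltaB, hrule.measurable, hnoise⟩
  have hAL : ∀ t < T, ∀ a ∈ A t, euclNorm a ≤ L := fun t ht => (hA t ht).2.2
  have hmem : ∀ t < T, aStar t ∈ A t := fun t ht => (haStar t ht).1
  have hreg := fun p hp => regret_le_of_confident hd hT hs hS hlam hL hdelta hdelta1 hrho hAL
    hrule hθ hmem (noise := noise) (p := p) hp
  refine ⟨?_, ?_, fun G hG => ?_, ?_⟩
  · refine replicable_of_budget hM hd hs hθ hB hsub hdeltaB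
      (rho' := rho / numBatches d T lam L) ?_ (fun _ => rfl) (fun _ => rfl) ?_
    · rw [← mul_div_assoc, ← sub_div]
      exact div_pos (by linarith) hB0
    · have h1 : ((mainParams d T sigma S lam L delta rho).B : ℝ) *
          (rho / numBatches d T lam L - 2 * (delta / numBatches d T lam L)) =
          rho - 2 * delta := by
        change (numBatches d T lam L : ℝ) * _ = _
        field_simp
      rw [h1]
      linarith
  · exact regretAtMost_of_confident hM hs hθ hsub hdeltaB hle hreg
  · exact regretAtMost_of_confident hM hs hθ hsub hdeltaB hle fun p hp =>
      regret_le_of_confident_of_loss_le hd hT hs hS hlam hL hdelta hdelta1 hrho hAL hrule hθ hmem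
        hG hp
  · refine regretAtMost_of_confident hM hs hθ hsub hdeltaB hle fun p hp => (hreg p hp).trans ?_
    have h := regretBound_le_rate hd hT hs hS hlam hL hdelta hdelta1
      (show 0 < rho by linarith)
    have h0 : 0 ≤ 48 * max 1 (L / √lam) :=
      mul_nonneg (by norm_num) (zero_le_one.trans (le_max_left _ _))
    have h1 := mul_le_mul_of_nonneg_left h h0
    refine le_trans (le_of_eq (by ring)) (h1.trans (le_of_eq (by ring)))
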